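/- Theorem 1.2. Let $\mathcal L$ be a connected oriented link diagram on the sphere (or in the plane), with a linear order on its crossings, a checkerboard coloring of its regions and a marked ("dotted") arc. *Khovanov complex.* An enhanced state is a resolved state $\sigma$ (an $A$- or $B$-smoothing of every crossing) together with a label in $\{1,x\}$ on each of its circles. Put $i=\#\{B\text{-smoothed crossings}\}-n_-$ and $j=i+\#\{\text{labels }1\}-\#\{\text{labels }x\}+n_+-n_-$, where $n_\pm$ is the number of positive/negative crossings. $CKh^{i,j}(\mathcal L)$ is the free abelian group on the enhanced states of bidegree $(i,j)$, and $\partial_{Kh}:CKh^{i,j}\to CKh^{i+1,j}$ is the sum, over the $A$-smoothed crossings $e$, of $(-1)^{\#\{B\text{-smoothed } f<e\}}$ times the map changing $e$ to its $B$-smoothing, given by $m$ with $m(1,1)=1$, $m(1,x)=m(x,1)=x$, $m(x,x)=0$ if two circles merge, and by $\Delta(1)=1\otimes x+x\otimes 1$, $\Delta(x)=x\otimes x$ if a circle splits. $Kh(\mathcal L)$ is its cohomology. The Hasse diagram has the enhanced states as vertices and an edge $s\to t$ of weight $[s:t]$ whenever the coefficient $[s:t]$ of $t$ in $\partial_{Kh}s$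 is nonzero. *Tait graph and activities.* The Tait graph $G_{\mathcal L}$ has the black regions as vertices and the crossings as edges; an edge is positive if the $A$-smoothing connects the black regions at the crossing, and negative otherwise. For a spanning tree $T$, an edge $e\in T$ is live if it is the least edge among those that reconnect $T\setminus e$, and an edge $e\notin T$ is live if it is the least edge of the cycle in $T\cup e$; the other edges are dead. The state $\sigma_T$ is $B$ on a positive edge if it is live in $T$ or dead outside $T$, and $A$ otherwise; on negative edges $A$ and $B$ are interchanged. The generators of $CKh(U(T))$ are the enhanced states that are smoothed as in $\sigma_T$ at the dead edges of $T$. $G(T)$ is the tree whose vertices are the circles of $\sigma_T$ and whose edges are the live edges of $T$, each joining the two circles at its crossing; its root $v_d$ is the circle through the dotted arc. A live edge is a negative twist if it is $B$-smoothed in $\sigma_T$, and a positive twist otherwise. States of $U(T)$ correspond to spanning subgraphs $H$ of $G(T)$ (the live edges smoothed differently from $\sigma_T$), their circles to the components of $H$. *Matching.* The generators $(H,\epsilon)$ of $CKh(U(T))$ are matched recursively. Let $e$ be the least edge of the current tree (initially $G(T)$) that has an end $v\ne v_d$ of degree one. If the component $C_v$ of $v$ in $H$ has more than one vertex, $(H,\epsilon)$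 is paired with $(H\setminus e,\epsilon')$, where $\epsilon'(\{v\})$ is $x$ if $e$ is a negative twist and $1$ if it is a positive twist, $\epsilon'(C_v\setminus v)=\epsilon(C_v)$, and all other labels are unchanged. The generators left over, in which $v$ is isolated with label $1$ (negative twist) or $x$ (positive twist), are paired as in the tree without $e$ and $v$, with the label of $v$ kept. Let $\mathcal M$ be the set of edges of the Hasse diagram of $CKh(\mathcal L)$ whose ends are paired in this way for some $T$. Let $S_c^{T^\pm}$ be the enhanced state with underlying state $\sigma_T$ whose label on $v_d$ is $1$ for $T^+$ and $x$ for $T^-$, and whose label on any other vertex $v$ is $1$ if the edge with which $v$ is removed in the recursion is a negative twist, and $x$ if it is a positive twist. *Spanning tree complex.* An alternating path is a directed path in the Hasse diagram with the edges of $\mathcal M$ reversed; its weight is the product of the $[s:t]$ over its unreversed edges $s\to t$ and of the $-1/[s:t]$ over its reversed edges $t\to s$. $CST^{i,j}(G_{\mathcal L})$ is the free abelian group on the signed spanning trees $T^\pm$ for which $S_c^{T^\pm}$ has bidegree $(i,j)$, and $\partial_{ST}:CST^{i,j}\to CST^{i+1,j}$ is $$\partial_{ST}T^+=\partial^+_{ST}T^++\sum_{T'}\Gamma(T^+,T'^-)\,T'^-,\qquad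 \partial_{ST}T^-=\partial_{ST}^-T^-,\qquad \partial^{\pm}_{ST}T^\pm=\sum_{T'}\Gamma(T^\pm,T'^\pm)\,T'^\pm,$$ the sums being over generators of homological degree $i+1$. Here $\Gamma(T^\pm,T'^\pm)$ is the sum of the weights of the alternating paths from $S_c^{T^\pm}$ to $S_c^{T'^\pm}$ on which the label of the dotted arc is constant, and $\Gamma(T^+,T'^-)$ is the sum of the weights of all alternating paths from $S_c^{T^+}$ to $S_c^{T'^-}$. Then $\mathcal M$ is an acyclic matching (each vertex lies in at most one edge, the weights of its edges are $\pm1$, and the Hasse diagram with the edges of $\mathcal M$ reversed has no directed cycle), the map $T^\pm\mapsto S_c^{T^\pm}$ is a bijection from the signed spanning trees onto the unmatched enhanced states, $\partial_{Kh}^2=0$, $\partial_{ST}^2=0$, and for all $i,j$ $$H^{i,j}(CST(G_{\mathcal L}),\partial_{ST})\cong Kh^{i,j}(\mathcal L).$$ -/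

import Mathlib

/-! ### Bigraded complexes with a distinguished basis -/

/-- The data of a bigraded cochain complex of free abelian groups with distinguished basis `B`:
the homological degree `i` and quantum degree `j` of each basis element, and the incidence numbers
`coeff b b'` (the coefficient of `b'` in the differential of `b`). -/
structure BasedComplex (B : Type*) where
  i : B → ℤ
  j : B → ℤ
  coeff : B → B → ℤ

namespace BasedComplex

/-- The free abelian group on the basis elements of bidegree `(p, q)`. -/
abbrev Chain {B : Type*} (K : BasedComplex B) (p q : ℤ) : Type _ :=
  {b : B // K.i b = p ∧ K.j b = q} →₀ ℤ

open Classical in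
/-- The linear map from bidegree `(p, q)` to bidegree `(p', q)` that sends a basis element `b` to
the sum of `coeff b b' • b'` over the basis elements `b'` of bidegree `(p', q)`. The differential
is the case `p' = p + 1`. -/
noncomputable def d {B : Type*} [Finite B] (K : BasedComplex B) (p p' q : ℤ) :
    K.Chain p q →ₗ[ℤ] K.Chain p' q :=
  haveI := Fintype.ofFinite B
  Finsupp.linearCombination ℤ fun b => ∑ b', Finsupp.single b' (K.coeff b.1 b'.1)

/-- The differential squares to zero. -/
def IsComplex {B : Type*} [Finite B] (K : BasedComplex B) : Prop :=
  ∀ p q : ℤ, K.d (p + 1) (p + 2) q ∘ₗ K.d p (p + 1) q = 0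

/-- The cohomology in bidegree `(p, q)`: cocycles modulo coboundaries. -/
abbrev Cohomology {B : Type*} [Finite B] (K : BasedComplex B) (p q : ℤ) : Type _ :=
  LinearMap.ker (K.d p (p + 1) q) ⧸
    (LinearMap.range (K.d (p - 1) p q)).comap (LinearMap.ker (K.d p (p + 1) q)).subtype

/-! ### Algebraic discrete Morse theory -/

/-- The Hasse diagram with the edges of the matching `M` reversed: there is an arrow `b → b'` if
`coeff b b' ≠ 0` and the pair is not matched, or if `b' → b` is a matched edge. -/
def Arrow {B : Type*} (K : BasedComplex B) (M : B → B → Prop) (b b' : B) : Prop :=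
  (K.coeff b b' ≠ 0 ∧ ¬ M b b') ∨ M b' b

/-- `M` (where `M b b'` says that the Hasse diagram edge `b → b'` is matched) is an acyclic
matching. -/
structure IsAcyclicMatching {B : Type*} (K : BasedComplex B) (M : B → B → Prop) : Prop where
  edge : ∀ b b', M b b' → K.coeff b b' ≠ 0
  matching : ∀ a a' b b', M a a' → M b b' →
    (a = b ∨ a = b' ∨ a' = b ∨ a' = b') → a = b ∧ a' = b'
  unit : ∀ b b', M b b' → IsUnit (K.coeff b b')
  acyclic : ∀ b, ¬ Relation.TransGen (K.Arrow M) b b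

/-- A basis element is critical if it lies in no edge of the matching. -/
def IsCritical {B : Type*} (M : B → B → Prop) (b : B) : Prop :=
  ∀ b', ¬ M b b' ∧ ¬ M b' b

open Classical in
/-- The weight of an arrow: the incidence number, or minus the inverse incidence number for a
reversed edge. -/
noncomputable def arrowWeight {B : Type*} (K : BasedComplex B) (M : B → B → Prop) (b b' : B) : ℤ :=
  if M b' b then -(1 / K.coeff b' b) else K.coeff b b'

/-- The weight of a directed path, given by its list of vertices: the product of the weights of its
arrows. -/
noncomputable def pathWeight {B : Type*} (K : BasedComplex B) (M : B → B → Prop) : List B → ℤ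
  | [] => 1
  | [_] => 1
  | b :: b' :: l => K.arrowWeight M b b' * K.pathWeight M (b' :: l)

/-- `l` is the list of vertices of a directed (alternating) path from `b` to `b'` all of whose
vertices lie in `V`. -/
structure IsPath {B : Type*} (K : BasedComplex B) (M : B → B → Prop) (V : Set B) (b b' : B)
    (l : List B) : Prop where
  chain : l.IsChain (K.Arrow M)
  nodup : l.Nodup
  head : l.head? = some b
  last : l.getLast? = some b'
  mem : ∀ c ∈ l, c ∈ V

/-- The sum of the weights of all directed paths from `b` to `b'` with vertices in `V`. -/
noncomputable def Gamma {B : Type*} (K : BasedComplex B) (M : B → B → Prop) (V : Set B)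
    (b b' : B) : ℤ :=
  ∑ᶠ l ∈ {l : List B | K.IsPath M V b b' l}, K.pathWeight M l

end BasedComplex

/-! ### Oriented link diagrams -/

/-- Combinatorial data of an oriented diagram with crossings `X` and arcs `A` (an arc runs from one
crossing to the next, or is a whole circle without crossings). The four ends of arcs at a crossing
are numbered counterclockwise `0, 1, 2, 3`, where `0` is the incoming end of the lower strand; so
`2` is the outgoing end of the lower strand, and `1`, `3` belong to the upper strand. The crossing
is positive iff the upper strand enters at `3` and leaves at `1`. -/
structure CrossingData (X A : Type*) where
  positive : X → Prop
  slot : X → Fin 4 → A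

namespace CrossingData

/-- The end `k` at the crossing `e` is outgoing. -/
def IsOut {X A : Type*} (D : CrossingData X A) (e : X) (k : Fin 4) : Prop :=
  k = 2 ∨ (k = 1 ∧ D.positive e) ∨ (k = 3 ∧ ¬ D.positive e)

/-- Two arcs meet at a crossing. -/
def Meet {X A : Type*} (D : CrossingData X A) (a b : A) : Prop :=
  ∃ e k l, a = D.slot e k ∧ b = D.slot e l

/-- The connected components of the diagram, as a 4-regular plane graph. -/
abbrev Component {X A : Type*} (D : CrossingData X A) : Type _ := Quot D.Meet

open Classical in
/-- The side of the arc at the end `k` of the crossing `e` that lies to the left, or to the right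
if `left = false`, of an observer who moves away from the crossing. The sides `(a, true)` and
`(a, false)` are the left and right sides of `a` with respect to its orientation. -/
noncomputable def side {X A : Type*} (D : CrossingData X A) (e : X) (k : Fin 4) (left : Bool) :
    A × Bool :=
  (D.slot e k, if D.IsOut e k then left else !left)

/-- Two sides of arcs bound the same corner of a crossing: the corner `k` lies between the
consecutive ends `k` and `k + 1`. -/
def SameCorner {X A : Type*} (D : CrossingData X A) (s t : A × Bool) : Prop :=
  ∃ e k, s = D.side e k true ∧ t = D.side e (k + 1) false

/-- The regions of the diagram, as classes of sides of arcs. -/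
abbrev Face {X A : Type*} (D : CrossingData X A) : Type _ := Quot D.SameCorner

/-- The region at the corner between the ends `k` and `k + 1` of the crossing `e`. -/
noncomputable def corner {X A : Type*} (D : CrossingData X A) (e : X) (k : Fin 4) : D.Face :=
  Quot.mk _ (D.side e k true)

/-- The diagram is connected. -/
def Connected {X A : Type*} (D : CrossingData X A) : Prop := Nat.card D.Component = 1

end CrossingData

/-- An oriented link diagram: every arc that occurs at a crossing has exactly one outgoing end and
one incoming end, and the underlying map is planar. Planarity is the Euler formula: a component
with `n ≥ 1` crossings has `n` vertices, `2 n` edges and, on the sphere, `n + 2` regions, and a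
circle without crossings has `2` regions. -/
structure LinkDiagram (X A : Type*) extends CrossingData X A where
  out_inj : ∀ e k f l, toCrossingData.IsOut e k → toCrossingData.IsOut f l →
    slot e k = slot f l → e = f ∧ k = l
  in_inj : ∀ e k f l, ¬ toCrossingData.IsOut e k → ¬ toCrossingData.IsOut f l →
    slot e k = slot f l → e = f ∧ k = l
  out_iff_in : ∀ a, (∃ e k, toCrossingData.IsOut e k ∧ slot e k = a) ↔
    (∃ e k, ¬ toCrossingData.IsOut e k ∧ slot e k = a)
  planar : Nat.card toCrossingData.Face = Nat.card X + 2 * Nat.card toCrossingData.Component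

/-! ### The Khovanov complex -/

/-- The labels `1` and `x`. -/
inductive Label
  | one
  | x

namespace Label

instance : Finite Label :=
  Finite.of_surjective (fun b : Bool => if b then one else x) (by
    rintro (_ | _)
    · exact ⟨true, rfl⟩
    · exact ⟨false, rfl⟩)

/-- The degree of a label: `1` for `1` and `-1` for `x`. -/
def deg : Label → ℤ
  | one => 1
  | x => -1

/-- `IsMul p q r`: the product `m (p, q)` is `r`; there is no `r` for `m (x, x) = 0`. -/
inductive IsMul : Label → Label → Label → Prop
  | one_one : IsMul one one one
  | one_x : IsMul one x x
  | x_one : IsMul x one x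

/-- `IsComul p q r`: the term `q ⊗ r` occurs in the coproduct `Δ p`. -/
inductive IsComul : Label → Label → Label → Prop
  | one_x : IsComul one one x
  | x_one : IsComul one x one
  | x_x : IsComul x x x

end Label

namespace CrossingData

/-- Two arcs are joined when the crossings in `σ` are `B`-smoothed and all others `A`-smoothed.
The `A`-smoothing joins the two regions swept by turning the upper strand counterclockwise. -/
def Smoothed {X A : Type*} (D : CrossingData X A) (σ : Finset X) (a b : A) : Prop :=
  ∃ e, (e ∉ σ ∧ ((a = D.slot e 0 ∧ b = D.slot e 1) ∨ (a = D.slot e 2 ∧ b = D.slot e 3))) ∨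
    (e ∈ σ ∧ ((a = D.slot e 1 ∧ b = D.slot e 2) ∨ (a = D.slot e 3 ∧ b = D.slot e 0)))

/-- The circles of the resolved state whose set of `B`-smoothed crossings is `σ`. -/
abbrev Circle {X A : Type*} (D : CrossingData X A) (σ : Finset X) : Type _ := Quot (D.Smoothed σ)

/-- The circle of the state `σ` that contains the arc `a`. -/
def circle {X A : Type*} (D : CrossingData X A) (σ : Finset X) (a : A) : D.Circle σ := Quot.mk _ a

/-- Enhanced states: a resolved state, given by its set of `B`-smoothed crossings, with a label
`1` or `x` on each of its circles. For a checkerboard coloring these are the enhanced spanning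
subgraphs of the Tait graph: the spanning subgraph of a state consists of the positive edges that
are `A`-smoothed and the negative edges that are `B`-smoothed, and the circles are the boundary
curves of a regular neighborhood of it, that is, the faces of its components. -/
abbrev Enhanced {X A : Type*} (D : CrossingData X A) : Type _ :=
  (σ : Finset X) × (D.Circle σ → Label)

/-- The label of the circle through the arc `a`. -/
def label {X A : Type*} (D : CrossingData X A) (s : D.Enhanced) (a : A) : Label :=
  s.2 (D.circle s.1 a)

instance {X A : Type*} [Finite X] [Finite A] (D : CrossingData X A) : Finite D.Enhanced :=
  inferInstance

/-- The homological degree: the number of `B`-smoothed crossings minus the number of negative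
crossings. -/
noncomputable def hdeg {X A : Type*} (D : CrossingData X A) (s : D.Enhanced) : ℤ :=
  s.1.card - Nat.card {e // ¬ D.positive e}

/-- The quantum degree: the homological degree, plus the number of labels `1` minus the number of
labels `x`, plus the number of positive minus the number of negative crossings. -/
noncomputable def qdeg {X A : Type*} (D : CrossingData X A) (s : D.Enhanced) : ℤ :=
  D.hdeg s + (∑ᶠ c, (s.2 c).deg) + Nat.card {e // D.positive e} - Nat.card {e // ¬ D.positive e}

/-- Changing the crossing `e` turns the labels of `s` into those of `t`. The circles of a state at
`e` are those through the ends `0` and `2`. Either two circles merge, or one circle splits; all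
other circles keep their labels. -/
def Compatible {X A : Type*} (D : CrossingData X A) (e : X) (s t : D.Enhanced) : Prop :=
  ((D.circle s.1 (D.slot e 0) ≠ D.circle s.1 (D.slot e 2) ∧
      D.circle t.1 (D.slot e 0) = D.circle t.1 (D.slot e 2) ∧
      Label.IsMul (D.label s (D.slot e 0)) (D.label s (D.slot e 2)) (D.label t (D.slot e 0))) ∨
    (D.circle s.1 (D.slot e 0) = D.circle s.1 (D.slot e 2) ∧
      D.circle t.1 (D.slot e 0) ≠ D.circle t.1 (D.slot e 2) ∧
      Label.IsComul (D.label s (D.slot e 0)) (D.label t (D.slot e 0)) (D.label t (D.slot e 2)))) ∧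
  ∀ a, D.circle s.1 a ≠ D.circle s.1 (D.slot e 0) → D.circle s.1 a ≠ D.circle s.1 (D.slot e 2) →
    D.label t a = D.label s a

open Classical in
/-- The coefficient of `t` in the Khovanov differential of `s`: the sum, over the `A`-smoothed
crossings `e` of `s` whose change leads to `t`, of `(-1) ^ w`, where `w` is the number of
`B`-smoothed crossings of `s` before `e`. -/
noncomputable def khCoeff {X A : Type*} [Fintype X] [LinearOrder X] (D : CrossingData X A)
    (s t : D.Enhanced) : ℤ :=
  ∑ e : X, if e ∉ s.1 ∧ t.1 = insert e s.1 ∧ D.Compatible e s t then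
    (-1) ^ (s.1.filter (· < e)).card else 0

/-- The Khovanov complex. -/
noncomputable def CKh {X A : Type*} [Fintype X] [LinearOrder X] (D : CrossingData X A) :
    BasedComplex D.Enhanced where
  i := D.hdeg
  j := D.qdeg
  coeff := D.khCoeff

/-! ### The Tait graph, its spanning trees and their activities -/

/-- `black` is a checkerboard coloring: the two sides of every arc have different colors. -/
def IsCheckerboard {X A : Type*} (D : CrossingData X A) (black : D.Face → Prop) : Prop :=
  ∀ a, black (Quot.mk _ (a, true)) ↔ ¬ black (Quot.mk _ (a, false))

/-- The sign of the edge of the Tait graph at the crossing `e`: it is positive iff the two black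
corners are `1` and `3`, the corners that the `A`-smoothing connects. -/
def PosEdge {X A : Type*} (D : CrossingData X A) (black : D.Face → Prop) (e : X) : Prop :=
  black (D.corner e 1)

/-- `u` and `v` are the two black corners of `e`. The Tait graph has the black regions as vertices
and the crossings as edges, each joining its two black corners. -/
def TaitLink {X A : Type*} (D : CrossingData X A) (black : D.Face → Prop) (e : X)
    (u v : D.Face) : Prop :=
  (D.PosEdge black e ∧ u = D.corner e 1 ∧ v = D.corner e 3) ∨
    (¬ D.PosEdge black e ∧ u = D.corner e 0 ∧ v = D.corner e 2)

/-- `u` and `v` are connected by edges of the Tait graph that belong to `S`. -/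
def TaitConn {X A : Type*} (D : CrossingData X A) (black : D.Face → Prop) (S : Set X) :
    D.Face → D.Face → Prop :=
  Relation.EqvGen fun u v => ∃ e ∈ S, D.TaitLink black e u v

/-- The ends of the edge `e` are connected by edges in `S`. -/
def EndsConn {X A : Type*} (D : CrossingData X A) (black : D.Face → Prop) (S : Set X)
    (e : X) : Prop :=
  ∀ u v, D.TaitLink black e u v → D.TaitConn black S u v

/-- `T` is the edge set of a spanning tree of the Tait graph: it connects all vertices, and none of
its edges lies on a cycle. -/
def IsSpanningTree {X A : Type*} (D : CrossingData X A) (black : D.Face → Prop)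
    (T : Finset X) : Prop :=
  (∀ u v, black u → black v → D.TaitConn black T u v) ∧
    ∀ e ∈ T, ¬ D.EndsConn black (T \ {e}) e

/-- The spanning trees of the Tait graph. -/
abbrev SpanningTree {X A : Type*} (D : CrossingData X A) (black : D.Face → Prop) : Type _ :=
  {T : Finset X // D.IsSpanningTree black T}

/-- For `e ∈ T`: the edges that reconnect `T \ e`. -/
def cut {X A : Type*} (D : CrossingData X A) (black : D.Face → Prop) (T : Finset X) (e : X) :
    Set X :=
  {f | ¬ D.EndsConn black (T \ {e}) f}

/-- For `e ∉ T`: the edges of the unique cycle in `T ∪ e`. -/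
def cyc {X A : Type*} (D : CrossingData X A) (black : D.Face → Prop) (T : Finset X) (e : X) :
    Set X :=
  {f | (f ∈ T ∨ f = e) ∧ D.EndsConn black ((T ∪ {e}) \ {f}) f}

/-- The edge `e` is live (internally or externally active) for the spanning tree `T`. -/
def Live {X A : Type*} [LinearOrder X] (D : CrossingData X A) (black : D.Face → Prop)
    (T : Finset X) (e : X) : Prop :=
  (e ∈ T ∧ ∀ f ∈ D.cut black T e, e ≤ f) ∨ (e ∉ T ∧ ∀ f ∈ D.cyc black T e, e ≤ f)

open Classical in
/-- The set of live edges of `T`. -/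
noncomputable def liveEdges {X A : Type*} [Fintype X] [LinearOrder X] (D : CrossingData X A)
    (black : D.Face → Prop) (T : Finset X) : Finset X :=
  Finset.univ.filter (D.Live black T)

open Classical in
/-- The resolved state attached to a spanning tree by the activities of the edges. The smoothings
of the edges of activity `L, D, l, d` are `B, A, A, B` for positive edges, and `A, B, B, A` for
negative ones. -/
noncomputable def treeState {X A : Type*} [Fintype X] [LinearOrder X] (D : CrossingData X A)
    (black : D.Face → Prop) (T : Finset X) : Finset X :=
  Finset.univ.filter fun e =>
    if D.PosEdge black e then
      if e ∈ T then D.Live black T e else ¬ D.Live black T e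
    else
      if e ∈ T then ¬ D.Live black T e else D.Live black T e

/-- The enhanced state `s` is a generator of the Khovanov complex of the twisted unknot `U(T)`, the
partial smoothing of the diagram in which the dead edges of `T` are smoothed as in `treeState`. -/
def InUnknot {X A : Type*} [Fintype X] [LinearOrder X] (D : CrossingData X A)
    (black : D.Face → Prop) (T : Finset X) (s : D.Enhanced) : Prop :=
  ∀ e, ¬ D.Live black T e → (e ∈ s.1 ↔ e ∈ D.treeState black T)

/-! ### The tree of a twisted unknot and the matching

Let `c` be the state `treeState T`. The tree `G(T)` has the circles of `c` as vertices and the live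
edges of `T` as edges, each joining the two circles of `c` that meet at the crossing. It is rooted
at the circle of `c` through the dotted arc. A live edge is a negative twist (activity `L` or
`l` barred) if it is `B`-smoothed in `c`, and a positive twist (`L` barred or `l`) if it is
`A`-smoothed in `c`. A resolved state of `U(T)` is the spanning subgraph of `G(T)` formed by the
live edges whose smoothing differs from that in `c`. -/

/-- The live edge `e` is incident to the vertex `v` of `G(T)`. -/
def Incident {X A : Type*} (D : CrossingData X A) (c : Finset X) (e : X) (v : D.Circle c) : Prop :=
  v = D.circle c (D.slot e 0) ∨ v = D.circle c (D.slot e 2)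

/-- In the subtree of `G(T)` with edge set `R`, the edge `e` is a leaf, with vertex `v` of degree
one other than the root. -/
def IsLeaf {X A : Type*} (D : CrossingData X A) (c : Finset X) (root : D.Circle c) (R : Finset X)
    (e : X) (v : D.Circle c) : Prop :=
  e ∈ R ∧ v ≠ root ∧ D.Incident c e v ∧ ∀ f ∈ R, D.Incident c f v → f = e

/-- `e` is the least leaf of the subtree with edge set `R`, with vertex `v`. -/
def IsLeastLeaf {X A : Type*} [LinearOrder X] (D : CrossingData X A) (c : Finset X)
    (root : D.Circle c) (R : Finset X) (e : X) (v : D.Circle c) : Prop :=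
  D.IsLeaf c root R e v ∧ ∀ f w, D.IsLeaf c root R f w → e ≤ f

/-- If one removes successively the least leaf from the subtree with edge set `R`, then at some
step the edge `e` is removed with vertex `v`. -/
inductive Removes {X A : Type*} [LinearOrder X] (D : CrossingData X A) (c : Finset X)
    (root : D.Circle c) : Finset X → X → D.Circle c → Prop
  | here (R : Finset X) (e : X) (v : D.Circle c) :
      D.IsLeastLeaf c root R e v → Removes D c root R e v
  | later (R : Finset X) (e f : X) (v w : D.Circle c) :
      D.IsLeastLeaf c root R e v → Removes D c root (R.erase e) f w → Removes D c root R f w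

/-- The live edge `e` belongs to the spanning subgraph of `G(T)` that corresponds to `s`. -/
def Joined {X A : Type*} (D : CrossingData X A) (c : Finset X) (e : X) (s : D.Enhanced) : Prop :=
  ¬ (e ∈ s.1 ↔ e ∈ c)

/-- The label of the isolated vertex cut off by the removal of `e` in a matched pair: `x` for a
negative twist and `1` for a positive twist. -/
def matchLabel {X : Type*} [DecidableEq X] (c : Finset X) (e : X) : Label :=
  if e ∈ c then Label.x else Label.one

/-- The other label, which the isolated vertex has in the states left unmatched by `e`: `1` for a
negative twist and `x` for a positive twist. -/
def critLabel {X : Type*} [DecidableEq X] (c : Finset X) (e : X) : Label :=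
  if e ∈ c then Label.one else Label.x

/-- The matching of the generators of the Khovanov complex of `U(T)`, by recursion on the subtree
with edge set `R`; `Paired R s t` means that `s` and `t` are paired, where `s` contains the
distinguished edge `e` and `t` does not. Let `e` be the least leaf of the subtree, with vertex `v`.
If the component of `v` in `s` has more than one vertex, then `s` is paired with the state obtained
by the removal of `e`, where `v` gets the label `matchLabel` and the rest of its component keeps
its label. The remaining states, where `v` is isolated with label `critLabel`, are paired as in the
subtree without `e` and `v`. -/
inductive Paired {X A : Type*} [LinearOrder X] (D : CrossingData X A) (c : Finset X)
    (root : D.Circle c) : Finset X → D.Enhanced → D.Enhanced → Prop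
  | here (R : Finset X) (e : X) (v : D.Circle c) (s t : D.Enhanced) :
      D.IsLeastLeaf c root R e v → D.Joined c e s → ¬ D.Joined c e t →
      (∀ f, f ≠ e → (f ∈ s.1 ↔ f ∈ t.1)) →
      (∀ a, D.circle c a = v → D.label t a = matchLabel c e) →
      (∀ a, D.circle c a ≠ v → D.label t a = D.label s a) →
      Paired D c root R s t
  | later (R : Finset X) (e : X) (v : D.Circle c) (s t : D.Enhanced) :
      D.IsLeastLeaf c root R e v → ¬ D.Joined c e s → ¬ D.Joined c e t →
      (∀ a, D.circle c a = v → D.label s a = critLabel c e ∧ D.label t a = critLabel c e) →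
      Paired D c root (R.erase e) s t →
      Paired D c root R s t

/-- The matching on the Hasse diagram of the Khovanov complex, the union over the spanning trees of
the matchings of the twisted unknots: the edge `s → t` of the Hasse diagram is matched. -/
def Matched {X A : Type*} [Fintype X] [LinearOrder X] (D : CrossingData X A)
    (black : D.Face → Prop) (dot : A) (s t : D.Enhanced) : Prop :=
  D.khCoeff s t ≠ 0 ∧ ∃ T : Finset X, D.IsSpanningTree black T ∧
    D.InUnknot black T s ∧ D.InUnknot black T t ∧
    (D.Paired (D.treeState black T) (D.circle _ dot) (D.liveEdges black T) s t ∨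
      D.Paired (D.treeState black T) (D.circle _ dot) (D.liveEdges black T) t s)

/-! ### The spanning tree complex -/

/-- The signed spanning trees: `(T, 1)` is `T⁺` and `(T, x)` is `T⁻`. -/
abbrev SignedTree {X A : Type*} (D : CrossingData X A) (black : D.Face → Prop) : Type _ :=
  D.SpanningTree black × Label

instance {X A : Type*} [Finite X] (D : CrossingData X A) (black : D.Face → Prop) :
    Finite (D.SignedTree black) := inferInstance

open Classical in
/-- The critical enhanced state of a signed spanning tree: all vertices of `G(T)` are isolated, the
root has the label of the sign (`1` for `T⁺` and `x` for `T⁻`), and any other vertex has label `1`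
if the edge with which it is removed is a negative twist, and `x` if it is a positive twist. -/
noncomputable def criticalState {X A : Type*} [Fintype X] [LinearOrder X] (D : CrossingData X A)
    (black : D.Face → Prop) (dot : A) (T : D.SignedTree black) : D.Enhanced :=
  ⟨D.treeState black T.1.1, fun v =>
    if v = D.circle _ dot then T.2
    else if ∃ e ∈ D.treeState black T.1.1,
        D.Removes _ (D.circle _ dot) (D.liveEdges black T.1.1) e v then Label.one
    else Label.x⟩

/-- The incidence number of two signed spanning trees: the sum of the weights of the alternating
paths between their critical states, for two trees of the same sign in the reduced Khovanov complex
(the label of the dotted arc is fixed), and from `T⁺` to `T'⁻` in the whole Khovanov complex. There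
are no terms from `T⁻` to `T'⁺`. -/
noncomputable def stCoeff {X A : Type*} [Fintype X] [LinearOrder X] (D : CrossingData X A)
    (black : D.Face → Prop) (dot : A) (T T' : D.SignedTree black) : ℤ :=
  let Γ (V : Set D.Enhanced) : ℤ := D.CKh.Gamma (D.Matched black dot) V
    (D.criticalState black dot T) (D.criticalState black dot T')
  match T.2, T'.2 with
  | .one, .one => Γ {s | D.label s dot = .one}
  | .x, .x => Γ {s | D.label s dot = .x}
  | .one, .x => Γ Set.univ
  | .x, .one => 0

/-- The unreduced spanning tree complex, generated by the signed spanning trees with the bidegrees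
of their critical states. -/
noncomputable def CST {X A : Type*} [Fintype X] [LinearOrder X] (D : CrossingData X A)
    (black : D.Face → Prop) (dot : A) : BasedComplex (D.SignedTree black) where
  i T := D.hdeg (D.criticalState black dot T)
  j T := D.qdeg (D.criticalState black dot T)
  coeff := D.stCoeff black dot

end CrossingData

/-!
The theorem is an instance of algebraic discrete Morse theory: once `M` is known to be an acyclic
matching, the incidence numbers of the spanning tree complex are sums over alternating paths
between critical states, and such a complex computes the cohomology of the original one
(`BasedComplex.IsAcyclicMatching.morse`). That general statement follows from the homological
perturbation lemma: the matched part of the differential is contracted by the reversed edges onto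
the span of the critical states, and the rest of the differential is a perturbation, nilpotent by
acyclicity. Between critical states of consecutive degrees every alternating path really
alternates between unmatched and reversed edges (`BasedComplex.gamma_eq_of_isCritical`), so that
the perturbed differential is the sum over paths.

*The Khovanov complex.* All that is needed about circles is that a change of smoothing merges two
of them or splits one (`LinkDiagram.hasSurgery`). With all arcs oriented so that the black region
is on the left, the circles are the cycles of a permutation of the arcs, and a change of smoothing
multiplies it by a transposition. The square of the differential vanishes
(`CrossingData.HasSurgery.finsum_khCoeff_mul`) since the edge maps are dual to ring operations: a
merge is a projection of quotients of a polynomial ring in the arcs, and a split is multiplication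
by the sum of two arcs; these commute.

*Spanning trees.* By Euler's formula an edge that is added to a spanning subgraph of the Tait
graph splits a circle iff its ends are already connected (`LinkDiagram.circle_eq_iff_endsConn`).
Activities partition the spanning subgraphs into intervals, one for each tree; this holds for
every finite matroid and is proved from its closure operator
(`IsMatroidClosure.exists_basis_inInterval`, `IsMatroidClosure.eq_of_inInterval`). Hence every
state lies in the twisted unknot `U(T)` of exactly one tree. The differential either stays in
`U(T)` or moves to a tree whose set of dead `B`-smoothed edges is larger in the colexicographic
order (`LinkDiagram.eq_or_deadB_lt`).

*One twisted unknot.* The circles of the states of `U(T)` are the components of the spanning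
subgraphs of a tree (`LinkDiagram.isTwistTree`). The matching is analyzed by removing one leaf at
a time. At a leaf, the states come in the order: leaf cut off with label `x`, leaf joined, leaf
cut off with label `1`. Along alternating paths this order never decreases, and the states left
over by the leaf form one of its three levels (`CrossingData.IsTwistTree.leafRank_step`). So a
cycle stays in that level, where the smaller tree takes over, or uses no reversed edge, which the
number of `B`-smoothed crossings excludes.

Finally, the matching keeps the label of the dotted arc, and the differential changes it only from
`1` to `x`. So the restriction of the paths in the definition of the differential of the spanning
tree complex is automatic, and its vanishing terms from `T⁻` to `T'⁺` are empty sums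
(`LinkDiagram.stCoeff_eq`).
-/

/-! ### Algebraic discrete Morse theory -/

/-- The identity behind the homological perturbation lemma: for `A = δ + δ H A = δ + A H δ`, the
element `A π A + E A + A E` arises from the square of the perturbed differential `E + δ` by
multiplication with units on both sides. -/
theorem perturbation_identity {R : Type*} [Ring R] {δ E H π S A : R}
    (hD : (δ + E) * (δ + E) = 0) (hEE : E * E = 0) (hπ : E * H + H * E = π - 1)
    (hS : S * (1 - δ * H) = 1) (hA : A = S * δ) (hS' : (1 - δ * H) * S = 1) :
    A * π * A + E * A + A * E = 0 := by
  have h1 : (1 - δ * H) * A = δ := by rw [hA, ← mul_assoc, hS', one_mul]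
  have h2 : A * (1 - H * δ) = δ := by
    have : S * δ * (1 - H * δ) = S * (1 - δ * H) * δ := by noncomm_ring
    rw [hA, this, hS, one_mul]
  have hπ' : π = E * H + H * E + 1 := by rw [hπ]; abel
  have hD' : δ * δ + δ * E + E * δ = 0 := by
    have : (δ + E) * (δ + E) = δ * δ + δ * E + E * δ + E * E := by noncomm_ring
    rw [hD, hEE, add_zero] at this
    exact this.symm
  have hU : (1 - H * δ) * (1 + H * A) = 1 := by
    have : (1 - H * δ) * (1 + H * A) = 1 - H * δ + H * ((1 - δ * H) * A) := by noncomm_ring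
    rw [this, h1]; abel
  have key : (1 - δ * H) * (A * π * A + E * A + A * E) * (1 - H * δ) = 0 := by
    calc (1 - δ * H) * (A * π * A + E * A + A * E) * (1 - H * δ)
        = ((1 - δ * H) * A) * π * (A * (1 - H * δ)) + (1 - δ * H) * E * (A * (1 - H * δ))
          + ((1 - δ * H) * A) * E * (1 - H * δ) := by noncomm_ring
      _ = δ * π * δ + (1 - δ * H) * E * δ + δ * E * (1 - H * δ) := by rw [h1, h2]
      _ = δ * δ + δ * E + E * δ := by rw [hπ']; noncomm_ring
      _ = 0 := hD'
  calc A * π * A + E * A + A * E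
      = (S * (1 - δ * H)) * (A * π * A + E * A + A * E) * ((1 - H * δ) * (1 + H * A)) := by
        rw [hS, hU]; noncomm_ring
    _ = S * ((1 - δ * H) * (A * π * A + E * A + A * E) * (1 - H * δ)) * (1 + H * A) := by
        noncomm_ring
    _ = 0 := by rw [key]; simp

/-- The homological perturbation lemma, for operators written as matrices that act on rows: `E` is
a differential contracted by `H` onto the image of the projection `π`, and `E + δ` is a perturbed
differential. The perturbed complex is homotopy equivalent to `π A π` on the image of `π`. -/
theorem perturbation_lemma {R : Type*} [Ring R] {δ E H π S A : R}
    (hD : (δ + E) * (δ + E) = 0) (hEE : E * E = 0) (hHH : H * H = 0)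
    (hπ : E * H + H * E = π - 1) (hππ : π * π = π) (hπH : π * H = 0) (hHπ : H * π = 0)
    (hπE : π * E = 0) (hEπ : E * π = 0)
    (hS : S * (1 - δ * H) = 1) (hS' : (1 - δ * H) * S = 1) (hA : A = S * δ) :
    (π * A * π) * (π * A * π) = 0 ∧
    (π * (1 + A * H)) * (δ + E) = π * A * π * (1 + A * H) ∧
    (δ + E) * ((1 + H * A) * π) = (1 + H * A) * π * A * π ∧
    π * (1 + A * H) * ((1 + H * A) * π) = π ∧
    (1 + H * A) * π * (1 + A * H) =
      1 + (H + H * A * H) * (δ + E) + (δ + E) * (H + H * A * H) := by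
  have h1 : (1 - δ * H) * A = δ := by rw [hA, ← mul_assoc, hS', one_mul]
  have h2 : A * (1 - H * δ) = δ := by
    have : S * δ * (1 - H * δ) = S * (1 - δ * H) * δ := by noncomm_ring
    rw [hA, this, hS, one_mul]
  have h1' : A = δ + δ * H * A := by
    have : (1 - δ * H) * A = A - δ * H * A := by noncomm_ring
    rwa [this, sub_eq_iff_eq_add] at h1
  have h2' : A = δ + A * H * δ := by
    have : A * (1 - H * δ) = A - A * H * δ := by noncomm_ring
    rwa [this, sub_eq_iff_eq_add] at h2
  have key : A * π * A = -(E * A) - A * E := by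
    have := perturbation_identity hD hEE hπ hS hA hS'
    rw [add_assoc] at this
    rw [eq_neg_of_add_eq_zero_left this]; abel
  have e1 : 1 + H * E = π - E * H := by
    rw [eq_sub_iff_add_eq, add_assoc, add_comm (H * E), hπ]; abel
  have e2 : 1 + E * H = π - H * E := by
    rw [eq_sub_iff_add_eq, add_assoc, hπ]; abel
  refine ⟨?_, ?_, ?_, ?_, ?_⟩
  · calc (π * A * π) * (π * A * π) = π * (A * (π * π) * A) * π := by noncomm_ring
      _ = -((π * E) * A * π) - π * A * (E * π) := by rw [hππ, key]; noncomm_ring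
      _ = 0 := by rw [hπE, hEπ]; simp
  · calc (π * (1 + A * H)) * (δ + E)
        = π * (δ + A * H * δ) + π * E + π * A * (H * E) := by noncomm_ring
      _ = π * A * (1 + H * E) := by rw [← h2', hπE]; noncomm_ring
      _ = π * A * π + π * (-(A * E)) * H := by rw [e1]; noncomm_ring
      _ = π * A * π + π * (-(E * A) - A * E) * H + π * E * A * H := by noncomm_ring
      _ = π * A * π * (1 + A * H) := by rw [← key, hπE]; noncomm_ring
  · calc (δ + E) * ((1 + H * A) * π)
        = (δ + δ * H * A) * π + E * π + (E * H) * A * π := by noncomm_ring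
      _ = (1 + E * H) * A * π := by rw [← h1', hEπ]; noncomm_ring
      _ = π * A * π + H * (-(E * A)) * π := by rw [e2]; noncomm_ring
      _ = π * A * π + H * (-(E * A) - A * E) * π + H * A * (E * π) := by noncomm_ring
      _ = (1 + H * A) * π * A * π := by rw [← key, hEπ]; noncomm_ring
  · calc π * (1 + A * H) * ((1 + H * A) * π)
        = π * π + (π * H) * A * π + π * A * (H * π) + π * A * (H * H) * A * π := by noncomm_ring
      _ = π := by rw [hππ, hπH, hHπ, hHH]; simp
  · calc (1 + H * A) * π * (1 + A * H)
        = π + H * A * π + π * A * H + H * (A * π * A) * H := by noncomm_ring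
      _ = π + H * A * (π - E * H) + (π - H * E) * A * H := by rw [key]; noncomm_ring
      _ = π + H * A * (1 + H * E) + (1 + E * H) * A * H := by rw [e1, e2]
      _ = π + (H * A + H * A * H * E) + (A * H + E * H * A * H) := by noncomm_ring
      _ = π + (H * (δ + A * H * δ) + H * A * H * E) + ((δ + δ * H * A) * H + E * H * A * H) := by
          rw [← h1', ← h2']
      _ = (E * H + H * E + 1) + (H * (δ + A * H * δ) + H * A * H * E) +
            ((δ + δ * H * A) * H + E * H * A * H) := by rw [hπ]; abel
      _ = 1 + (H + H * A * H) * (δ + E) + (δ + E) * (H + H * A * H) := by noncomm_ring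

namespace BasedComplex

open Classical in
/-- The linear map between chain groups of two based complexes with matrix `A`. The differential is
the case of the matrix of incidence numbers. -/
noncomputable def ofMatrix {B B' : Type*} [Finite B'] (K : BasedComplex B) (K' : BasedComplex B')
    (A : Matrix B B' ℤ) (p p' q : ℤ) : K.Chain p q →ₗ[ℤ] K'.Chain p' q :=
  haveI := Fintype.ofFinite B'
  Finsupp.linearCombination ℤ fun b => ∑ b', Finsupp.single b' (A b.1 b'.1)

/-- The matrix `A` is homogeneous of homological degree `n` and quantum degree `0`. -/
def Homogeneous {B B' : Type*} (K : BasedComplex B) (K' : BasedComplex B') (A : Matrix B B' ℤ)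
    (n : ℤ) : Prop :=
  ∀ b b', A b b' ≠ 0 → K'.i b' = K.i b + n ∧ K'.j b' = K.j b

section Matrices

variable {B B' B'' : Type*} (K : BasedComplex B) (K' : BasedComplex B') (K'' : BasedComplex B'')

theorem d_eq_ofMatrix [Finite B] (p p' q : ℤ) : K.d p p' q = K.ofMatrix K K.coeff p p' q := rfl

theorem ofMatrix_single [Finite B'] (A : Matrix B B' ℤ) (p p' q : ℤ)
    (b : {b : B // K.i b = p ∧ K.j b = q}) (b' : {b' : B' // K'.i b' = p' ∧ K'.j b' = q}) :
    K.ofMatrix K' A p p' q (Finsupp.single b 1) b' = A b.1 b'.1 := by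
  classical
  simp [ofMatrix, Finsupp.finsetSum_apply, Finsupp.single_apply]

theorem ofMatrix_congr [Finite B'] {A A' : Matrix B B' ℤ} {p p' q : ℤ}
    (h : ∀ b b', K.i b = p → K.j b = q → K'.i b' = p' → K'.j b' = q → A b b' = A' b b') :
    K.ofMatrix K' A p p' q = K.ofMatrix K' A' p p' q := by
  ext b b'
  simp only [LinearMap.comp_apply, Finsupp.lsingle_apply, ofMatrix_single]
  exact h _ _ b.2.1 b.2.2 b'.2.1 b'.2.2

theorem ofMatrix_one [Finite B] [DecidableEq B] (p q : ℤ) :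
    K.ofMatrix K 1 p p q = LinearMap.id := by
  classical
  ext b b'
  simp only [LinearMap.comp_apply, Finsupp.lsingle_apply, ofMatrix_single, LinearMap.id_apply,
    Matrix.one_apply, Finsupp.single_apply, Subtype.ext_iff]

theorem ofMatrix_add [Finite B'] (A A' : Matrix B B' ℤ) (p p' q : ℤ) :
    K.ofMatrix K' (A + A') p p' q = K.ofMatrix K' A p p' q + K.ofMatrix K' A' p p' q := by
  ext b b'
  simp [ofMatrix_single]

theorem ofMatrix_zero [Finite B'] (p p' q : ℤ) : K.ofMatrix K' 0 p p' q = 0 := by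
  ext b b'
  simp [ofMatrix_single]

theorem ofMatrix_mul [Fintype B'] [Finite B''] {A : Matrix B B' ℤ}
    {A' : Matrix B' B'' ℤ} {n p p' p'' q : ℤ} (hA : K.Homogeneous K' A n) (hp : p' = p + n) :
    K'.ofMatrix K'' A' p' p'' q ∘ₗ K.ofMatrix K' A p p' q = K.ofMatrix K'' (A * A') p p'' q := by
  classical
  ext b b''
  simp only [LinearMap.comp_apply, Finsupp.lsingle_apply, ofMatrix_single, Matrix.mul_apply]
  have key : ∀ (x : K'.Chain p' q), K'.ofMatrix K'' A' p' p'' q x b'' =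
      ∑ b' : {b' : B' // K'.i b' = p' ∧ K'.j b' = q}, x b' * A' b'.1 b''.1 := by
    intro x
    induction x using Finsupp.induction_linear with
    | zero => simp
    | add f g hf hg => simp [hf, hg, add_mul, Finset.sum_add_distrib]
    | single b r =>
      have : Finsupp.single b r = r • Finsupp.single b (1 : ℤ) := by simp
      rw [this, map_smul, Finsupp.smul_apply, ofMatrix_single]
      simp [Finsupp.single_apply]
  rw [key]
  simp only [ofMatrix_single]
  refine (Finset.sum_subtype (Finset.univ.filter fun b' : B' => K'.i b' = p' ∧ K'.j b' = q)
    (by simp) (fun b' => A b.1 b' * A' b' b''.1)).symm.trans ?_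
  refine Finset.sum_filter_of_ne fun b' _ h => ?_
  have := hA b.1 b' (left_ne_zero_of_mul h)
  rw [this.1, this.2, b.2.1, b.2.2]
  exact ⟨hp.symm, rfl⟩

end Matrices

end BasedComplex

/-- Maps between two three-term complexes that are inverse up to coboundaries induce an isomorphism
of cohomology in the middle. -/
noncomputable def cohomologyEquiv {C₀ C₁ C₂ D₀ D₁ D₂ : Type*} [AddCommGroup C₀] [AddCommGroup C₁]
    [AddCommGroup C₂] [AddCommGroup D₀] [AddCommGroup D₁] [AddCommGroup D₂]
    (c₀ : C₀ →ₗ[ℤ] C₁) (c₁ : C₁ →ₗ[ℤ] C₂) (d₀ : D₀ →ₗ[ℤ] D₁) (d₁ : D₁ →ₗ[ℤ] D₂)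
    (f : C₁ →ₗ[ℤ] D₁) (g : D₁ →ₗ[ℤ] C₁)
    (hf₁ : ∀ x, c₁ x = 0 → d₁ (f x) = 0) (hf₀ : ∀ x, ∃ y, f (c₀ x) = d₀ y)
    (hg₁ : ∀ x, d₁ x = 0 → c₁ (g x) = 0) (hg₀ : ∀ x, ∃ y, g (d₀ x) = c₀ y)
    (hgf : ∀ x, c₁ x = 0 → ∃ y, g (f x) - x = c₀ y)
    (hfg : ∀ x, d₁ x = 0 → ∃ y, f (g x) - x = d₀ y) :
    (LinearMap.ker c₁ ⧸ (LinearMap.range c₀).comap (LinearMap.ker c₁).subtype) ≃ₗ[ℤ]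
      (LinearMap.ker d₁ ⧸ (LinearMap.range d₀).comap (LinearMap.ker d₁).subtype) :=
  LinearEquiv.ofLinearMap
    (Submodule.mapQ _ _ (f.restrict (p := LinearMap.ker c₁) (q := LinearMap.ker d₁) hf₁) (by
      rintro ⟨_, hx⟩ ⟨x, rfl⟩
      obtain ⟨y, hy⟩ := hf₀ x
      exact ⟨y, hy.symm⟩))
    (Submodule.mapQ _ _ (g.restrict (p := LinearMap.ker d₁) (q := LinearMap.ker c₁) hg₁) (by
      rintro ⟨_, hx⟩ ⟨x, rfl⟩
      obtain ⟨y, hy⟩ := hg₀ x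
      exact ⟨y, hy.symm⟩))
    (by
      refine Submodule.linearMap_qext _ (LinearMap.ext fun x => ?_)
      refine (Submodule.Quotient.eq _).2 ?_
      obtain ⟨y, hy⟩ := hfg x.1 x.2
      exact ⟨y, hy.symm⟩)
    (by
      refine Submodule.linearMap_qext _ (LinearMap.ext fun x => ?_)
      refine (Submodule.Quotient.eq _).2 ?_
      obtain ⟨y, hy⟩ := hgf x.1 x.2
      exact ⟨y, hy.symm⟩)

namespace BasedComplex

section

variable {B B' B'' : Type*} {K : BasedComplex B} {K' : BasedComplex B'} {K'' : BasedComplex B''}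

theorem Homogeneous.mul [Fintype B'] {A : Matrix B B' ℤ} {A' : Matrix B' B'' ℤ} {m n : ℤ}
    (hA : K.Homogeneous K' A m) (hA' : K'.Homogeneous K'' A' n) :
    K.Homogeneous K'' (A * A') (m + n) := by
  intro b b'' h
  rw [Matrix.mul_apply] at h
  obtain ⟨b', -, hb'⟩ := Finset.exists_ne_zero_of_sum_ne_zero h
  have h1 := hA _ _ (left_ne_zero_of_mul hb')
  have h2 := hA' _ _ (right_ne_zero_of_mul hb')
  constructor
  · rw [h2.1, h1.1]; ring
  · rw [h2.2, h1.2]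

theorem Homogeneous.add {A A' : Matrix B B' ℤ} {n : ℤ}
    (hA : K.Homogeneous K' A n) (hA' : K.Homogeneous K' A' n) : K.Homogeneous K' (A + A') n := by
  intro b b' h
  by_cases h1 : A b b' = 0
  · exact hA' _ _ fun h2 => h (by simp [h1, h2])
  · exact hA _ _ h1

theorem Homogeneous.one [DecidableEq B] : K.Homogeneous K 1 0 := by
  intro b b' h
  have : b = b' := by
    by_contra hb
    exact h (Matrix.one_apply_ne hb)
  simp [this]

theorem isComplex_of_mul_self [Fintype B] {A : Matrix B B ℤ} (hA : K.Homogeneous K A 1)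
    (hAK : ∀ b b', K.i b' = K.i b + 1 → K.j b' = K.j b → K.coeff b b' = A b b')
    (h : A * A = 0) : K.IsComplex := by
  intro p q
  have e (p p' : ℤ) (hp : p' = p + 1) : K.d p p' q = K.ofMatrix K A p p' q := by
    rw [d_eq_ofMatrix]
    refine ofMatrix_congr _ _ fun b b' h1 h2 h3 h4 => hAK _ _ ?_ ?_
    · rw [h1, h3, hp]
    · rw [h2, h4]
  rw [e _ _ rfl, e (p + 1) (p + 2) (by ring), ofMatrix_mul K K K hA rfl, h, ofMatrix_zero]

/-- A homotopy equivalence given by homogeneous matrices (acting on rows) induces an isomorphism of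
cohomology. -/
theorem nonempty_cohomology_equiv [Fintype B] [Fintype B'] [DecidableEq B] [DecidableEq B']
    {D : Matrix B B ℤ} {D' : Matrix B' B' ℤ} {f : Matrix B' B ℤ} {g : Matrix B B' ℤ}
    {h : Matrix B B ℤ}
    (hD : K.Homogeneous K D 1) (hD' : K'.Homogeneous K' D' 1) (hf : K'.Homogeneous K f 0)
    (hg : K.Homogeneous K' g 0) (hh : K.Homogeneous K h (-1))
    (hDK : ∀ b b', K.i b' = K.i b + 1 → K.j b' = K.j b → K.coeff b b' = D b b')
    (hDK' : ∀ b b', K'.i b' = K'.i b + 1 → K'.j b' = K'.j b → K'.coeff b b' = D' b b')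
    (hfD : f * D = D' * f) (hDg : D * g = g * D') (hfg : f * g = 1)
    (hgf : g * f = 1 + h * D + D * h) (p q : ℤ) :
    Nonempty (K'.Cohomology p q ≃ₗ[ℤ] K.Cohomology p q) := by
  have e (p p' : ℤ) (hp : p' = p + 1) : K.d p p' q = K.ofMatrix K D p p' q := by
    rw [d_eq_ofMatrix]
    refine ofMatrix_congr _ _ fun b b' h1 h2 h3 h4 => hDK _ _ ?_ ?_
    · rw [h1, h3, hp]
    · rw [h2, h4]
  have e' (p p' : ℤ) (hp : p' = p + 1) : K'.d p p' q = K'.ofMatrix K' D' p p' q := by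
    rw [d_eq_ofMatrix]
    refine ofMatrix_congr _ _ fun b b' h1 h2 h3 h4 => hDK' _ _ ?_ ?_
    · rw [h1, h3, hp]
    · rw [h2, h4]
  let F (p : ℤ) := K'.ofMatrix K f p p q
  let G (p : ℤ) := K.ofMatrix K' g p p q
  have hF (p p' : ℤ) (hp : p' = p + 1) (x) : F p' (K'.d p p' q x) = K.d p p' q (F p x) := by
    rw [e _ _ hp, e' _ _ hp, ← LinearMap.comp_apply, ← LinearMap.comp_apply,
      ofMatrix_mul K' K' K hD' hp, ofMatrix_mul K' K K hf (by simp), hfD]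
  have hG (p p' : ℤ) (hp : p' = p + 1) (x) : G p' (K.d p p' q x) = K'.d p p' q (G p x) := by
    rw [e _ _ hp, e' _ _ hp, ← LinearMap.comp_apply, ← LinearMap.comp_apply,
      ofMatrix_mul K K K' hD hp, ofMatrix_mul K K' K' hg (by simp), hDg]
  have hGF (x) : G p (F p x) = x := by
    rw [← LinearMap.comp_apply, ofMatrix_mul K' K K' hf (by simp), hfg, ofMatrix_one]
    rfl
  have hFG (x) : F p (G p x) = x + K.d (p - 1) p q (K.ofMatrix K h p (p - 1) q x) +
      K.ofMatrix K h (p + 1) p q (K.d p (p + 1) q x) := by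
    rw [← LinearMap.comp_apply, ofMatrix_mul K K' K hg (by simp), hgf, ofMatrix_add, ofMatrix_add,
      ofMatrix_one, ← ofMatrix_mul K K K hh (show p - 1 = p + -1 by ring),
      ← ofMatrix_mul K K K hD rfl, e _ _ rfl, e (p - 1) p (by ring)]
    rfl
  refine ⟨cohomologyEquiv _ _ _ _ (F p) (G p) ?_ ?_ ?_ ?_ ?_ ?_⟩
  · intro x hx
    rw [← hF _ _ rfl, hx, map_zero]
  · intro x
    exact ⟨_, hF _ _ (by ring) x⟩
  · intro x hx
    rw [← hG _ _ rfl, hx, map_zero]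
  · intro x
    exact ⟨_, hG _ _ (by ring) x⟩
  · intro x _
    exact ⟨0, by rw [hGF]; simp⟩
  · intro x hx
    exact ⟨_, by rw [hFG, hx, map_zero, add_zero, add_sub_cancel_left]⟩

end

end BasedComplex

namespace BasedComplex

variable {B : Type*} {K : BasedComplex B} {M : B → B → Prop}

/-- A path in a relation without cycles visits no vertex twice. -/
theorem _root_.List.IsChain.nodup_of_acyclic {α : Type*} {r : α → α → Prop} {l : List α}
    (h : l.IsChain r) (hr : ∀ a, ¬ Relation.TransGen r a a) : l.Nodup := by
  have : l.IsChain (Relation.TransGen r) := h.imp fun _ _ hab => .single hab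
  refine (List.isChain_iff_pairwise.1 this).imp ?_
  rintro a b hab rfl
  exact hr a hab

theorem finite_setOf_isPath [Finite B] (V : Set B) (b b' : B) :
    {l : List B | K.IsPath M V b b' l}.Finite := by
  classical
  have := Fintype.ofFinite B
  have : Finite {l : List B // l.Nodup} := Finite.of_fintype _
  refine Set.Finite.subset (s := {l : List B | l.Nodup}) (@Set.toFinite _ _ this) ?_
  intro l hl
  exact hl.nodup

/-- The weighted adjacency matrix of the Hasse diagram with the matched edges reversed. -/
noncomputable def arrowMatrix (K : BasedComplex B) (M : B → B → Prop) : Matrix B B ℤ :=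
  open Classical in fun b b' => if K.Arrow M b b' then K.arrowWeight M b b' else 0

/-- Splitting off the first arrow of a path. -/
theorem gamma_univ_eq [Fintype B] [DecidableEq B]
    (hM : ∀ b, ¬ Relation.TransGen (K.Arrow M) b b) (b b' : B) :
    K.Gamma M Set.univ b b' = (if b = b' then 1 else 0) +
      ∑ b₁, K.arrowMatrix M b b₁ * K.Gamma M Set.univ b₁ b' := by
  classical
  let S (b : B) := {l : List B | K.IsPath M Set.univ b b' l}
  let U (b₁ : B) : Set (List B) := if K.Arrow M b b₁ then (b :: ·) '' S b₁ else ∅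
  have hhead : ∀ b l, l ∈ S b → ∃ l', l = b :: l' := by
    intro b l hl
    cases l with
    | nil => have := hl.head; simp at this
    | cons a l' =>
      have := hl.head
      simp only [List.head?_cons, Option.some.injEq] at this
      exact ⟨l', by rw [this]⟩
  have hS : S b = (if b = b' then {[b]} else ∅) ∪ ⋃ b₁, U b₁ := by
    ext l
    constructor
    · intro hl
      obtain ⟨l', rfl⟩ := hhead b l hl
      cases l' with
      | nil =>
        have := hl.last
        simp only [List.getLast?_singleton, Option.some.injEq] at this
        left
        simp [this]
      | cons b₁ l'' =>
        right
        refine Set.mem_iUnion.2 ⟨b₁, ?_⟩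
        have hc := hl.chain
        rw [List.isChain_cons_cons] at hc
        simp only [U, if_pos hc.1]
        refine ⟨b₁ :: l'', ⟨hc.2, hl.nodup.of_cons, rfl, ?_, fun _ _ => trivial⟩, rfl⟩
        have := hl.last
        rwa [List.getLast?_cons_cons] at this
    · rintro (h | h)
      · split_ifs at h with hb
        · rw [Set.mem_singleton_iff] at h
          subst h hb
          exact ⟨by simp, by simp, rfl, rfl, fun _ _ => trivial⟩
        · exact h.elim
      · obtain ⟨b₁, h⟩ := Set.mem_iUnion.1 h
        simp only [U] at h
        split_ifs at h with hb
        · obtain ⟨l', hl', rfl⟩ := h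
          obtain ⟨l'', rfl⟩ := hhead b₁ l' hl'
          have hc : (b :: b₁ :: l'').IsChain (K.Arrow M) := List.isChain_cons_cons.2 ⟨hb, hl'.chain⟩
          refine ⟨hc, hc.nodup_of_acyclic hM, rfl, ?_, fun _ _ => trivial⟩
          have := hl'.last
          simpa using this
        · exact h.elim
  have hU : ∀ b₁, (U b₁).Finite := by
    intro b₁
    simp only [U]
    split_ifs
    · exact (finite_setOf_isPath _ _ _).image _
    · exact Set.finite_empty
  have hsum : ∀ b₁, ∑ᶠ l ∈ U b₁, K.pathWeight M l =
      K.arrowMatrix M b b₁ * K.Gamma M Set.univ b₁ b' := by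
    intro b₁
    simp only [U, arrowMatrix]
    split_ifs with hb
    · rw [finsum_mem_image (by intro x _ y _ h; simpa using h), Gamma, ← smul_eq_mul,
        smul_finsum_mem (finite_setOf_isPath _ _ _)]
      refine finsum_mem_congr rfl fun l hl => ?_
      obtain ⟨l'', rfl⟩ := hhead b₁ l hl
      rfl
    · simp
  have hdisj : Disjoint (if b = b' then {[b]} else ∅ : Set (List B)) (⋃ b₁, U b₁) := by
    rw [Set.disjoint_left]
    intro l hl h
    split_ifs at hl with hb
    · rw [Set.mem_singleton_iff] at hl
      subst hl
      obtain ⟨b₁, h⟩ := Set.mem_iUnion.1 h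
      simp only [U] at h
      split_ifs at h
      · obtain ⟨l', hl', he⟩ := h
        obtain ⟨l'', rfl⟩ := hhead b₁ l' hl'
        simp at he
      · exact h
    · exact hl
  have hpair : Pairwise (Function.onFun Disjoint U) := by
    intro b₁ b₂ hne
    rw [Function.onFun, Set.disjoint_left]
    intro l h₁ h₂
    simp only [U] at h₁ h₂
    split_ifs at h₁ h₂
    · obtain ⟨l₁, hl₁, he₁⟩ := h₁
      obtain ⟨l₂, hl₂, he₂⟩ := h₂
      obtain ⟨k₁, rfl⟩ := hhead b₁ l₁ hl₁
      obtain ⟨k₂, rfl⟩ := hhead b₂ l₂ hl₂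
      rw [← he₂] at he₁
      simp only [List.cons.injEq] at he₁
      exact hne he₁.2.1
    all_goals first | exact h₁ | exact h₂
  change ∑ᶠ l ∈ S b, K.pathWeight M l = _
  rw [hS, finsum_mem_union hdisj (by split_ifs <;> simp) (Set.finite_iUnion hU)]
  congr 1
  · split_ifs
    · rw [finsum_mem_singleton]; rfl
    · simp
  · rw [finsum_mem_iUnion hpair hU, finsum_eq_sum_of_fintype]
    exact Finset.sum_congr rfl fun b₁ _ => hsum b₁

/-- A matrix whose nonzero entries lie over a relation without cycles is nilpotent. -/
theorem isNilpotent_of_acyclic [Fintype B] [DecidableEq B] {r : B → B → Prop}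
    (hr : ∀ b, ¬ Relation.TransGen r b b) {N : Matrix B B ℤ}
    (hN : ∀ b b', N b b' ≠ 0 → Relation.TransGen r b b') : IsNilpotent N := by
  classical
  let ht (b : B) : ℕ := (Finset.univ.filter fun a => Relation.TransGen r a b).card
  have hlt : ∀ b b', N b b' ≠ 0 → ht b < ht b' := by
    intro b b' h
    refine Finset.card_lt_card ⟨?_, ?_⟩
    · intro a ha
      simp only [Finset.mem_filter, Finset.mem_univ, true_and] at ha ⊢
      exact ha.trans (hN b b' h)
    · intro hsub
      have := hsub (by simpa using hN b b' h : b ∈ _)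
      simp only [Finset.mem_filter, Finset.mem_univ, true_and] at this
      exact hr b this
  have hpow : ∀ k b b', (N ^ k) b b' ≠ 0 → ht b + k ≤ ht b' := by
    intro k
    induction k with
    | zero =>
      intro b b' h
      have : b = b' := by
        by_contra hb
        exact h (by rw [pow_zero, Matrix.one_apply_ne hb])
      simp [this]
    | succ k ih =>
      intro b b' h
      rw [pow_succ, Matrix.mul_apply] at h
      obtain ⟨a, -, ha⟩ := Finset.exists_ne_zero_of_sum_ne_zero h
      have h1 := ih _ _ (left_ne_zero_of_mul ha)
      have h2 := hlt _ _ (right_ne_zero_of_mul ha)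
      omega
  refine ⟨Fintype.card B + 1, ?_⟩
  ext b b'
  by_contra h
  have := hpow _ _ _ h
  have h2 : ht b' ≤ Fintype.card B := Finset.card_le_univ _
  omega

section Morse

open Classical

/-- The matched part of the differential. -/
noncomputable def matchedPart (K : BasedComplex B) (M : B → B → Prop) : Matrix B B ℤ :=
  fun b b' => if M b b' then K.coeff b b' else 0

/-- The part of the differential outside the matching. -/
noncomputable def unmatchedPart (K : BasedComplex B) (M : B → B → Prop) : Matrix B B ℤ :=
  fun b b' => if M b b' then 0 else K.coeff b b'

/-- The reversed matched edges, with their weights. -/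
noncomputable def reversedPart (K : BasedComplex B) (M : B → B → Prop) : Matrix B B ℤ :=
  fun b b' => if M b' b then -(1 / K.coeff b' b) else 0

/-- The projection to the span of the critical basis elements. -/
noncomputable def criticalProjection (M : B → B → Prop) : Matrix B B ℤ :=
  Matrix.diagonal fun b => if IsCritical M b then 1 else 0

theorem matchedPart_ne_zero {b b' : B} (h : K.matchedPart M b b' ≠ 0) : M b b' := by
  by_contra h'
  exact h (by simp [matchedPart, h'])

theorem reversedPart_ne_zero {b b' : B} (h : K.reversedPart M b b' ≠ 0) : M b' b := by
  by_contra h'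
  exact h (by simp [reversedPart, h'])

theorem unmatchedPart_ne_zero {b b' : B} (h : K.unmatchedPart M b b' ≠ 0) :
    K.coeff b b' ≠ 0 ∧ ¬ M b b' := by
  by_cases h' : M b b'
  · exact absurd (by simp [unmatchedPart, h']) h
  · exact ⟨fun h0 => h (by simp [unmatchedPart, h', h0]), h'⟩

/-- A target of the matching is never a source. -/
theorem IsAcyclicMatching.not_source (hM : K.IsAcyclicMatching M) {a b c : B} (h : M a b) :
    ¬ M b c := by
  intro h'
  have h1 := hM.matching _ _ _ _ h h' (by tauto)
  rw [← h1.1] at h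
  exact hM.acyclic a (.single (Or.inr h))

variable [Fintype B]

theorem matchedPart_mul_reversedPart_apply (hM : K.IsAcyclicMatching M) (b c : B) :
    (K.matchedPart M * K.reversedPart M) b c = if b = c ∧ ∃ a, M b a then -1 else 0 := by
  rw [Matrix.mul_apply]
  simp only [matchedPart, reversedPart]
  split_ifs with h
  · obtain ⟨rfl, a, ha⟩ := h
    rw [Finset.sum_eq_single a]
    · simp only [if_pos ha]
      rcases Int.isUnit_iff.1 (hM.unit _ _ ha) with h | h <;> rw [h] <;> norm_num
    · intro a' _ hne
      rw [if_neg, zero_mul]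
      intro h'
      exact hne (hM.matching _ _ _ _ h' ha (Or.inl rfl)).2
    · simp
  · refine Finset.sum_eq_zero fun a _ => ?_
    by_cases h1 : M b a
    · by_cases h2 : M c a
      · exact absurd ⟨(hM.matching _ _ _ _ h1 h2 (by tauto)).1, a, h1⟩ h
      · simp [h2]
    · simp [h1]

theorem reversedPart_mul_matchedPart_apply (hM : K.IsAcyclicMatching M) (b c : B) :
    (K.reversedPart M * K.matchedPart M) b c = if b = c ∧ ∃ a, M a b then -1 else 0 := by
  rw [Matrix.mul_apply]
  simp only [matchedPart, reversedPart]
  split_ifs with h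
  · obtain ⟨rfl, a, ha⟩ := h
    rw [Finset.sum_eq_single a]
    · simp only [if_pos ha]
      rcases Int.isUnit_iff.1 (hM.unit _ _ ha) with h | h <;> rw [h] <;> norm_num
    · intro a' _ hne
      rw [if_neg, zero_mul]
      intro h'
      exact hne (hM.matching _ _ _ _ h' ha (by tauto)).1
    · simp
  · refine Finset.sum_eq_zero fun a _ => ?_
    by_cases h1 : M a b
    · by_cases h2 : M a c
      · exact absurd ⟨(hM.matching _ _ _ _ h1 h2 (by tauto)).2, a, h1⟩ h
      · simp [h2]
    · simp [h1]

theorem matchedPart_mul_self (hM : K.IsAcyclicMatching M) :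
    K.matchedPart M * K.matchedPart M = 0 := by
  ext b c
  rw [Matrix.mul_apply]
  refine Finset.sum_eq_zero fun a _ => ?_
  simp only [matchedPart]
  by_cases h1 : M b a
  · simp [hM.not_source h1]
  · simp [h1]

theorem reversedPart_mul_self (hM : K.IsAcyclicMatching M) :
    K.reversedPart M * K.reversedPart M = 0 := by
  ext b c
  rw [Matrix.mul_apply]
  refine Finset.sum_eq_zero fun a _ => ?_
  simp only [reversedPart]
  by_cases h1 : M c a
  · simp [hM.not_source h1]
  · simp [h1]

theorem contraction_eq (hM : K.IsAcyclicMatching M) :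
    K.matchedPart M * K.reversedPart M + K.reversedPart M * K.matchedPart M =
      criticalProjection M - 1 := by
  ext b c
  rw [Matrix.add_apply, matchedPart_mul_reversedPart_apply hM,
    reversedPart_mul_matchedPart_apply hM, Matrix.sub_apply, criticalProjection,
    Matrix.diagonal_apply, Matrix.one_apply]
  by_cases hbc : b = c
  · subst hbc
    by_cases h1 : ∃ a, M b a
    · have h2 : ¬ ∃ a, M a b := fun ⟨a, ha⟩ => h1.elim fun _ => hM.not_source ha
      have h3 : ¬ IsCritical M b := fun h => h1.elim fun a ha => (h a).1 ha
      simp [h1, h2, h3]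
    · by_cases h2 : ∃ a, M a b
      · have h3 : ¬ IsCritical M b := fun h => h2.elim fun a ha => (h a).2 ha
        simp [h1, h2, h3]
      · have h3 : IsCritical M b := fun a => ⟨fun h => h1 ⟨a, h⟩, fun h => h2 ⟨a, h⟩⟩
        simp [h1, h2, h3]
  · simp [hbc]

theorem criticalProjection_mul (A : Matrix B B ℤ)
    (h : ∀ b b', A b b' ≠ 0 → ¬ IsCritical M b) : criticalProjection M * A = 0 := by
  ext b b'
  have : (criticalProjection M * A) b b' = 0 := by
    rw [criticalProjection, Matrix.diagonal_mul]
    by_cases h1 : A b b' = 0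
    · simp [h1]
    · simp [h _ _ h1]
  exact this

theorem mul_criticalProjection (A : Matrix B B ℤ)
    (h : ∀ b b', A b b' ≠ 0 → ¬ IsCritical M b') : A * criticalProjection M = 0 := by
  ext b b'
  have : (A * criticalProjection M) b b' = 0 := by
    rw [criticalProjection, Matrix.mul_diagonal]
    by_cases h1 : A b b' = 0
    · simp [h1]
    · simp [h _ _ h1]
  exact this

end Morse

end BasedComplex

namespace BasedComplex

variable {B : Type*} {K : BasedComplex B} {M : B → B → Prop}

section Morse

open Classical

/-- For homogeneous incidence numbers, the weights of the arrows are those of the unmatched and of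
the reversed edges. -/
theorem arrowMatrix_eq (hM : K.IsAcyclicMatching M) (hK : K.Homogeneous K K.coeff 1) :
    K.arrowMatrix M = K.unmatchedPart M + K.reversedPart M := by
  ext b b'
  rw [Matrix.add_apply]
  simp only [arrowMatrix, unmatchedPart, reversedPart, Arrow, arrowWeight]
  by_cases h1 : M b' b
  · have h2 := hK _ _ (hM.edge _ _ h1)
    have h3 : K.coeff b b' = 0 := by
      by_contra h
      have := hK _ _ h
      omega
    simp [h1, h3]
  · by_cases h2 : M b b'
    · simp [h1, h2]
    · by_cases h3 : K.coeff b b' = 0 <;> simp [h1, h2, h3]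

variable [Fintype B]

theorem isUnit_one_sub_unmatchedPart_mul_reversedPart (hM : K.IsAcyclicMatching M) :
    IsUnit (1 - K.unmatchedPart M * K.reversedPart M) := by
  refine IsNilpotent.isUnit_one_sub (isNilpotent_of_acyclic hM.acyclic fun b b' h => ?_)
  rw [Matrix.mul_apply] at h
  obtain ⟨a, -, ha⟩ := Finset.exists_ne_zero_of_sum_ne_zero h
  exact .tail (.single (Or.inl (unmatchedPart_ne_zero (left_ne_zero_of_mul ha))))
    (Or.inr (reversedPart_ne_zero (right_ne_zero_of_mul ha)))

/-- `A` is the sum of the weights of the paths that alternate between unmatched and reversed edges,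
beginning and ending with an unmatched one. Between critical elements of consecutive degrees every
path is of this kind. -/
theorem gamma_eq_of_isCritical (hM : K.IsAcyclicMatching M) (hK : K.Homogeneous K K.coeff 1)
    {A : Matrix B B ℤ} (hA : A = K.unmatchedPart M + K.unmatchedPart M * K.reversedPart M * A)
    {c c' : B} (hc : IsCritical M c) (hc' : IsCritical M c') (hi : K.i c' = K.i c + 1) :
    K.Gamma M Set.univ c c' = A c c' := by
  set δ := K.unmatchedPart M with hδ
  set H := K.reversedPart M with hH
  set y : B → ℤ := fun b => K.Gamma M Set.univ b c' with hy
  -- `f` is the degree, raised by one at the sources of the matching; it does not decrease along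
  -- arrows, and it is constant exactly along reversed edges and arrows from a source to the next
  -- degree that do not end at a source
  set f : B → ℤ := fun b => if ∃ a, M b a then K.i b + 1 else K.i b with hf
  have hyrec : ∀ b, y b = (if b = c' then 1 else 0) + ∑ a, (δ b a + H b a) * y a := by
    intro b
    rw [hy]
    simp only
    rw [gamma_univ_eq hM.acyclic, arrowMatrix_eq hM hK]
    rfl
  have hδi : ∀ b a, δ b a ≠ 0 → K.i a = K.i b + 1 := fun b a h =>
    (hK _ _ (unmatchedPart_ne_zero h).1).1
  have hfi : ∀ b, K.i b ≤ f b := by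
    intro b; simp only [hf]; split_ifs <;> omega
  have hfi' : ∀ b, f b ≤ K.i b + 1 := by
    intro b; simp only [hf]; split_ifs <;> omega
  have hfs : ∀ b, (¬ ∃ a, M b a) → f b = K.i b := fun b h => if_neg h
  have hHf : ∀ b a, H b a ≠ 0 → f b = f a := by
    intro b a h
    have h := reversedPart_ne_zero h
    have h1 : f a = K.i a + 1 := if_pos ⟨b, h⟩
    rw [hfs b fun ⟨_, h'⟩ => hM.not_source h h', h1, (hK _ _ (hM.edge _ _ h)).1]
  have hfc' : f c' = K.i c' := hfs _ fun ⟨a, h⟩ => (hc' a).1 h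
  have hwf : WellFounded (flip (Relation.TransGen (K.Arrow M))) := by
    have : Std.Irrefl (flip (Relation.TransGen (K.Arrow M))) := ⟨hM.acyclic⟩
    have : IsTrans B (flip (Relation.TransGen (K.Arrow M))) := ⟨fun _ _ _ h h' => h'.trans h⟩
    exact Finite.wellFounded_of_trans_of_irrefl _
  have hδarrow : ∀ b a, δ b a ≠ 0 → K.Arrow M b a := fun b a h => Or.inl (unmatchedPart_ne_zero h)
  have hHarrow : ∀ b a, H b a ≠ 0 → K.Arrow M b a := fun b a h => Or.inr (reversedPart_ne_zero h)
  have hmono : ∀ b, y b ≠ 0 → f b ≤ f c' := by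
    intro b
    induction b using hwf.induction with
    | _ b ih =>
      intro h
      rw [hyrec] at h
      by_cases hb : b = c'
      · rw [hb]
      · rw [if_neg hb, zero_add] at h
        obtain ⟨a, -, ha⟩ := Finset.exists_ne_zero_of_sum_ne_zero h
        have hya := right_ne_zero_of_mul ha
        have hw := left_ne_zero_of_mul ha
        by_cases hδa : δ b a = 0
        · rw [hδa, zero_add] at hw
          rw [hHf b a hw]
          exact ih a (.single (hHarrow _ _ hw)) hya
        · have h1 := ih a (.single (hδarrow _ _ hδa)) hya
          have h2 := hδi _ _ hδa
          have h3 := hfi a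
          have h4 := hfi' b
          omega
  -- the column of `1 + H A` at `c'` satisfies the same recursion as `y` in the degree of `c'`
  set v : B → ℤ := fun b => (if b = c' then 1 else 0) + ∑ a, H b a * A a c' with hv
  have hAv : ∀ b, A b c' = ∑ a, δ b a * v a := by
    intro b
    conv_lhs => rw [hA, Matrix.mul_assoc, Matrix.add_apply, Matrix.mul_apply]
    simp only [hv, mul_add, Finset.sum_add_distrib, Matrix.mul_apply]
    simp
  have hyv : ∀ b, K.i b = K.i c' → y b = v b := by
    intro b
    induction b using hwf.induction with
    | _ b ih =>
      intro hb
      by_cases hs : ∃ a, M b a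
      · obtain ⟨a, ha⟩ := hs
        have h1 : y b = 0 := by
          by_contra h
          have h2 := hmono b h
          have h3 : f b = K.i b + 1 := if_pos ⟨a, ha⟩
          omega
        have h2 : b ≠ c' := by
          rintro rfl
          exact (hc' a).1 ha
        rw [h1, hv]
        simp only [if_neg h2, zero_add]
        refine (Finset.sum_eq_zero fun a' _ => ?_).symm
        by_cases h3 : H b a' = 0
        · simp [h3]
        · exact absurd ha (hM.not_source (reversedPart_ne_zero h3))
      · rw [hyrec, hv]
        simp only
        congr 1
        refine Finset.sum_congr rfl fun a _ => ?_
        by_cases hHa : H b a = 0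
        · rw [hHa, add_zero, zero_mul]
          by_cases h1 : δ b a = 0
          · simp [h1]
          · by_cases h2 : y a = 0
            · simp [h2]
            · have h3 := hmono a h2
              have h4 := hfi a
              have h5 := hδi _ _ h1
              omega
        · have hMab := reversedPart_ne_zero hHa
          have h1 : δ b a = 0 := by
            by_contra h1
            have := hδi _ _ h1
            have := (hK _ _ (hM.edge _ _ hMab)).1
            omega
          rw [h1, zero_add]
          congr 1
          have hia := (hK _ _ (hM.edge _ _ hMab)).1
          have hac : a ≠ c' := by
            rintro rfl
            omega
          rw [hyrec, if_neg hac, zero_add, hAv]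
          refine Finset.sum_congr rfl fun a' _ => ?_
          have h2 : H a a' = 0 := by
            by_contra h2
            exact hM.not_source (reversedPart_ne_zero h2) hMab
          rw [h2, add_zero]
          by_cases h3 : δ a a' = 0
          · simp [h3]
          · rw [ih a' (.tail (.single (hHarrow _ _ hHa)) (hδarrow _ _ h3))]
            have := hδi _ _ h3
            omega
  have hcc' : c ≠ c' := by
    rintro rfl
    omega
  change y c = _
  rw [hyrec, if_neg hcc', zero_add, hAv]
  refine Finset.sum_congr rfl fun a _ => ?_
  have h2 : H c a = 0 := by
    by_contra h2
    exact (hc a).2 (reversedPart_ne_zero h2)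
  rw [h2, add_zero]
  by_cases h3 : δ c a = 0
  · simp [h3]
  · rw [hyv]
    have := hδi _ _ h3
    omega

theorem submatrix_mul_criticalProjection_mul {B' : Type*} [Fintype B'] {φ : B' → B}
    (hφ : Set.BijOn φ Set.univ {b | IsCritical M b}) {C C' : Type*} {e : C → B} {e' : C' → B}
    (P Q : Matrix B B ℤ) :
    P.submatrix e φ * Q.submatrix φ e' = (P * criticalProjection M * Q).submatrix e e' := by
  ext b b'
  rw [Matrix.submatrix_apply, Matrix.mul_apply, Matrix.mul_apply]
  simp only [Matrix.submatrix_apply, criticalProjection, Matrix.mul_diagonal]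
  have hinj : Function.Injective φ := Set.injOn_univ.1 hφ.injOn
  rw [← Finset.sum_image (f := fun x => P (e b) x * Q x (e' b')) (s := Finset.univ) (g := φ)
    (fun x _ y _ h => hinj h)]
  have him : Finset.univ.image φ = Finset.univ.filter fun b => IsCritical M b := by
    ext b
    simp only [Finset.mem_image, Finset.mem_univ, true_and, Finset.mem_filter]
    constructor
    · rintro ⟨a, rfl⟩
      exact hφ.mapsTo (Set.mem_univ a)
    · intro hb
      obtain ⟨a, -, ha⟩ := hφ.surjOn hb
      exact ⟨a, ha⟩
  rw [him, Finset.sum_filter]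
  refine Finset.sum_congr rfl fun x _ => ?_
  split_ifs <;> simp

theorem submatrix_id_mul_submatrix_id {C C' : Type*} (e : C → B) (e' : C' → B)
    (P Q : Matrix B B ℤ) : P.submatrix e id * Q.submatrix id e' = (P * Q).submatrix e e' := rfl

theorem criticalProjection_mul_submatrix {B' C : Type*} {φ : B' → B}
    (hφ : ∀ b, IsCritical M (φ b)) (e : C → B) (P : Matrix B B ℤ) :
    (criticalProjection M * P).submatrix φ e = P.submatrix φ e := by
  ext b c
  rw [Matrix.submatrix_apply, criticalProjection, Matrix.diagonal_mul, if_pos (hφ b), one_mul,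
    Matrix.submatrix_apply]

theorem submatrix_mul_criticalProjection {B' C : Type*} {φ : B' → B}
    (hφ : ∀ b, IsCritical M (φ b)) (e : C → B) (P : Matrix B B ℤ) :
    (P * criticalProjection M).submatrix e φ = P.submatrix e φ := by
  ext b c
  rw [Matrix.submatrix_apply, criticalProjection, Matrix.mul_diagonal, if_pos (hφ c), mul_one,
    Matrix.submatrix_apply]

end Morse

open Classical in
/-- The main theorem of algebraic discrete Morse theory: the complex on the critical basis elements
whose incidence numbers are the sums of the weights of the alternating paths computes the
cohomology. -/
theorem IsAcyclicMatching.morse [Finite B] (hM : K.IsAcyclicMatching M)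
    (hK : K.Homogeneous K K.coeff 1)
    (hsq : ∀ b b', ∑ᶠ a, K.coeff b a * K.coeff a b' = 0)
    {B' : Type*} [Finite B'] {K' : BasedComplex B'} {φ : B' → B}
    (hφ : Set.BijOn φ Set.univ {b | IsCritical M b}) (hi : ∀ b, K'.i b = K.i (φ b))
    (hj : ∀ b, K'.j b = K.j (φ b))
    (hcoeff : ∀ b b', K'.i b' = K'.i b + 1 →
      K'.coeff b b' = K.Gamma M Set.univ (φ b) (φ b')) :
    K'.IsComplex ∧ ∀ p q : ℤ, Nonempty (K'.Cohomology p q ≃ₗ[ℤ] K.Cohomology p q) := by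
  have := Fintype.ofFinite B
  have := Fintype.ofFinite B'
  set δ := K.unmatchedPart M with hδ
  set E := K.matchedPart M with hE
  set H := K.reversedPart M with hH
  set π : Matrix B B ℤ := criticalProjection M with hπ
  have hδE : δ + E = (K.coeff : Matrix B B ℤ) := by
    ext b b'
    rw [Matrix.add_apply]
    simp only [hδ, hE, unmatchedPart, matchedPart]
    split_ifs <;> simp
  obtain ⟨u, hu⟩ := isUnit_one_sub_unmatchedPart_mul_reversedPart hM
  set S : Matrix B B ℤ := ↑u⁻¹ with hSdef
  have hS : S * (1 - δ * H) = 1 := by rw [← hu]; exact u.inv_mul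
  have hS' : (1 - δ * H) * S = 1 := by rw [← hu]; exact u.mul_inv
  set A := S * δ with hA
  have hAeq : A = δ + δ * H * A := by
    have h1 : (1 - δ * H) * A = δ := by rw [hA, ← mul_assoc, hS', one_mul]
    rw [sub_mul, one_mul, sub_eq_iff_eq_add] at h1
    exact h1
  have hsq' : (δ + E) * (δ + E) = 0 := by
    ext b b'
    rw [Matrix.mul_apply, Matrix.zero_apply, ← hsq b b', finsum_eq_sum_of_fintype]
    exact Finset.sum_congr rfl fun a _ => by rw [hδE]
  have hcrit : ∀ {b a}, M b a → ¬ IsCritical M b := fun h hc => (hc _).1 h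
  have hcrit' : ∀ {b a}, M a b → ¬ IsCritical M b := fun h hc => (hc _).2 h
  have hππ : π * π = π := by
    rw [hπ, criticalProjection, Matrix.diagonal_mul_diagonal]
    congr 1
    ext b
    split_ifs <;> simp
  obtain ⟨hsqA, p2, p3, p4, p5⟩ := perturbation_lemma (δ := δ) (E := E) (H := H) (π := π) hsq'
    (matchedPart_mul_self hM) (reversedPart_mul_self hM) (contraction_eq hM) hππ
    (criticalProjection_mul H fun _ _ h => hcrit' (reversedPart_ne_zero h))
    (mul_criticalProjection H fun _ _ h => hcrit (reversedPart_ne_zero h))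
    (criticalProjection_mul E fun _ _ h => hcrit (matchedPart_ne_zero h))
    (mul_criticalProjection E fun _ _ h => hcrit' (matchedPart_ne_zero h)) hS hS' hA
  -- homogeneity of all matrices involved
  have gD : K.Homogeneous K (δ + E) 1 := by rw [hδE]; exact hK
  have gδ : K.Homogeneous K δ 1 := fun b b' h => hK _ _ (unmatchedPart_ne_zero h).1
  have gH : K.Homogeneous K H (-1) := fun b b' h => by
    have := hK _ _ (hM.edge _ _ (reversedPart_ne_zero h))
    exact ⟨by omega, this.2.symm⟩
  have gA : K.Homogeneous K A 1 := by
    have hnil : IsNilpotent (δ * H) := isNilpotent_of_acyclic hM.acyclic fun b b' h => by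
      rw [Matrix.mul_apply] at h
      obtain ⟨a, -, ha⟩ := Finset.exists_ne_zero_of_sum_ne_zero h
      exact .tail (.single (Or.inl (unmatchedPart_ne_zero (left_ne_zero_of_mul ha))))
        (Or.inr (reversedPart_ne_zero (right_ne_zero_of_mul ha)))
    obtain ⟨n, hn⟩ := hnil
    have hpow : ∀ k, K.Homogeneous K ((δ * H) ^ k) 0 := by
      intro k
      induction k with
      | zero => exact Homogeneous.one
      | succ k ih => rw [pow_succ]; exact ih.mul (gδ.mul gH)
    have hexp : ∀ k, A = (∑ l ∈ Finset.range k, (δ * H) ^ l * δ) + (δ * H) ^ k * A := by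
      intro k
      induction k with
      | zero => simp
      | succ k ih =>
        rw [Finset.sum_range_succ, add_assoc, pow_succ, Matrix.mul_assoc ((δ * H) ^ k),
          ← Matrix.mul_add, ← hAeq]
        exact ih
    have : ∀ k, K.Homogeneous K (∑ l ∈ Finset.range k, (δ * H) ^ l * δ) 1 := by
      intro k
      induction k with
      | zero => intro b b' h; exact absurd rfl h
      | succ k ih => rw [Finset.sum_range_succ]; exact ih.add ((hpow k).mul gδ)
    rw [hexp n, hn, Matrix.zero_mul, add_zero]
    exact this n
  have gAH : K.Homogeneous K (1 + A * H) 0 := Homogeneous.one.add (gA.mul gH)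
  have gHA : K.Homogeneous K (1 + H * A) 0 := Homogeneous.one.add (gH.mul gA)
  have gh : K.Homogeneous K (H + H * A * H) (-1) := gH.add ((gH.mul gA).mul gH)
  have hφc : ∀ b, IsCritical M (φ b) := fun b => hφ.mapsTo (Set.mem_univ b)
  have gD' : K'.Homogeneous K' (A.submatrix φ φ) 1 := fun b b' h => by
    rw [hi, hj, hi, hj]; exact gA _ _ h
  have gf : K'.Homogeneous K ((1 + A * H).submatrix φ id) 0 := fun b b' h => by
    rw [hi, hj]; exact gAH _ _ h
  have gg : K.Homogeneous K' ((1 + H * A).submatrix id φ) 0 := fun b b' h => by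
    rw [hi, hj]; exact gHA _ _ h
  have hDK' : ∀ b b', K'.i b' = K'.i b + 1 → K'.j b' = K'.j b →
      K'.coeff b b' = A.submatrix φ φ b b' := by
    intro b b' h _
    rw [hcoeff b b' h]
    rw [hi, hi] at h
    exact gamma_eq_of_isCritical hM hK hAeq (hφc b) (hφc b') h
  refine ⟨isComplex_of_mul_self gD' hDK' ?_, nonempty_cohomology_equiv gD gD' gf gg gh ?_ hDK'
    ?_ ?_ ?_ ?_⟩
  · rw [submatrix_mul_criticalProjection_mul hφ, ← criticalProjection_mul_submatrix hφc,
      ← submatrix_mul_criticalProjection hφc, ← hπ]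
    have : π * (A * π * A) * π = 0 := by
      rw [← hsqA]
      calc π * (A * π * A) * π = π * A * π * A * π := by noncomm_ring
        _ = π * A * (π * π) * A * π := by rw [hππ]
        _ = π * A * π * (π * A * π) := by noncomm_ring
    rw [this]
    rfl
  · intro b b' _ _
    rw [hδE]
  · calc (1 + A * H).submatrix φ id * (δ + E)
        = (1 + A * H).submatrix φ id * (δ + E).submatrix id id := rfl
      _ = (A * π * (1 + A * H)).submatrix φ id := by
        rw [submatrix_id_mul_submatrix_id, ← criticalProjection_mul_submatrix hφc, ← hπ,
          ← mul_assoc, p2,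
          ← criticalProjection_mul_submatrix hφc id (A * π * (1 + A * H)), ← hπ]
        simp only [mul_assoc]
      _ = _ := (submatrix_mul_criticalProjection_mul hφ _ _).symm
  · calc (δ + E) * (1 + H * A).submatrix id φ
        = (δ + E).submatrix id id * (1 + H * A).submatrix id φ := rfl
      _ = ((1 + H * A) * π * A).submatrix id φ := by
        rw [submatrix_id_mul_submatrix_id, ← submatrix_mul_criticalProjection hφc, ← hπ,
          mul_assoc, p3,
          submatrix_mul_criticalProjection hφc]
      _ = _ := (submatrix_mul_criticalProjection_mul hφ _ _).symm
  · rw [submatrix_id_mul_submatrix_id, ← criticalProjection_mul_submatrix hφc,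
      ← submatrix_mul_criticalProjection hφc, ← hπ]
    have : π * ((1 + A * H) * (1 + H * A)) * π = π := by
      rw [← mul_assoc, mul_assoc, p4]
    rw [this, hπ, criticalProjection]
    ext b b'
    rw [Matrix.submatrix_apply, Matrix.diagonal_apply, Matrix.one_apply, if_pos (hφc b)]
    have hinj : Function.Injective φ := Set.injOn_univ.1 hφ.injOn
    simp only [hinj.eq_iff]
  · rw [submatrix_mul_criticalProjection_mul hφ, p5]
    rfl

end BasedComplex

/-! ### Activities and the interval decomposition of the set of spanning subgraphs -/

/-- The closure operator of a matroid on a finite set: a closure operator with the exchange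
property. -/
structure IsMatroidClosure {X : Type*} (cl : Set X → Set X) : Prop where
  subset : ∀ S, S ⊆ cl S
  mono : ∀ {S S'}, S ⊆ S' → cl S ⊆ cl S'
  idem : ∀ S, cl (cl S) ⊆ cl S
  exchange : ∀ {S e f}, e ∈ cl (insert f S) → e ∉ cl S → f ∈ cl (insert e S)

/-- `T` is a basis of the matroid with closure operator `cl`. -/
structure IsClosureBasis {X : Type*} (cl : Set X → Set X) (T : Set X) : Prop where
  spans : ∀ e, e ∈ cl T
  indep : ∀ e ∈ T, e ∉ cl (T \ {e})

/-- The element `f` of the basis `T` can be exchanged for the element `g`. -/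
def Exchangeable {X : Type*} (cl : Set X → Set X) (T : Set X) (f g : X) : Prop :=
  g ∉ cl (T \ {f})

/-- The elements that are internally or externally active with respect to the basis `T`. -/
def ActiveFor {X : Type*} [LinearOrder X] (cl : Set X → Set X) (T : Set X) (e : X) : Prop :=
  (e ∈ T ∧ ∀ g ∉ T, Exchangeable cl T e g → e ≤ g) ∨
    (e ∉ T ∧ ∀ f ∈ T, Exchangeable cl T f e → e ≤ f)

/-- `H` lies in the interval of the basis `T`: it agrees with `T` on the inactive elements. -/
def InInterval {X : Type*} [LinearOrder X] (cl : Set X → Set X) (T H : Set X) : Prop :=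
  ∀ e, ¬ ActiveFor cl T e → (e ∈ H ↔ e ∈ T)

namespace IsMatroidClosure

variable {X : Type*} {cl : Set X → Set X} {T H : Set X}

theorem mem_cl_of_subset_cl (h : IsMatroidClosure cl) {S S' : Set X} {e : X} (he : e ∈ cl S)
    (hS : S ⊆ cl S') : e ∈ cl S' :=
  h.idem _ (h.mono hS he)

theorem mem_of_mem_of_subset (h : IsMatroidClosure cl) {S S' : Set X} {e : X} (he : e ∈ cl S)
    (hS : S ⊆ S') : e ∈ cl S' :=
  h.mono hS he

/-- A set that spans a basis element contains it or an element that it can be exchanged for. -/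
theorem exists_exchangeable (h : IsMatroidClosure cl) (hT : IsClosureBasis cl T) {Y : Set X}
    {f : X} (hf : f ∈ T) (hY : f ∈ cl Y) :
    ∃ g ∈ Y, g = f ∨ (g ∉ T ∧ Exchangeable cl T f g) := by
  by_contra! hc
  refine hT.indep f hf (h.mem_cl_of_subset_cl hY fun g hg => ?_)
  obtain ⟨h1, h2⟩ := hc g hg
  by_cases hgT : g ∈ T
  · exact h.subset _ ⟨hgT, h1⟩
  · exact not_not.1 (h2 hgT)

/-- An element outside a basis is spanned by the rest of its fundamental circuit. -/
theorem mem_cl_setOf_exchangeable [Finite X] (h : IsMatroidClosure cl) (hT : IsClosureBasis cl T)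
    (g : X) : g ∈ cl {f ∈ T | Exchangeable cl T f g} := by
  obtain ⟨S, ⟨hST, hgS⟩, hmin⟩ := (Set.toFinite {S : Set X | S ⊆ T ∧ g ∈ cl S}).exists_minimal
    ⟨T, Set.Subset.rfl, hT.spans g⟩
  refine h.mem_of_mem_of_subset hgS fun f hf => ⟨hST hf, fun hgf => ?_⟩
  have hg' : g ∉ cl (S \ {f}) := fun hg' =>
    (hmin ⟨Set.sdiff_subset.trans hST, hg'⟩ Set.sdiff_subset hf).2 rfl
  have hS : insert f (S \ {f}) = S := by
    ext x
    by_cases hx : x = f <;> simp [hx, hf]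
  have := h.exchange (e := g) (f := f) (S := S \ {f}) (by rwa [hS]) hg'
  refine hT.indep f (hST hf) (h.mem_cl_of_subset_cl this (Set.insert_subset hgf ?_))
  exact (Set.sdiff_subset_sdiff_left hST).trans (h.subset _)

/-- Exchange inside a fundamental circuit. -/
theorem mem_cl_insert_of_exchangeable [Finite X] (h : IsMatroidClosure cl)
    (hT : IsClosureBasis cl T) {f g : X} (hfg : Exchangeable cl T f g) :
    f ∈ cl (insert g {e ∈ T | Exchangeable cl T e g ∧ e ≠ f}) := by
  refine h.exchange (h.mono ?_ (h.mem_cl_setOf_exchangeable hT g)) fun hg => hfg (h.mono ?_ hg)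
  · intro e he
    by_cases hef : e = f
    · exact Or.inl hef
    · exact Or.inr ⟨he.1, he.2, hef⟩
  · exact fun e he => ⟨he.1, he.2.2⟩

variable [LinearOrder X] [Finite X]

omit [Finite X] in
theorem inInterval_le_left (hH : InInterval cl T H) {f g : X} (hf : f ∈ T) (hfH : f ∉ H)
    (hg : g ∉ T) (hfg : Exchangeable cl T f g) : f ≤ g := by
  have : ActiveFor cl T f := by
    by_contra hc
    exact hfH ((hH f hc).2 hf)
  rcases this with h | h
  · exact h.2 g hg hfg
  · exact absurd hf h.1

omit [Finite X] in
theorem inInterval_le_right (hH : InInterval cl T H) {f g : X} (hf : f ∈ T) (hgH : g ∈ H)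
    (hg : g ∉ T) (hfg : Exchangeable cl T f g) : g ≤ f := by
  have : ActiveFor cl T g := by
    by_contra hc
    exact hg ((hH g hc).1 hgH)
  rcases this with h | h
  · exact absurd h.1 hg
  · exact h.2 f hf hfg

/-- The basis is determined by any member of its interval: each element is decided by the
larger elements of `H`, or by `H` and the smaller elements. -/
theorem mem_iff_of_inInterval (h : IsMatroidClosure cl) (hT : IsClosureBasis cl T)
    (hH : InInterval cl T H) (e : X) :
    e ∈ T ↔ (e ∈ H ∧ e ∉ cl (H ∩ Set.Ioi e)) ∨ (e ∉ H ∧ e ∉ cl (H ∪ Set.Iio e)) := by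
  by_cases heT : e ∈ T <;> by_cases heH : e ∈ H <;>
    simp only [heT, heH, true_and, not_true_eq_false, false_and, or_false, false_or, true_iff,
      false_iff, not_not, not_false_eq_true]
  · intro hc
    obtain ⟨g, hg, rfl | ⟨hgT, hge⟩⟩ := h.exists_exchangeable hT heT hc
    · exact lt_irrefl _ hg.2
    · exact absurd hg.2 (not_lt.2 (inInterval_le_right hH heT hg.1 hgT hge))
  · intro hc
    obtain ⟨g, hg, rfl | ⟨hgT, hge⟩⟩ := h.exists_exchangeable hT heT hc
    · exact hg.elim heH (lt_irrefl _)
    · rcases hg with hg | hg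
      · have h1 := inInterval_le_left hH heT heH hgT hge
        have h2 := inInterval_le_right hH heT hg hgT hge
        exact hgT (le_antisymm h1 h2 ▸ heT)
      · exact absurd hg (not_lt.2 (inInterval_le_left hH heT heH hgT hge))
  · refine h.mono ?_ (h.mem_cl_setOf_exchangeable hT e)
    rintro f ⟨hf, hfe⟩
    have h1 := inInterval_le_right hH hf heH heT hfe
    have h2 : e ≠ f := fun h2 => heT (h2 ▸ hf)
    refine ⟨?_, lt_of_le_of_ne h1 h2⟩
    by_contra hfH
    exact h2 (le_antisymm h1 (inInterval_le_left hH hf hfH heT hfe))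
  · refine h.mono ?_ (h.mem_cl_setOf_exchangeable hT e)
    rintro f ⟨hf, hfe⟩
    by_cases hfH : f ∈ H
    · exact Or.inl hfH
    · have h1 := inInterval_le_left hH hf hfH heT hfe
      exact Or.inr (lt_of_le_of_ne h1 fun h2 => heT (h2 ▸ hf))

theorem eq_of_inInterval (h : IsMatroidClosure cl) {T' : Set X} (hT : IsClosureBasis cl T)
    (hT' : IsClosureBasis cl T') (hH : InInterval cl T H) (hH' : InInterval cl T' H) : T = T' := by
  ext e
  rw [h.mem_iff_of_inInterval hT hH, h.mem_iff_of_inInterval hT' hH']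

/-- Whether an element is active depends only on the larger elements of `H`: it is active iff it is
a loop or a bridge of the minor in which the larger elements are contracted or deleted according to
`H`. -/
theorem activeFor_iff_of_inInterval (h : IsMatroidClosure cl) (hT : IsClosureBasis cl T)
    (hH : InInterval cl T H) (f : X) :
    ActiveFor cl T f ↔
      f ∈ cl (H ∩ Set.Ioi f) ∨ f ∉ cl ((H ∩ Set.Ioi f) ∪ Set.Iio f) := by
  constructor
  · rintro (⟨hfT, hact⟩ | ⟨hfT, hact⟩)
    · right
      intro hc
      obtain ⟨g, hg, rfl | ⟨hgT, hgf⟩⟩ := h.exists_exchangeable hT hfT hc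
      · exact hg.elim (fun hg => lt_irrefl _ hg.2) (lt_irrefl _)
      · have h1 := hact g hgT hgf
        rcases hg with hg | hg
        · exact absurd hg.2 (not_lt.2 (inInterval_le_right hH hfT hg.1 hgT hgf))
        · exact absurd hg (not_lt.2 h1)
    · left
      refine h.mono ?_ (h.mem_cl_setOf_exchangeable hT f)
      rintro e ⟨heT, hef⟩
      have h1 := hact e heT hef
      have h2 : f ≠ e := fun h2 => hfT (h2 ▸ heT)
      refine ⟨?_, lt_of_le_of_ne h1 h2⟩
      by_contra heH
      exact h2 (le_antisymm h1 (inInterval_le_left hH heT heH hfT hef))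
  · rintro (hc | hc)
    · have hfT : f ∉ T := by
        intro hfT
        obtain ⟨g, hg, rfl | ⟨hgT, hgf⟩⟩ := h.exists_exchangeable hT hfT hc
        · exact lt_irrefl _ hg.2
        · exact absurd hg.2 (not_lt.2 (inInterval_le_right hH hfT hg.1 hgT hgf))
      refine Or.inr ⟨hfT, fun g hg hgf => ?_⟩
      by_contra! hlt
      -- the span of `H ∩ Ioi f` contains `f`, so it is not contained in that of `T \ g`
      have : ∃ k ∈ H ∩ Set.Ioi f, k ∉ cl (T \ {g}) := by
        by_contra! hk
        exact hgf (h.mem_cl_of_subset_cl hc hk)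
      obtain ⟨k, hk, hkg⟩ := this
      have hkT : k ∉ T := fun hkT => hkg (h.subset _ ⟨hkT, (hlt.trans hk.2).ne'⟩)
      exact absurd (inInterval_le_right hH hg hk.1 hkT hkg) (not_le.2 (hlt.trans hk.2))
    · have hfT : f ∈ T := by
        by_contra hfT
        refine hc (h.mono ?_ (h.mem_cl_setOf_exchangeable hT f))
        rintro g ⟨hgT, hgf⟩
        rcases lt_trichotomy g f with hlt | rfl | hlt
        · exact Or.inr hlt
        · exact absurd hgT hfT
        · refine Or.inl ⟨?_, hlt⟩
          by_contra hgH
          exact absurd (inInterval_le_left hH hgT hgH hfT hgf) (not_le.2 hlt)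
      refine Or.inl ⟨hfT, fun g hg hgf => ?_⟩
      by_contra! hlt
      refine hc (h.mono ?_ (h.mem_cl_insert_of_exchangeable hT hgf))
      rintro e (rfl | ⟨heT, hge, hef⟩)
      · exact Or.inr hlt
      · rcases lt_or_gt_of_ne hef with hlt' | hlt'
        · exact Or.inr hlt'
        · refine Or.inl ⟨?_, hlt'⟩
          by_contra heH
          exact absurd (inInterval_le_left hH heT heH hg hge) (not_le.2 (hlt.trans hlt'))

/-- Every subset lies in the interval of some basis. -/
theorem exists_basis_inInterval (h : IsMatroidClosure cl) (H : Set X) :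
    ∃ T, IsClosureBasis cl T ∧ InInterval cl T H := by
  let T : Set X :=
    {e | (e ∈ H ∧ e ∉ cl (H ∩ Set.Ioi e)) ∨ (e ∉ H ∧ e ∉ cl (H ∪ Set.Iio e))}
  have hmemT : ∀ e, e ∈ H → (e ∈ T ↔ e ∉ cl (H ∩ Set.Ioi e)) := by
    intro e he; simp [T, he]
  have hmemT' : ∀ e, e ∉ H → (e ∈ T ↔ e ∉ cl (H ∪ Set.Iio e)) := by
    intro e he; simp [T, he]
  have hwf : WellFounded ((· < ·) : X → X → Prop) := wellFounded_lt
  have hwf' : WellFounded ((· > ·) : X → X → Prop) := wellFounded_gt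
  have hspanH : ∀ e, e ∈ H → e ∈ cl (T ∩ H ∩ Set.Ici e) := by
    intro e
    induction e using hwf'.induction with
    | _ e ih =>
      intro he
      by_cases heT : e ∈ T
      · exact h.subset _ ⟨⟨heT, he⟩, le_rfl⟩
      · have h1 := not_not.1 (mt (hmemT e he).2 heT)
        refine h.mem_cl_of_subset_cl h1 fun f hf => h.mono ?_ (ih f hf.2 hf.1)
        exact Set.inter_subset_inter_right _ (Set.Ici_subset_Ici.2 hf.2.le)
  have hspan : ∀ e, e ∉ H → e ∈ cl (T ∩ (H ∪ Set.Iic e)) := by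
    intro e
    induction e using hwf.induction with
    | _ e ih =>
      intro he
      by_cases heT : e ∈ T
      · exact h.subset _ ⟨heT, Or.inr le_rfl⟩
      · have h1 := not_not.1 (mt (hmemT' e he).2 heT)
        refine h.mem_cl_of_subset_cl h1 fun f hf => ?_
        by_cases hfH : f ∈ H
        · exact h.mem_of_mem_of_subset (hspanH f hfH) fun x hx => ⟨hx.1.1, Or.inl hx.1.2⟩
        · have hlt : f < e := hf.resolve_left hfH
          exact h.mem_of_mem_of_subset (ih f hlt hfH)
            fun x hx => ⟨hx.1, hx.2.imp_right fun hx' => le_trans hx' hlt.le⟩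
  -- `T` is independent: list the elements of `T ∩ H` in decreasing order, and then those of
  -- `T \ H` in increasing order; no element is spanned by its predecessors
  have hindH : ∀ e ∈ T, e ∈ H → ∀ Y : Set X, Y ⊆ H → (∀ y ∈ Y, y ∈ T ∧ y ≠ e) → e ∉ cl Y := by
    intro e heT heH Y
    have hfin : Y.Finite := Set.toFinite Y
    -- remove the least element of `Y` by exchange, until all elements exceed `e`
    obtain ⟨n, hn⟩ : ∃ n, Y.ncard = n := ⟨_, rfl⟩
    induction n generalizing Y e with
    | zero =>
      intro _ _ he
      rw [(Set.ncard_eq_zero hfin).1 hn] at he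
      exact (hmemT e heH).1 heT (h.mono (Set.empty_subset _) he)
    | succ n ih =>
      intro hYH hY he
      by_cases hall : ∀ y ∈ Y, e < y
      · exact (hmemT e heH).1 heT (h.mem_of_mem_of_subset he fun y hy => ⟨hYH hy, hall y hy⟩)
      · have hne : Y.Nonempty := by
          rw [← Set.ncard_pos hfin, hn]; omega
        obtain ⟨m, hm, hmin⟩ := hfin.exists_minimal hne
        have hmin' : ∀ y ∈ Y, m ≤ y := fun y hy => (le_total m y).elim id fun h' => hmin hy h'
        push Not at hall
        obtain ⟨y, hy, hye⟩ := hall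
        have hme : m < e := lt_of_le_of_ne ((hmin' y hy).trans hye) (hY m hm).2
        have hins : insert m (Y \ {m}) = Y := by
          ext x; by_cases hx : x = m <;> simp [hx, hm]
        have hcard : (Y \ {m}).ncard = n := by
          rw [Set.ncard_sdiff_singleton_of_mem hm, hn]; rfl
        have h1 : e ∉ cl (Y \ {m}) := ih e heT heH (Y \ {m}) (Set.toFinite _) hcard
          (Set.sdiff_subset.trans hYH) fun x hx => hY x hx.1
        have h2 := h.exchange (e := e) (f := m) (S := Y \ {m}) (by rwa [hins]) h1
        refine (hmemT m (hYH hm)).1 (hY m hm).1 (h.mono ?_ h2)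
        rintro x (rfl | ⟨hx, hxm⟩)
        · exact ⟨heH, hme⟩
        · exact ⟨hYH hx, lt_of_le_of_ne (hmin' x hx) (Ne.symm hxm)⟩
  have hind : ∀ Y : Set X, Y ⊆ T → ∀ e ∈ T, e ∉ Y → e ∉ cl Y := by
    intro Y
    obtain ⟨n, hn⟩ : ∃ n, (Y \ H).ncard = n := ⟨_, rfl⟩
    induction n generalizing Y with
    | zero =>
      intro hYT e heT heY he
      have hYH : Y ⊆ H := Set.sdiff_eq_empty.1 ((Set.ncard_eq_zero (Set.toFinite _)).1 hn)
      by_cases heH : e ∈ H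
      · exact hindH e heT heH Y hYH (fun y hy => ⟨hYT hy, fun h' => heY (h' ▸ hy)⟩) he
      · exact (hmemT' e heH).1 heT (h.mono (hYH.trans Set.subset_union_left) he)
    | succ n ih =>
      intro hYT e heT heY he
      have hne : (Y \ H).Nonempty := by
        rw [← Set.ncard_pos (Set.toFinite _), hn]; omega
      obtain ⟨m, hm, hmax⟩ := (Set.toFinite (Y \ H)).exists_maximal hne
      have hmax' : ∀ y ∈ Y \ H, y ≤ m := fun y hy => (le_total y m).elim id fun h' => hmax hy h'
      have hins : insert m (Y \ {m}) = Y := by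
        ext x; by_cases hx : x = m <;> simp [hx, hm.1]
      by_cases hlast : e ∉ H ∧ m < e
      · refine (hmemT' e hlast.1).1 heT (h.mono (fun y hy => ?_) he)
        by_cases hyH : y ∈ H
        · exact Or.inl hyH
        · exact Or.inr ((hmax' y ⟨hy, hyH⟩).trans_lt hlast.2)
      · have hcard : ((Y \ {m}) \ H).ncard = n := by
          have : (Y \ {m}) \ H = (Y \ H) \ {m} := by
            ext x; simp only [Set.mem_sdiff, Set.mem_singleton_iff]; tauto
          rw [this, Set.ncard_sdiff_singleton_of_mem hm, hn]; rfl
        have h1 := ih (Y \ {m}) hcard (Set.sdiff_subset.trans hYT) e heT fun h' => heY h'.1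
        have h2 := h.exchange (e := e) (f := m) (S := Y \ {m}) (by rwa [hins]) h1
        refine (hmemT' m hm.2).1 (hYT hm.1) (h.mono ?_ h2)
        rintro x (rfl | ⟨hx, hxm⟩)
        · by_cases hxH : x ∈ H
          · exact Or.inl hxH
          · refine Or.inr (lt_of_le_of_ne (not_lt.1 fun h' => hlast ⟨hxH, h'⟩) ?_)
            rintro rfl
            exact heY hm.1
        · by_cases hxH : x ∈ H
          · exact Or.inl hxH
          · exact Or.inr (lt_of_le_of_ne (hmax' x ⟨hx, hxH⟩) hxm)
  have hT : IsClosureBasis cl T := by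
    refine ⟨fun e => ?_, fun e he => hind _ Set.sdiff_subset e he fun h' => h'.2 rfl⟩
    by_cases he : e ∈ H
    · exact h.mem_of_mem_of_subset (hspanH e he) fun x hx => hx.1.1
    · exact h.mem_of_mem_of_subset (hspan e he) fun x hx => hx.1
  refine ⟨T, hT, fun e hdead => ?_⟩
  by_contra hne
  rw [not_iff] at hne
  refine hdead ?_
  by_cases he : e ∈ H
  · have heT : e ∉ T := fun h' => hne.2 h' he
    refine Or.inr ⟨heT, fun f hf hfe => ?_⟩
    by_contra! hlt
    have h1 := hspanH e he
    refine hfe (h.mem_of_mem_of_subset h1 fun x hx => ⟨hx.1.1, ?_⟩)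
    rintro rfl
    exact absurd hx.2 (not_le.2 hlt)
  · have heT : e ∈ T := hne.1 he
    refine Or.inl ⟨heT, fun g hg hge => ?_⟩
    by_contra! hlt
    by_cases hgH : g ∈ H
    · exact hge (h.mem_of_mem_of_subset (hspanH g hgH)
          fun x hx => ⟨hx.1.1, fun h' => he (h' ▸ hx.1.2)⟩)
    · refine hge (h.mem_of_mem_of_subset (hspan g hgH) fun x hx => ⟨hx.1, ?_⟩)
      rintro rfl
      exact hx.2.elim he fun h' => absurd h' (not_le.2 hlt)

end IsMatroidClosure

/-! ### Merging two classes of a partition -/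

/-- If the map `π` identifies exactly the two points `a` and `b`, then sums over its source and its
target differ by the terms at these points. -/
theorem finsum_add_eq_of_merge {Q Q' : Type*} [Finite Q] [Finite Q'] (π : Q → Q')
    (hπ : Function.Surjective π) {a b : Q} (hab : a ≠ b) (hπab : π a = π b)
    (hinj : ∀ c c', π c = π c' → c = c' ∨ ((c = a ∨ c = b) ∧ (c' = a ∨ c' = b)))
    (f : Q → ℤ) (f' : Q' → ℤ) (hf : ∀ q, q ≠ a → q ≠ b → f' (π q) = f q) :
    ∑ᶠ q, f q + f' (π a) = ∑ᶠ q, f' q + (f a + f b) := by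
  classical
  have := Fintype.ofFinite Q
  have := Fintype.ofFinite Q'
  rw [finsum_eq_sum_of_fintype, finsum_eq_sum_of_fintype,
    ← Finset.add_sum_erase _ f (Finset.mem_univ a),
    ← Finset.add_sum_erase _ f (show b ∈ Finset.univ.erase a by simp [hab.symm]),
    ← Finset.add_sum_erase _ f' (Finset.mem_univ (π a))]
  have : ∑ q ∈ (Finset.univ.erase a).erase b, f q = ∑ q ∈ Finset.univ.erase (π a), f' q := by
    refine Finset.sum_bij (fun q _ => π q) ?_ ?_ ?_ ?_
    · intro q hq
      simp only [Finset.mem_erase, Finset.mem_univ, and_true] at hq ⊢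
      intro h
      rcases hinj _ _ h with h | h
      · exact hq.2 h
      · exact h.1.elim hq.2 hq.1
    · intro q hq q' hq' h
      simp only [Finset.mem_erase, Finset.mem_univ, and_true] at hq
      rcases hinj _ _ h with h | h
      · exact h
      · exact absurd h.1 (not_or.2 ⟨hq.2, hq.1⟩)
    · intro q' hq'
      obtain ⟨q, rfl⟩ := hπ q'
      simp only [Finset.mem_erase, Finset.mem_univ, and_true] at hq'
      refine ⟨q, ?_, rfl⟩
      simp only [Finset.mem_erase, Finset.mem_univ, and_true]
      exact ⟨fun h => hq' (by rw [h, hπab]), fun h => hq' (by rw [h])⟩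
    · intro q hq
      simp only [Finset.mem_erase, Finset.mem_univ, and_true] at hq
      exact (hf q hq.2 hq.1).symm
  rw [this]
  ring

theorem finsum_one_eq_card (P : Type*) [Finite P] : ∑ᶠ _ : P, (1 : ℤ) = Nat.card P := by
  have := Fintype.ofFinite P
  rw [finsum_eq_sum_of_fintype]
  simp

theorem card_eq_card_add_one_of_merge {Q Q' : Type*} [Finite Q] [Finite Q'] (π : Q → Q')
    (hπ : Function.Surjective π) {a b : Q} (hab : a ≠ b) (hπab : π a = π b)
    (hinj : ∀ c c', π c = π c' → c = c' ∨ ((c = a ∨ c = b) ∧ (c' = a ∨ c' = b))) :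
    Nat.card Q = Nat.card Q' + 1 := by
  have := finsum_add_eq_of_merge π hπ hab hπab hinj (fun _ => 1) (fun _ => 1) (fun _ _ _ => rfl)
  rw [finsum_one_eq_card, finsum_one_eq_card] at this
  omega

/-! ### Cycles of a permutation multiplied by a transposition -/

namespace Equiv.Perm

variable {α : Type*} [DecidableEq α]

/-- Following the cycle of `a` up to its first return to `{a, b}`. -/
theorem exists_pow_swap_mul [Finite α] (π : Perm α) (a b : α) :
    ∃ n, 0 < n ∧ ((π ^ n) a = a ∨ (π ^ n) a = b) ∧
      (∀ k < n, 0 < k → (π ^ k) a ≠ a ∧ (π ^ k) a ≠ b) ∧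
      (∀ k < n, ((swap a b * π) ^ k) a = (π ^ k) a) ∧
      ((swap a b * π) ^ n) a = swap a b ((π ^ n) a) := by
  classical
  have hex : ∃ n, 0 < n ∧ ((π ^ n) a = a ∨ (π ^ n) a = b) :=
    ⟨orderOf π, orderOf_pos π, Or.inl (by rw [pow_orderOf_eq_one]; rfl)⟩
  set n := Nat.find hex with hn
  have hmin : ∀ k < n, 0 < k → (π ^ k) a ≠ a ∧ (π ^ k) a ≠ b := by
    intro k hk hk0
    have := Nat.find_min hex hk
    exact not_or.1 fun h => this ⟨hk0, h⟩
  have hpow : ∀ k < n, ((swap a b * π) ^ k) a = (π ^ k) a := by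
    intro k
    induction k with
    | zero => intro _; rfl
    | succ k ih =>
      intro hk
      rw [pow_succ', mul_apply, ih (by omega), mul_apply, ← mul_apply π, ← pow_succ']
      have := hmin (k + 1) hk (by omega)
      exact swap_apply_of_ne_of_ne this.1 this.2
  obtain ⟨h0, h1⟩ := Nat.find_spec hex
  refine ⟨n, h0, h1, hmin, hpow, ?_⟩
  obtain ⟨m, hm⟩ : ∃ m, n = m + 1 := ⟨n - 1, by omega⟩
  rw [hm, pow_succ', mul_apply, hpow m (by omega), mul_apply, ← mul_apply π, ← pow_succ']

/-- In a product with the transposition of two points of different cycles, these cycles merge. -/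
theorem sameCycle_swap_mul_of_not_sameCycle [Finite α] {π : Perm α} {a b : α}
    (h : ¬ π.SameCycle a b) : (swap a b * π).SameCycle a b := by
  obtain ⟨n, -, h1, -, -, h2⟩ := exists_pow_swap_mul π a b
  have h3 : (π ^ n) a = a := h1.resolve_right fun h' => h ⟨n, by simpa using h'⟩
  rw [h3, swap_apply_left] at h2
  exact ⟨n, by simpa using h2⟩

/-- In a product with the transposition of two points of one cycle, this cycle splits. -/
theorem not_sameCycle_swap_mul_of_sameCycle [Finite α] {π : Perm α} {a b : α} (hab : a ≠ b)
    (h : π.SameCycle a b) : ¬ (swap a b * π).SameCycle a b := by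
  have key : ∀ (σ : Perm α) (n : ℕ), 0 < n → (σ ^ n) a = a →
      (∀ k < n, (σ ^ k) a ≠ b) → ¬ σ.SameCycle a b := by
    intro σ n hn hna hk hs
    obtain ⟨m, hm⟩ := hs.exists_nat_pow_eq
    have hper : ∀ q, ((σ ^ n) ^ q) a = a := by
      intro q
      induction q with
      | zero => rfl
      | succ q ih => rw [pow_succ, mul_apply, hna, ih]
    rw [← Nat.mod_add_div m n, pow_add, pow_mul, mul_apply, hper] at hm
    exact hk _ (Nat.mod_lt _ hn) hm
  obtain ⟨n, hn, h1, hmin, hpow, h2⟩ := exists_pow_swap_mul π a b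
  have hkb : ∀ k < n, (π ^ k) a ≠ b := by
    intro k hk
    rcases Nat.eq_zero_or_pos k with rfl | hk0
    · exact hab
    · exact (hmin k hk hk0).2
  have h3 : (π ^ n) a = b := h1.resolve_left fun h' => key π n hn h' hkb h
  rw [h3, swap_apply_right] at h2
  exact key _ n hn h2 fun k hk => by rw [hpow k hk]; exact hkb k hk

theorem sameCycle_swap_mul_iff [Finite α] {π : Perm α} {a b : α}
    (h : ¬ π.SameCycle a b) (x y : α) :
    (swap a b * π).SameCycle x y ↔ π.SameCycle x y ∨
      ((π.SameCycle x a ∨ π.SameCycle x b) ∧ (π.SameCycle y a ∨ π.SameCycle y b)) := by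
  have hab := sameCycle_swap_mul_of_not_sameCycle h
  have hle : ∀ {x y}, π.SameCycle x y → (swap a b * π).SameCycle x y := by
    intro x y hxy
    obtain ⟨n, rfl⟩ := hxy.exists_nat_pow_eq
    induction n with
    | zero => exact SameCycle.refl _ _
    | succ n ih =>
      refine (ih ⟨n, by simp⟩).trans ?_
      have hs : (swap a b * π).SameCycle ((π ^ n) x) (swap a b (π ((π ^ n) x))) := ⟨1, by simp⟩
      rw [pow_succ', mul_apply]
      refine hs.trans ?_
      by_cases h1 : π ((π ^ n) x) = a
      · rw [h1, swap_apply_left]; exact hab.symm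
      · by_cases h2 : π ((π ^ n) x) = b
        · rw [h2, swap_apply_right]; exact hab
        · rw [swap_apply_of_ne_of_ne h1 h2]
  constructor
  · intro hxy
    obtain ⟨n, rfl⟩ := hxy.exists_nat_pow_eq
    induction n with
    | zero => exact Or.inl (SameCycle.refl _ _)
    | succ n ih =>
      set z := ((swap a b * π) ^ n) x with hz
      have ih' := ih ⟨n, by simp [hz]⟩
      rw [pow_succ', mul_apply, ← hz, mul_apply]
      have hzπ : π.SameCycle z (π z) := ⟨1, by simp⟩
      by_cases h1 : π z = a
      · rw [h1, swap_apply_left]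
        rw [h1] at hzπ
        rcases ih' with h' | h'
        · exact Or.inr ⟨Or.inl (h'.trans hzπ), Or.inr (SameCycle.refl _ _)⟩
        · exact Or.inr ⟨h'.1, Or.inr (SameCycle.refl _ _)⟩
      · by_cases h2 : π z = b
        · rw [h2, swap_apply_right]
          rw [h2] at hzπ
          rcases ih' with h' | h'
          · exact Or.inr ⟨Or.inr (h'.trans hzπ), Or.inl (SameCycle.refl _ _)⟩
          · exact Or.inr ⟨h'.1, Or.inl (SameCycle.refl _ _)⟩
        · rw [swap_apply_of_ne_of_ne h1 h2]
          rcases ih' with h' | h'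
          · exact Or.inl (h'.trans hzπ)
          · exact Or.inr ⟨h'.1, h'.2.imp hzπ.symm.trans hzπ.symm.trans⟩
  · rintro (h' | ⟨h1, h2⟩)
    · exact hle h'
    · have e1 : (swap a b * π).SameCycle x a := h1.elim hle fun h' => (hle h').trans hab.symm
      have e2 : (swap a b * π).SameCycle y a := h2.elim hle fun h' => (hle h').trans hab.symm
      exact e1.trans e2.symm

end Equiv.Perm

/-! ### Circles and surgery -/

/-- The two states differ exactly at the crossing `e`. -/
def Flips {X : Type*} (e : X) (σ τ : Finset X) : Prop :=
  ∀ f, (f ∈ σ ↔ f ∈ τ) ↔ f ≠ e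

theorem Flips.symm {X : Type*} {e : X} {σ τ : Finset X} (h : Flips e σ τ) : Flips e τ σ :=
  fun f => by rw [← h f]; exact iff_comm

namespace CrossingData

variable {X A : Type*} {D : CrossingData X A} {black : D.Face → Prop}

theorem corner_eq_mk_side (D : CrossingData X A) (e : X) (k : Fin 4) :
    D.corner e k = Quot.mk _ (D.side e (k + 1) false) :=
  Quot.sound ⟨e, k, rfl, rfl⟩

theorem IsCheckerboard.black_side (h : D.IsCheckerboard black) (e : X) (k : Fin 4) :
    black (Quot.mk _ (D.side e k true)) ↔ ¬ black (Quot.mk _ (D.side e k false)) := by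
  have := h (D.slot e k)
  simp only [side]
  split_ifs
  · exact this
  · simp only [Bool.not_true, Bool.not_false]; tauto

/-- The colors of the corners at a crossing alternate. -/
theorem IsCheckerboard.black_corner_succ (h : D.IsCheckerboard black) (e : X) (k : Fin 4) :
    black (D.corner e (k + 1)) ↔ ¬ black (D.corner e k) := by
  rw [corner_eq_mk_side D e k]
  exact h.black_side e (k + 1)

theorem IsCheckerboard.black_corner (h : D.IsCheckerboard black) (e : X) :
    (black (D.corner e 1) ↔ ¬ black (D.corner e 0)) ∧
    (black (D.corner e 2) ↔ black (D.corner e 0)) ∧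
    (black (D.corner e 3) ↔ ¬ black (D.corner e 0)) := by
  have h1 := h.black_corner_succ e 0
  have h2 := h.black_corner_succ e 1
  have h3 := h.black_corner_succ e 2
  simp only [show (0 : Fin 4) + 1 = 1 from rfl, show (1 : Fin 4) + 1 = 2 from rfl,
    show (2 : Fin 4) + 1 = 3 from rfl] at h1 h2 h3
  tauto

theorem IsCheckerboard.black_corner_iff_isOut (h : D.IsCheckerboard black) (e : X) (k : Fin 4) :
    black (D.corner e k) ↔ (D.IsOut e k ↔ black (Quot.mk _ (D.slot e k, true))) := by
  have := h (D.slot e k)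
  simp only [corner, side]
  split_ifs with ho
  · simp only [ho, true_iff]
  · simp only [Bool.not_true, ho, false_iff]; tauto

/-- The end that is joined to the end `k` at the crossing `e` in the state `σ`. -/
def partner [DecidableEq X] (σ : Finset X) (e : X) (k : Fin 4) : Fin 4 :=
  if e ∈ σ then ![3, 2, 1, 0] k else ![1, 0, 3, 2] k

theorem Smoothed.exists_partner [DecidableEq X] {σ : Finset X} {a b : A} (h : D.Smoothed σ a b) :
    ∃ e k, a = D.slot e k ∧ b = D.slot e (partner σ e k) := by
  obtain ⟨e, ⟨he, ⟨h1, h2⟩ | ⟨h1, h2⟩⟩ | ⟨he, ⟨h1, h2⟩ | ⟨h1, h2⟩⟩⟩ := h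
  · exact ⟨e, 0, h1, by simp [partner, he, h2]⟩
  · exact ⟨e, 2, h1, by simp [partner, he, h2]⟩
  · exact ⟨e, 1, h1, by simp [partner, he, h2]⟩
  · exact ⟨e, 3, h1, by simp [partner, he, h2]⟩

theorem circle_of_notMem (D : CrossingData X A) {σ : Finset X} {e : X} (he : e ∉ σ) :
    D.circle σ (D.slot e 0) = D.circle σ (D.slot e 1) ∧
    D.circle σ (D.slot e 2) = D.circle σ (D.slot e 3) :=
  ⟨Quot.sound ⟨e, Or.inl ⟨he, Or.inl ⟨rfl, rfl⟩⟩⟩, Quot.sound ⟨e, Or.inl ⟨he, Or.inr ⟨rfl, rfl⟩⟩⟩⟩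

theorem circle_of_mem (D : CrossingData X A) {σ : Finset X} {e : X} (he : e ∈ σ) :
    D.circle σ (D.slot e 1) = D.circle σ (D.slot e 2) ∧
    D.circle σ (D.slot e 3) = D.circle σ (D.slot e 0) :=
  ⟨Quot.sound ⟨e, Or.inr ⟨he, Or.inl ⟨rfl, rfl⟩⟩⟩, Quot.sound ⟨e, Or.inr ⟨he, Or.inr ⟨rfl, rfl⟩⟩⟩⟩

theorem circle_partner [DecidableEq X] (D : CrossingData X A) (σ : Finset X) (e : X) (k : Fin 4) :
    D.circle σ (D.slot e (partner σ e k)) = D.circle σ (D.slot e k) := by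
  unfold partner
  split_ifs with he
  · have := D.circle_of_mem he
    fin_cases k
    exacts [this.2, this.1.symm, this.1, this.2.symm]
  · have := D.circle_of_notMem he
    fin_cases k
    exacts [this.1.symm, this.1, this.2.symm, this.2]

theorem IsCheckerboard.black_partner [DecidableEq X] (h : D.IsCheckerboard black) (σ : Finset X)
    (e : X) (k : Fin 4) : black (D.corner e (partner σ e k)) ↔ ¬ black (D.corner e k) := by
  have hc := h.black_corner e
  unfold partner
  split_ifs with he
  · fin_cases k
    · change black (D.corner e 3) ↔ ¬ black (D.corner e 0); tauto
    · change black (D.corner e 2) ↔ ¬ black (D.corner e 1); tauto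
    · change black (D.corner e 1) ↔ ¬ black (D.corner e 2); tauto
    · change black (D.corner e 0) ↔ ¬ black (D.corner e 3); tauto
  · fin_cases k
    · change black (D.corner e 1) ↔ ¬ black (D.corner e 0); tauto
    · change black (D.corner e 0) ↔ ¬ black (D.corner e 1); tauto
    · change black (D.corner e 3) ↔ ¬ black (D.corner e 2); tauto
    · change black (D.corner e 2) ↔ ¬ black (D.corner e 3); tauto

theorem partner_partner [DecidableEq X] (σ : Finset X) (e : X) (k : Fin 4) :
    partner σ e (partner σ e k) = k := by
  unfold partner
  split_ifs <;> fin_cases k <;> rfl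

/-- Changing the smoothing of a crossing either merges two circles or splits one: if the circles
at the crossing differ, exactly these two are merged. -/
structure HasSurgery (D : CrossingData X A) : Prop where
  eq_iff_ne : ∀ {e σ τ}, Flips e σ τ → (D.circle σ (D.slot e 0) = D.circle σ (D.slot e 2) ↔
    D.circle τ (D.slot e 0) ≠ D.circle τ (D.slot e 2))
  merge : ∀ {e σ τ}, Flips e σ τ → D.circle σ (D.slot e 0) ≠ D.circle σ (D.slot e 2) → ∀ a b,
    D.circle τ a = D.circle τ b ↔ D.circle σ a = D.circle σ b ∨
      ((D.circle σ a = D.circle σ (D.slot e 0) ∨ D.circle σ a = D.circle σ (D.slot e 2)) ∧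
      (D.circle σ b = D.circle σ (D.slot e 0) ∨ D.circle σ b = D.circle σ (D.slot e 2)))

end CrossingData

namespace LinkDiagram

open CrossingData

variable {X A : Type*} {L : LinkDiagram X A} {black : L.Face → Prop}

/-- Orient every arc with the black region on its left. Then it leaves a crossing at only one end
and enters a crossing at only one end. -/
theorem end_injective (h : L.IsCheckerboard black) {e f : X} {k l : Fin 4}
    (hb : black (L.corner e k) ↔ black (L.corner f l)) (hs : L.slot e k = L.slot f l) :
    e = f ∧ k = l := by
  rw [h.black_corner_iff_isOut, h.black_corner_iff_isOut, hs] at hb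
  have : L.IsOut e k ↔ L.IsOut f l := by
    by_cases hb' : black (Quot.mk _ (L.slot f l, true))
    · simpa [hb'] using hb
    · simpa [hb', not_iff_not] using hb
  by_cases ho : L.IsOut e k
  · exact L.out_inj e k f l ho (this.1 ho) hs
  · exact L.in_inj e k f l ho (mt this.2 ho) hs

theorem exists_head_of_tail (h : L.IsCheckerboard black) {e : X} {k : Fin 4}
    (hb : black (L.corner e k)) : ∃ f l, ¬ black (L.corner f l) ∧ L.slot f l = L.slot e k := by
  rw [h.black_corner_iff_isOut] at hb
  by_cases ho : L.IsOut e k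
  · obtain ⟨f, l, h1, h2⟩ := (L.out_iff_in (L.slot e k)).1 ⟨e, k, ho, rfl⟩
    refine ⟨f, l, ?_, h2⟩
    rw [h.black_corner_iff_isOut, h2]
    tauto
  · obtain ⟨f, l, h1, h2⟩ := (L.out_iff_in (L.slot e k)).2 ⟨e, k, ho, rfl⟩
    refine ⟨f, l, ?_, h2⟩
    rw [h.black_corner_iff_isOut, h2]
    tauto

section

open Classical

/-- The arc that follows the arc `a` on its circle in the state `σ`, where all arcs have the black
region on their left; an arc without crossings follows itself. -/
noncomputable def next (L : LinkDiagram X A) (black : L.Face → Prop) (σ : Finset X) (a : A) : A :=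
  if h : ∃ p : X × Fin 4, ¬ black (L.corner p.1 p.2) ∧ L.slot p.1 p.2 = a then
    L.slot h.choose.1 (partner σ h.choose.1 h.choose.2) else a

theorem next_slot (h : L.IsCheckerboard black) (σ : Finset X) {e : X} {k : Fin 4}
    (hk : ¬ black (L.corner e k)) :
    L.next black σ (L.slot e k) = L.slot e (partner σ e k) := by
  have hex : ∃ p : X × Fin 4, ¬ black (L.corner p.1 p.2) ∧ L.slot p.1 p.2 = L.slot e k :=
    ⟨(e, k), hk, rfl⟩
  obtain ⟨h1, h2⟩ := end_injective h (by simp [hk, hex.choose_spec.1]) hex.choose_spec.2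
  rw [next, dif_pos hex, h1, h2]

theorem next_of_forall {σ : Finset X} {a : A}
    (ha : ∀ e k, ¬ black (L.corner e k) → L.slot e k ≠ a) : L.next black σ a = a :=
  dif_neg fun ⟨_, h1, h2⟩ => ha _ _ h1 h2

theorem next_injective (h : L.IsCheckerboard black) (σ : Finset X) :
    Function.Injective (L.next black σ) := by
  intro a b hab
  by_cases ha : ∃ e k, ¬ black (L.corner e k) ∧ L.slot e k = a
  · obtain ⟨e, k, hk, rfl⟩ := ha
    rw [next_slot h σ hk] at hab
    have hk' := (h.black_partner σ e k).2 hk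
    by_cases hb : ∃ e k, ¬ black (L.corner e k) ∧ L.slot e k = b
    · obtain ⟨f, l, hl, rfl⟩ := hb
      rw [next_slot h σ hl] at hab
      have hl' := (h.black_partner σ f l).2 hl
      obtain ⟨rfl, h2⟩ := end_injective h (by simp [hk', hl']) hab
      rw [← partner_partner σ e k, h2, partner_partner]
    · push Not at hb
      rw [next_of_forall hb] at hab
      obtain ⟨f, l, hl, hs⟩ := exists_head_of_tail h hk'
      exact absurd (hs.trans hab) (hb f l hl)
  · push Not at ha
    rw [next_of_forall ha] at hab
    by_cases hb : ∃ e k, ¬ black (L.corner e k) ∧ L.slot e k = b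
    · obtain ⟨f, l, hl, rfl⟩ := hb
      rw [next_slot h σ hl] at hab
      have hl' := (h.black_partner σ f l).2 hl
      obtain ⟨e, k, hk, hs⟩ := exists_head_of_tail h hl'
      exact absurd (hs.trans hab.symm) (ha e k hk)
    · push Not at hb
      rwa [next_of_forall hb] at hab

/-- The permutation of the arcs whose cycles are the circles of the state `σ`. -/
noncomputable def nextPerm [Finite A] (h : L.IsCheckerboard black) (σ : Finset X) :
    Equiv.Perm A :=
  Equiv.ofBijective (L.next black σ) (Finite.injective_iff_bijective.1 (next_injective h σ))

theorem nextPerm_apply [Finite A] (h : L.IsCheckerboard black) (σ : Finset X) (a : A) :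
    nextPerm h σ a = L.next black σ a := rfl

theorem circle_next (h : L.IsCheckerboard black) (σ : Finset X) (a : A) :
    L.circle σ (L.next black σ a) = L.circle σ a := by
  by_cases ha : ∃ e k, ¬ black (L.corner e k) ∧ L.slot e k = a
  · obtain ⟨e, k, hk, rfl⟩ := ha
    rw [next_slot h σ hk, circle_partner]
  · push Not at ha
    rw [next_of_forall ha]

theorem circle_eq_iff_sameCycle [Finite A] (h : L.IsCheckerboard black) (σ : Finset X) (a b : A) :
    L.circle σ a = L.circle σ b ↔ (nextPerm h σ).SameCycle a b := by
  constructor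
  · intro hab
    replace hab := Quot.eqvGen_exact hab
    induction hab with
    | rel a b hab =>
      obtain ⟨e, k, rfl, rfl⟩ := hab.exists_partner
      by_cases hk : black (L.corner e k)
      · have hk' : ¬ black (L.corner e (partner σ e k)) := by
          rw [h.black_partner]; exact not_not.2 hk
        refine Equiv.Perm.SameCycle.symm ⟨1, ?_⟩
        rw [zpow_one, nextPerm_apply, next_slot h σ hk', partner_partner]
      · exact ⟨1, by rw [zpow_one, nextPerm_apply, next_slot h σ hk]⟩
    | refl a => exact Equiv.Perm.SameCycle.refl _ _
    | symm a b _ ih => exact ih.symm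
    | trans a b c _ _ ih1 ih2 => exact ih1.trans ih2
  · intro hab
    obtain ⟨n, rfl⟩ := hab.exists_nat_pow_eq
    clear hab
    induction n with
    | zero => rfl
    | succ n ih => rw [pow_succ', Equiv.Perm.mul_apply, nextPerm_apply, circle_next h, ih]

theorem nextPerm_flips [Finite A] (h : L.IsCheckerboard black) {e : X} {σ τ : Finset X}
    (hf : Flips e σ τ) {p q : Fin 4} (hpq : p ≠ q) (hp : black (L.corner e p))
    (hq : black (L.corner e q)) :
    nextPerm h τ = Equiv.swap (L.slot e p) (L.slot e q) * nextPerm h σ := by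
  have hpq' : ∀ l, black (L.corner e l) → l = p ∨ l = q := by
    intro l hl
    have := h.black_corner e
    fin_cases l <;> fin_cases p <;> fin_cases q <;> simp at hpq hp hq hl ⊢ <;> tauto
  ext a
  rw [Equiv.Perm.mul_apply, nextPerm_apply, nextPerm_apply]
  have hne : ∀ {f l k}, black (L.corner f l) → black (L.corner e k) → (f = e → l ≠ k) →
      L.slot f l ≠ L.slot e k := by
    intro f l k h1 h2 h3 h4
    obtain ⟨rfl, h5⟩ := end_injective h (by simp [h1, h2]) h4
    exact h3 rfl h5
  by_cases ha : ∃ f k, ¬ black (L.corner f k) ∧ L.slot f k = a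
  · obtain ⟨f, k, hk, rfl⟩ := ha
    rw [next_slot h σ hk, next_slot h τ hk]
    have hσ := (h.black_partner σ f k).2 hk
    by_cases hfe : f = e
    · subst hfe
      have hτ := (h.black_partner τ f k).2 hk
      have hd : partner σ f k ≠ partner τ f k := by
        have := hf f
        unfold partner
        split_ifs with h1 h2 h2
        · exact absurd rfl (this.1 (by tauto))
        · fin_cases k <;> decide
        · fin_cases k <;> decide
        · exact absurd rfl (this.1 (by tauto))
      rcases hpq' _ hσ with h1 | h1 <;> rcases hpq' _ hτ with h2 | h2
      · exact absurd (h1.trans h2.symm) hd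
      · rw [h1, h2, Equiv.swap_apply_left]
      · rw [h1, h2, Equiv.swap_apply_right]
      · exact absurd (h1.trans h2.symm) hd
    · have : partner τ f k = partner σ f k := by
        have := (hf f).2 hfe
        simp only [partner, this]
      rw [this, Equiv.swap_apply_of_ne_of_ne (hne hσ hp fun h' => absurd h' hfe)
        (hne hσ hq fun h' => absurd h' hfe)]
  · push Not at ha
    rw [next_of_forall ha, next_of_forall ha]
    have : ∀ k, black (L.corner e k) → a ≠ L.slot e k := by
      rintro k hk rfl
      obtain ⟨f, l, h1, h2⟩ := exists_head_of_tail h hk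
      exact ha f l h1 h2
    rw [Equiv.swap_apply_of_ne_of_ne (this p hp) (this q hq)]

/-- In a checkerboard colored diagram a change of smoothing merges two circles or splits one: it
multiplies the permutation of the arcs, all oriented with the black region on their left, by a
transposition. -/
theorem hasSurgery [Finite A] (h : L.IsCheckerboard black) : L.HasSurgery := by
  have key : ∀ {e σ τ}, Flips e σ τ → ∃ p q : Fin 4, black (L.corner e p) ∧
      black (L.corner e q) ∧ p ≠ q ∧ ∀ ρ,
      ((L.circle ρ (L.slot e p) = L.circle ρ (L.slot e 0) ∧
        L.circle ρ (L.slot e q) = L.circle ρ (L.slot e 2)) ∨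
       (L.circle ρ (L.slot e p) = L.circle ρ (L.slot e 2) ∧
        L.circle ρ (L.slot e q) = L.circle ρ (L.slot e 0))) := by
    intro e σ τ hf
    have hc := h.black_corner e
    by_cases h0 : black (L.corner e 0)
    · exact ⟨0, 2, h0, hc.2.1.2 h0, by decide, fun ρ => Or.inl ⟨rfl, rfl⟩⟩
    · refine ⟨1, 3, hc.1.2 h0, hc.2.2.2 h0, by decide, fun ρ => ?_⟩
      by_cases he : e ∈ ρ
      · exact Or.inr (L.circle_of_mem he)
      · have := L.circle_of_notMem he
        exact Or.inl ⟨this.1.symm, this.2.symm⟩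
  have hne : ∀ {e p q}, black (L.corner e p) → black (L.corner e q) → p ≠ q →
      L.slot e p ≠ L.slot e q := fun hp hq hpq hs =>
    hpq (end_injective h (by simp [hp, hq]) hs).2
  constructor
  · intro e σ τ hf
    obtain ⟨p, q, hp, hq, hpq, hcirc⟩ := key hf
    have h1 : ∀ ρ, L.circle ρ (L.slot e 0) = L.circle ρ (L.slot e 2) ↔
        L.circle ρ (L.slot e p) = L.circle ρ (L.slot e q) := by
      intro ρ
      rcases hcirc ρ with h' | h'
      · rw [h'.1, h'.2]
      · rw [h'.1, h'.2, eq_comm]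
    rw [ne_eq, h1, h1, circle_eq_iff_sameCycle h, circle_eq_iff_sameCycle h,
      nextPerm_flips h hf hpq hp hq]
    exact ⟨Equiv.Perm.not_sameCycle_swap_mul_of_sameCycle (hne hp hq hpq),
      fun h' => by
        by_contra h''
        exact h' (Equiv.Perm.sameCycle_swap_mul_of_not_sameCycle h'')⟩
  · intro e σ τ hf hcσ a b
    obtain ⟨p, q, hp, hq, hpq, hcirc⟩ := key hf
    have hpq' : L.circle σ (L.slot e p) ≠ L.circle σ (L.slot e q) := by
      rcases hcirc σ with h' | h'
      · rwa [h'.1, h'.2]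
      · rw [h'.1, h'.2]; exact hcσ.symm
    rw [circle_eq_iff_sameCycle h τ, nextPerm_flips h hf hpq hp hq,
      Equiv.Perm.sameCycle_swap_mul_iff (by rwa [← circle_eq_iff_sameCycle])]
    simp only [← circle_eq_iff_sameCycle]
    rcases hcirc σ with h' | h'
    · rw [h'.1, h'.2]
    · rw [h'.1, h'.2]; tauto

end

end LinkDiagram

/-! ### The Khovanov differential -/

namespace CrossingData

variable {X A : Type*} {D : CrossingData X A}

theorem flips_insert [DecidableEq X] {σ : Finset X} {e : X} (he : e ∉ σ) :
    Flips e σ (insert e σ) := by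
  intro f
  by_cases hf : f = e
  · subst hf; simp [he]
  · simp [hf]

theorem HasSurgery.circle_mono (hs : D.HasSurgery) {e : X} {σ τ : Finset X} (hf : Flips e σ τ)
    (hne : D.circle σ (D.slot e 0) ≠ D.circle σ (D.slot e 2)) {a b : A}
    (h : D.circle σ a = D.circle σ b) : D.circle τ a = D.circle τ b :=
  (hs.merge hf hne a b).2 (Or.inl h)

/-- Membership in the circle created by a merge. -/
theorem HasSurgery.circle_eq_merged (hs : D.HasSurgery) {e : X} {σ τ : Finset X}
    (hf : Flips e σ τ) (hne : D.circle σ (D.slot e 0) ≠ D.circle σ (D.slot e 2)) (a : A) :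
    D.circle τ a = D.circle τ (D.slot e 0) ↔
      D.circle σ a = D.circle σ (D.slot e 0) ∨ D.circle σ a = D.circle σ (D.slot e 2) := by
  rw [hs.merge hf hne]
  tauto

/-- Circles away from a merge. -/
theorem HasSurgery.circle_eq_of_ne (hs : D.HasSurgery) {e : X} {σ τ : Finset X}
    (hf : Flips e σ τ) (hne : D.circle σ (D.slot e 0) ≠ D.circle σ (D.slot e 2)) {a : A}
    (h0 : D.circle σ a ≠ D.circle σ (D.slot e 0)) (h2 : D.circle σ a ≠ D.circle σ (D.slot e 2))
    (b : A) : D.circle τ b = D.circle τ a ↔ D.circle σ b = D.circle σ a := by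
  rw [hs.merge hf hne]
  tauto

theorem HasSurgery.merged (hs : D.HasSurgery) {e : X} {σ τ : Finset X}
    (hf : Flips e σ τ) (hne : D.circle σ (D.slot e 0) ≠ D.circle σ (D.slot e 2)) :
    D.circle τ (D.slot e 0) = D.circle τ (D.slot e 2) :=
  (hs.eq_iff_ne hf.symm).2 hne

section Sums

variable [Finite A]

/-- The effect of a merge on sums over the circles. -/
theorem HasSurgery.finsum_circle (hs : D.HasSurgery) {e : X} {σ τ : Finset X} (hf : Flips e σ τ)
    (hne : D.circle σ (D.slot e 0) ≠ D.circle σ (D.slot e 2))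
    (f : D.Circle σ → ℤ) (f' : D.Circle τ → ℤ)
    (h : ∀ a, D.circle σ a ≠ D.circle σ (D.slot e 0) → D.circle σ a ≠ D.circle σ (D.slot e 2) →
      f' (D.circle τ a) = f (D.circle σ a)) :
    ∑ᶠ c, f c + f' (D.circle τ (D.slot e 0)) =
      ∑ᶠ c, f' c + (f (D.circle σ (D.slot e 0)) + f (D.circle σ (D.slot e 2))) := by
  let π : D.Circle σ → D.Circle τ :=
    Quot.lift (D.circle τ) fun a b hab => hs.circle_mono hf hne (Quot.sound hab)
  refine finsum_add_eq_of_merge π ?_ hne (hs.merged hf hne) ?_ f f' ?_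
  · rintro ⟨a⟩
    exact ⟨D.circle σ a, rfl⟩
  · rintro ⟨a⟩ ⟨b⟩ hab
    exact (hs.merge hf hne a b).1 hab
  · rintro ⟨a⟩ h0 h2
    exact h a h0 h2

theorem HasSurgery.card_circle (hs : D.HasSurgery) {e : X} {σ τ : Finset X} (hf : Flips e σ τ)
    (hne : D.circle σ (D.slot e 0) ≠ D.circle σ (D.slot e 2)) :
    Nat.card (D.Circle σ) = Nat.card (D.Circle τ) + 1 := by
  have := hs.finsum_circle hf hne (fun _ => 1) (fun _ => 1) fun _ _ _ => rfl
  rw [finsum_one_eq_card, finsum_one_eq_card] at this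
  omega

theorem _root_.Label.IsMul.deg_add {p q r : Label} (h : Label.IsMul p q r) :
    p.deg + q.deg = r.deg + 1 := by
  cases h <;> rfl

theorem _root_.Label.IsComul.deg_add {p q r : Label} (h : Label.IsComul p q r) :
    q.deg + r.deg = p.deg - 1 := by
  cases h <;> rfl

theorem HasSurgery.finsum_deg (hs : D.HasSurgery) {e : X} {s t : D.Enhanced}
    (hf : Flips e s.1 t.1) (hc : D.Compatible e s t) :
    ∑ᶠ c, (t.2 c).deg = ∑ᶠ c, (s.2 c).deg - 1 := by
  obtain ⟨⟨hne, -, hm⟩ | ⟨-, hne, hm⟩, ho⟩ := hc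
  · have h1 := hs.finsum_circle hf hne (fun c => (s.2 c).deg) (fun c => (t.2 c).deg)
      fun a h0 h2 => congrArg Label.deg (ho a h0 h2)
    have h2 := Label.IsMul.deg_add hm
    simp only [label] at h2
    linarith
  · have h1 := hs.finsum_circle hf.symm hne (fun c => (t.2 c).deg) (fun c => (s.2 c).deg)
      fun a h0 h2 => (congrArg Label.deg (ho a
        (fun h' => ((hs.circle_eq_merged hf.symm hne a).1 h').elim h0 h2)
        (fun h' => ((hs.circle_eq_merged hf.symm hne a).1
          (h'.trans (hs.merged hf.symm hne).symm)).elim h0 h2))).symm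
    have h2 := Label.IsComul.deg_add hm
    simp only [label] at h2
    linarith

end Sums

section Coefficients

variable [Fintype X] [LinearOrder X]

open Classical in
/-- A nonzero incidence number comes from exactly one crossing. -/
theorem khCoeff_eq {s t : D.Enhanced} {e : X} (he : e ∉ s.1) (ht : t.1 = insert e s.1)
    (hc : D.Compatible e s t) :
    D.khCoeff s t = (-1) ^ (s.1.filter (· < e)).card := by
  rw [khCoeff, Finset.sum_eq_single e]
  · convert if_pos _ using 3
    exact ⟨he, by convert ht, hc⟩
  · intro f _ hfe
    refine if_neg fun h => hfe ?_
    have : f ∈ t.1 := by rw [h.2.1]; exact Finset.mem_insert_self _ _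
    rw [ht, Finset.mem_insert] at this
    exact this.resolve_right h.1
  · simp

theorem khCoeff_ne_zero_iff {s t : D.Enhanced} :
    D.khCoeff s t ≠ 0 ↔ ∃ e, e ∉ s.1 ∧ t.1 = insert e s.1 ∧ D.Compatible e s t := by
  classical
  constructor
  · intro h
    obtain ⟨e, -, he⟩ := Finset.exists_ne_zero_of_sum_ne_zero h
    refine ⟨e, ?_⟩
    by_contra hc
    refine he (if_neg fun h' => hc ⟨h'.1, ?_, h'.2.2⟩)
    convert h'.2.1
  · rintro ⟨e, he, ht, hc⟩
    rw [khCoeff_eq he (by convert ht) hc]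
    exact pow_ne_zero _ (by norm_num)

theorem isUnit_khCoeff {s t : D.Enhanced} (h : D.khCoeff s t ≠ 0) : IsUnit (D.khCoeff s t) := by
  classical
  obtain ⟨e, he, ht, hc⟩ := khCoeff_ne_zero_iff.1 h
  rw [khCoeff_eq he (by convert ht) hc]
  exact IsUnit.pow _ (by norm_num)

theorem HasSurgery.homogeneous [Finite A] (hs : D.HasSurgery) :
    D.CKh.Homogeneous D.CKh D.CKh.coeff 1 := by
  intro s t h
  obtain ⟨e, he, ht, hc⟩ := khCoeff_ne_zero_iff.1 h
  have h1 : D.hdeg t = D.hdeg s + 1 := by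
    simp only [hdeg, ht, Finset.card_insert_of_notMem he]
    push_cast
    ring
  refine ⟨h1, ?_⟩
  have h2 := hs.finsum_deg (ht ▸ flips_insert he) hc
  change D.qdeg t = D.qdeg s
  simp only [qdeg, h1, h2]
  ring

end Coefficients

/-! ### The Khovanov differential squares to zero -/

section Square

open Classical

/-- The number of arcs of the multiset `m` on the circle through `a`. -/
noncomputable def arcCount (D : CrossingData X A) (σ : Finset X) (m : Multiset A) (a : A) : ℕ :=
  m.countP fun b => D.circle σ b = D.circle σ a

/-- The monomial `m`, a multiset of arcs, represents the enhanced state `s`: a circle carries one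
arc of `m` if its label is `x`, and none if its label is `1`. The arcs serve as variables of a
polynomial ring whose quotient by the squares and by the differences of arcs on a common circle has
the enhanced states as a basis. -/
def Represents (D : CrossingData X A) (m : Multiset A) (s : D.Enhanced) : Prop :=
  ∀ a, D.arcCount s.1 m a = if D.label s a = Label.x then 1 else 0

/-- The dual of the edge map at the crossing `e` in the state `σ`: a merge is the projection of
quotient rings, and a split is multiplication by the sum of the two arcs at the crossing. -/
noncomputable def edgeDual (D : CrossingData X A) (e : X) (σ : Finset X) (g : Multiset A → ℤ)
    (m : Multiset A) : ℤ :=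
  if D.circle σ (D.slot e 0) ≠ D.circle σ (D.slot e 2) then g m
  else g (m + {D.slot e 0}) + g (m + {D.slot e 2})

/-- The coefficient of the enhanced state `s` in a monomial. -/
noncomputable def coeffFun (D : CrossingData X A) (s : D.Enhanced) (m : Multiset A) : ℤ :=
  if D.Represents m s then 1 else 0

theorem arcCount_add (σ : Finset X) (m m' : Multiset A) (a : A) :
    D.arcCount σ (m + m') a = D.arcCount σ m a + D.arcCount σ m' a :=
  Multiset.countP_add _ _ _

theorem arcCount_singleton (σ : Finset X) (b a : A) :
    D.arcCount σ {b} a = if D.circle σ b = D.circle σ a then 1 else 0 := by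
  rw [arcCount, ← Multiset.cons_zero, Multiset.countP_cons, Multiset.countP_zero, zero_add]

theorem arcCount_congr {σ : Finset X} (m : Multiset A) {a b : A}
    (h : D.circle σ a = D.circle σ b) : D.arcCount σ m a = D.arcCount σ m b := by
  rw [arcCount, arcCount, h]

theorem label_congr {s : D.Enhanced} {a b : A} (h : D.circle s.1 a = D.circle s.1 b) :
    D.label s a = D.label s b := congrArg s.2 h

theorem HasSurgery.arcCount_merged (hs : D.HasSurgery) {e : X} {σ τ : Finset X}
    (hf : Flips e σ τ) (hne : D.circle σ (D.slot e 0) ≠ D.circle σ (D.slot e 2)) (m : Multiset A) :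
    D.arcCount τ m (D.slot e 0) =
      D.arcCount σ m (D.slot e 0) + D.arcCount σ m (D.slot e 2) := by
  induction m using Multiset.induction_on with
  | empty => rfl
  | cons b m ih =>
    rw [← Multiset.singleton_add, arcCount_add, arcCount_add, arcCount_add, ih,
      arcCount_singleton, arcCount_singleton, arcCount_singleton]
    have := hs.circle_eq_merged hf hne b
    by_cases h0 : D.circle σ b = D.circle σ (D.slot e 0)
    · have h2 : D.circle σ b ≠ D.circle σ (D.slot e 2) := fun h2 => hne (h0.symm.trans h2)
      rw [if_pos (this.2 (Or.inl h0)), if_pos h0, if_neg h2]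
      ring
    · by_cases h2 : D.circle σ b = D.circle σ (D.slot e 2)
      · rw [if_pos (this.2 (Or.inr h2)), if_neg h0, if_pos h2]
        ring
      · rw [if_neg fun h => (this.1 h).elim h0 h2, if_neg h0, if_neg h2]
        ring

theorem HasSurgery.arcCount_of_ne (hs : D.HasSurgery) {e : X} {σ τ : Finset X}
    (hf : Flips e σ τ) (hne : D.circle σ (D.slot e 0) ≠ D.circle σ (D.slot e 2)) (m : Multiset A)
    {a : A} (h0 : D.circle σ a ≠ D.circle σ (D.slot e 0))
    (h2 : D.circle σ a ≠ D.circle σ (D.slot e 2)) : D.arcCount τ m a = D.arcCount σ m a := by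
  simp only [arcCount, hs.circle_eq_of_ne hf hne h0 h2]

theorem _root_.Label.eq_one_or_eq_x (p : Label) : p = Label.one ∨ p = Label.x := by
  cases p
  · exact Or.inl rfl
  · exact Or.inr rfl

theorem _root_.Label.ite_eq_iff {p q : Label} :
    (if p = Label.x then 1 else 0 : ℕ) = (if q = Label.x then 1 else 0) ↔ p = q := by
  cases p <;> cases q <;> simp

theorem _root_.Label.isMul_iff (p q r : Label) : Label.IsMul p q r ↔
    (if p = Label.x then 1 else 0 : ℕ) + (if q = Label.x then 1 else 0) =
      if r = Label.x then 1 else 0 := by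
  constructor
  · rintro (_ | _ | _) <;> simp
  · cases p <;> cases q <;> cases r <;> simp <;> constructor

/-- The coproduct, in terms of exponents: a circle with exponent `m + n` splits into circles with
exponents `m` and `n`, and one of them is raised by one. -/
theorem _root_.Label.isComul_iff (p q r : Label) (m n : ℕ)
    (h : m + n = if p = Label.x then 1 else 0) :
    (if Label.IsComul p q r then (1 : ℤ) else 0) =
      (if m + 1 = (if q = Label.x then 1 else 0) ∧ n = (if r = Label.x then 1 else 0)
        then 1 else 0) +
      (if m = (if q = Label.x then 1 else 0) ∧ n + 1 = (if r = Label.x then 1 else 0)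
        then 1 else 0) := by
  have h1 : Label.IsComul p q r ↔ (p = .one ∧ q = .one ∧ r = .x) ∨ (p = .one ∧ q = .x ∧ r = .one) ∨
      (p = .x ∧ q = .x ∧ r = .x) := by
    constructor
    · rintro (_ | _ | _) <;> simp
    · rintro (⟨rfl, rfl, rfl⟩ | ⟨rfl, rfl, rfl⟩ | ⟨rfl, rfl, rfl⟩) <;> constructor
  have h2 : (m = 0 ∧ n = 0) ∨ (m = 1 ∧ n = 0) ∨ (m = 0 ∧ n = 1) := by
    split_ifs at h <;> omega
  rcases h2 with ⟨rfl, rfl⟩ | ⟨rfl, rfl⟩ | ⟨rfl, rfl⟩ <;> cases p <;> cases q <;> cases r <;>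
    simp_all

/-- Representing a state whose circles arise by a merge. -/
theorem HasSurgery.represents_merged_iff (hs : D.HasSurgery) {e : X} {σ : Finset X} {t : D.Enhanced}
    (hf : Flips e σ t.1) (hne : D.circle σ (D.slot e 0) ≠ D.circle σ (D.slot e 2))
    (m : Multiset A) :
    D.Represents m t ↔
      (D.arcCount σ m (D.slot e 0) + D.arcCount σ m (D.slot e 2) =
        if D.label t (D.slot e 0) = Label.x then 1 else 0) ∧
      ∀ a, D.circle σ a ≠ D.circle σ (D.slot e 0) → D.circle σ a ≠ D.circle σ (D.slot e 2) →
        D.arcCount σ m a = if D.label t a = Label.x then 1 else 0 := by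
  constructor
  · intro h
    refine ⟨?_, fun a h0 h2 => ?_⟩
    · rw [← hs.arcCount_merged hf hne, h]
    · rw [← hs.arcCount_of_ne hf hne m h0 h2, h]
  · rintro ⟨h, ho⟩ a
    by_cases ha : D.circle σ a = D.circle σ (D.slot e 0) ∨ D.circle σ a = D.circle σ (D.slot e 2)
    · have ha' := (hs.circle_eq_merged hf hne a).2 ha
      rw [arcCount_congr m ha', hs.arcCount_merged hf hne, h, label_congr ha']
    · rw [not_or] at ha
      rw [hs.arcCount_of_ne hf hne m ha.1 ha.2, ho a ha.1 ha.2]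

/-- Representing a state whose circles arise by a split. -/
theorem represents_split_iff (e : X) (t : D.Enhanced) (m : Multiset A) :
    D.Represents m t ↔
      ((D.arcCount t.1 m (D.slot e 0) = if D.label t (D.slot e 0) = Label.x then 1 else 0) ∧
        (D.arcCount t.1 m (D.slot e 2) = if D.label t (D.slot e 2) = Label.x then 1 else 0)) ∧
      ∀ a, D.circle t.1 a ≠ D.circle t.1 (D.slot e 0) →
        D.circle t.1 a ≠ D.circle t.1 (D.slot e 2) →
        D.arcCount t.1 m a = if D.label t a = Label.x then 1 else 0 := by
  constructor
  · intro h
    exact ⟨⟨h _, h _⟩, fun a _ _ => h a⟩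
  · rintro ⟨⟨h0, h2⟩, ho⟩ a
    by_cases ha0 : D.circle t.1 a = D.circle t.1 (D.slot e 0)
    · rw [arcCount_congr m ha0, h0, label_congr ha0]
    · by_cases ha2 : D.circle t.1 a = D.circle t.1 (D.slot e 2)
      · rw [arcCount_congr m ha2, h2, label_congr ha2]
      · exact ho a ha0 ha2

/-- The matrix coefficient of an edge map is computed on any monomial that represents the source. -/
theorem HasSurgery.edgeDual_coeffFun (hs : D.HasSurgery) {e : X} {s t : D.Enhanced}
    (hf : Flips e s.1 t.1) {m : Multiset A} (hm : D.Represents m s) :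
    (if D.Compatible e s t then (1 : ℤ) else 0) = D.edgeDual e s.1 (D.coeffFun t) m := by
  by_cases hne : D.circle s.1 (D.slot e 0) ≠ D.circle s.1 (D.slot e 2)
  · rw [edgeDual, if_pos hne, coeffFun]
    congr 1
    rw [hs.represents_merged_iff hf hne, hm, hm, ← Label.isMul_iff, eq_iff_iff]
    simp only [Compatible, hne, hs.merged hf hne, ne_eq, not_true_eq_false, not_false_eq_true,
      true_and, false_and, or_false]
    refine and_congr_right fun _ => forall_congr' fun a => forall_congr' fun _ =>
      forall_congr' fun _ => ?_
    rw [hm, Label.ite_eq_iff, eq_comm]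
  · rw [edgeDual, if_neg hne, coeffFun, coeffFun]
    rw [not_ne_iff] at hne
    have hne' := (hs.eq_iff_ne hf).1 hne
    have hsum := hs.arcCount_merged hf.symm hne' m
    rw [hm] at hsum
    -- the labels of the circles away from the crossing
    set P : Prop := ∀ a, D.circle t.1 a ≠ D.circle t.1 (D.slot e 0) →
        D.circle t.1 a ≠ D.circle t.1 (D.slot e 2) →
        D.arcCount t.1 m a = if D.label t a = Label.x then 1 else 0 with hP
    have hcompat : D.Compatible e s t ↔ Label.IsComul (D.label s (D.slot e 0))
        (D.label t (D.slot e 0)) (D.label t (D.slot e 2)) ∧ P := by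
      simp only [Compatible, hne, hne', ne_eq, not_true_eq_false, not_false_eq_true,
        true_and, false_and, false_or, hP]
      refine and_congr_right fun _ => forall_congr' fun a => ?_
      have h1 := hs.circle_eq_merged hf.symm hne' a
      rw [hne] at h1
      constructor
      · intro h h0 h2
        have h3 := mt h1.1 (not_or.2 ⟨h0, h2⟩)
        rw [← hs.arcCount_of_ne hf.symm hne' m h0 h2, hm, Label.ite_eq_iff, h h3 h3]
      · intro h h0 _
        obtain ⟨h3, h4⟩ := not_or.1 (mt h1.2 h0)
        have := h h3 h4
        rw [← hs.arcCount_of_ne hf.symm hne' m h3 h4, hm, Label.ite_eq_iff] at this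
        exact this.symm
    have hrep0 : D.Represents (m + {D.slot e 0}) t ↔
        ((D.arcCount t.1 m (D.slot e 0) + 1 =
            if D.label t (D.slot e 0) = Label.x then 1 else 0) ∧
          (D.arcCount t.1 m (D.slot e 2) =
            if D.label t (D.slot e 2) = Label.x then 1 else 0)) ∧ P := by
      rw [represents_split_iff e]
      simp only [arcCount_add, arcCount_singleton, if_pos, if_neg hne', add_zero]
      refine and_congr_right fun _ => forall_congr' fun a => forall_congr' fun h0 =>
        forall_congr' fun _ => ?_
      rw [if_neg (Ne.symm h0), add_zero]
    have hrep2 : D.Represents (m + {D.slot e 2}) t ↔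
        ((D.arcCount t.1 m (D.slot e 0) =
            if D.label t (D.slot e 0) = Label.x then 1 else 0) ∧
          (D.arcCount t.1 m (D.slot e 2) + 1 =
            if D.label t (D.slot e 2) = Label.x then 1 else 0)) ∧ P := by
      rw [represents_split_iff e]
      simp only [arcCount_add, arcCount_singleton, if_pos, if_neg hne'.symm, add_zero]
      refine and_congr_right fun _ => forall_congr' fun a => forall_congr' fun _ =>
        forall_congr' fun h2 => ?_
      rw [if_neg (Ne.symm h2), add_zero]
    have hcomul := Label.isComul_iff (D.label s (D.slot e 0)) (D.label t (D.slot e 0))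
      (D.label t (D.slot e 2)) _ _ hsum.symm
    by_cases hPt : P
    · simp only [hcompat, hrep0, hrep2, hPt, and_true]
      exact hcomul
    · simp only [hcompat, hrep0, hrep2, hPt, and_false, if_false, add_zero]

/-- Monomials that represent no state lie in the ideal, so every edge map kills them. -/
theorem HasSurgery.edgeDual_eq_zero (hs : D.HasSurgery) {e : X} {σ : Finset X} {t : D.Enhanced}
    (hf : Flips e σ t.1) {m : Multiset A} {a : A} (ha : 2 ≤ D.arcCount σ m a) :
    D.edgeDual e σ (D.coeffFun t) m = 0 := by
  have hle : ∀ m, D.Represents m t → ∀ a, D.arcCount t.1 m a ≤ 1 := by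
    intro m hm a
    rw [hm]
    split_ifs <;> omega
  by_cases hne : D.circle σ (D.slot e 0) ≠ D.circle σ (D.slot e 2)
  · rw [edgeDual, if_pos hne, coeffFun, if_neg]
    intro hm
    by_cases h0 : D.circle σ a = D.circle σ (D.slot e 0)
    · have h1 := hle m hm (D.slot e 0)
      rw [hs.arcCount_merged hf hne] at h1
      rw [arcCount_congr m h0] at ha
      omega
    · by_cases h2 : D.circle σ a = D.circle σ (D.slot e 2)
      · have h1 := hle m hm (D.slot e 0)
        rw [hs.arcCount_merged hf hne] at h1
        rw [arcCount_congr m h2] at ha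
        omega
      · have h1 := hle m hm a
        rw [hs.arcCount_of_ne hf hne m h0 h2] at h1
        omega
  · have hne' := (hs.eq_iff_ne hf).1 (not_ne_iff.1 hne)
    have key : ∀ b, b = D.slot e 0 ∨ b = D.slot e 2 → ¬ D.Represents (m + {b}) t := by
      intro b hb hm
      by_cases h0 : D.circle σ a = D.circle σ (D.slot e 0)
      · have h1 := hle _ hm (D.slot e 0)
        have h2 := hle _ hm (D.slot e 2)
        have h3 := hs.arcCount_merged hf.symm hne' (m + {b})
        rw [arcCount_congr m h0] at ha
        rw [arcCount_add, arcCount_singleton, if_pos] at h3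
        · omega
        · rcases hb with rfl | rfl
          · rfl
          · exact (hs.merged hf.symm hne').symm
      · have h1 := mt (hs.circle_eq_merged hf.symm hne' a).2 h0
        rw [not_or] at h1
        have h2 := hle _ hm a
        rw [arcCount_add, ← hs.arcCount_of_ne hf.symm hne' m h1.1 h1.2] at h2
        omega
    rw [edgeDual, if_neg hne, coeffFun, coeffFun, if_neg (key _ (Or.inl rfl)),
      if_neg (key _ (Or.inr rfl)), add_zero]

/-- The enhanced state with smoothing `σ` whose labels are given on arcs. -/
def enhance (D : CrossingData X A) (σ : Finset X) (l : A → Label)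
    (hl : ∀ a b, D.circle σ a = D.circle σ b → l a = l b) : D.Enhanced :=
  ⟨σ, Quot.lift l fun a b h => hl a b (Quot.sound h)⟩

theorem label_enhance {σ : Finset X} {l : A → Label}
    {hl : ∀ a b, D.circle σ a = D.circle σ b → l a = l b} (a : A) :
    D.label (D.enhance σ l hl) a = l a := rfl

theorem enhanced_ext {s t : D.Enhanced} (h : s.1 = t.1) (hl : ∀ a, D.label s a = D.label t a) :
    s = t := by
  obtain ⟨σ, l⟩ := s
  obtain ⟨τ, l'⟩ := t
  cases h
  congr 1
  funext c
  obtain ⟨a, rfl⟩ := Quot.exists_rep c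
  exact hl a

theorem exists_represents [Finite A] (s : D.Enhanced) : ∃ m, D.Represents m s := by
  have := Fintype.ofFinite (D.Circle s.1)
  refine ⟨(Finset.univ.filter fun c => s.2 c = Label.x).val.map Quot.out, fun a => ?_⟩
  have hout : ∀ c : D.Circle s.1, D.circle s.1 c.out = c := fun c => Quot.out_eq c
  rw [arcCount, Multiset.countP_map]
  simp only [hout]
  rw [← Finset.filter_val, Finset.filter_filter, Finset.card_val]
  by_cases ha : D.label s a = Label.x
  · rw [if_pos ha, Finset.card_eq_one]
    refine ⟨D.circle s.1 a, ?_⟩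
    ext c
    simp only [Finset.mem_filter, Finset.mem_univ, true_and, Finset.mem_singleton]
    refine ⟨fun h => h.2, ?_⟩
    rintro rfl
    exact ⟨ha, rfl⟩
  · rw [if_neg ha, Finset.card_eq_zero, Finset.filter_eq_empty_iff]
    rintro c - ⟨h1, rfl⟩
    exact ha h1

theorem coeffFun_congr {u : D.Enhanced} (m : Multiset A) {a b : A}
    (h : D.circle u.1 a = D.circle u.1 b) :
    D.coeffFun u (m + {a}) = D.coeffFun u (m + {b}) := by
  simp only [coeffFun, Represents, arcCount_add, arcCount_singleton, h]

/-- A monomial is congruent to the state that it represents, or lies in the ideal. -/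
theorem HasSurgery.sum_coeffFun_mul [Fintype D.Enhanced] (hs : D.HasSurgery) {f : X}
    {τ : Finset X} {u : D.Enhanced} (hf : Flips f τ u.1) (m : Multiset A) :
    ∑ t : D.Enhanced, (if t.1 = τ then
        D.coeffFun t m * (if D.Compatible f t u then 1 else 0) else 0) =
      D.edgeDual f τ (D.coeffFun u) m := by
  by_cases hm : ∀ a, D.arcCount τ m a ≤ 1
  · set t₀ : D.Enhanced := D.enhance τ
      (fun a => if D.arcCount τ m a = 1 then Label.x else Label.one)
      (fun a b hab => by simp only [arcCount_congr m hab]) with ht₀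
    have hrep : D.Represents m t₀ := by
      intro a
      rw [ht₀, label_enhance]
      change D.arcCount τ m a = _
      have h1 := hm a
      by_cases h2 : D.arcCount τ m a = 1
      · simp [h2]
      · simp only [h2, if_false, reduceCtorEq]
        omega
    rw [Finset.sum_eq_single t₀]
    · rw [if_pos (show t₀.1 = τ from rfl), coeffFun, if_pos hrep, one_mul]
      exact hs.edgeDual_coeffFun (s := t₀) hf hrep
    · intro t _ hne
      by_cases ht : t.1 = τ
      · rw [if_pos ht, coeffFun, if_neg, zero_mul]
        intro h
        refine hne (enhanced_ext ht fun a => ?_)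
        have h1 := h a
        have h2 := hrep a
        rw [ht] at h1
        exact Label.ite_eq_iff.1 (h1.symm.trans h2)
      · rw [if_neg ht]
    · simp
  · push Not at hm
    obtain ⟨a, ha⟩ := hm
    rw [hs.edgeDual_eq_zero hf ha]
    refine Finset.sum_eq_zero fun t _ => ?_
    by_cases ht : t.1 = τ
    · rw [if_pos ht, coeffFun, if_neg, zero_mul]
      intro h
      have h1 := h a
      rw [ht] at h1
      split_ifs at h1 <;> omega
    · rw [if_neg ht]

/-- The composition of two edge maps. -/
theorem HasSurgery.sum_compatible [Fintype D.Enhanced] (hs : D.HasSurgery) {e f : X}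
    {s u : D.Enhanced} {τ : Finset X} (he : Flips e s.1 τ) (hf : Flips f τ u.1)
    {m : Multiset A} (hm : D.Represents m s) :
    ∑ t : D.Enhanced, (if t.1 = τ ∧ D.Compatible e s t ∧ D.Compatible f t u then (1 : ℤ) else 0) =
      D.edgeDual e s.1 (D.edgeDual f τ (D.coeffFun u)) m := by
  have h1 : ∀ t : D.Enhanced,
      (if t.1 = τ ∧ D.Compatible e s t ∧ D.Compatible f t u then (1 : ℤ) else 0) =
      if t.1 = τ then D.edgeDual e s.1 (D.coeffFun t) m *
        (if D.Compatible f t u then 1 else 0) else 0 := by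
    intro t
    by_cases ht : t.1 = τ
    · rw [if_pos ht, ← hs.edgeDual_coeffFun (by rwa [ht]) hm]
      by_cases h2 : D.Compatible e s t <;> by_cases h3 : D.Compatible f t u <;> simp [ht, h2, h3]
    · simp [ht]
  have h2 := hs.sum_coeffFun_mul hf
  simp only [h1, edgeDual] at h2 ⊢
  by_cases hne : D.circle s.1 (D.slot e 0) = D.circle s.1 (D.slot e 2)
  · simp only [hne, ne_eq, not_true_eq_false, if_false] at h2 ⊢
    rw [← h2, ← h2, ← Finset.sum_add_distrib]
    refine Finset.sum_congr rfl fun t _ => ?_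
    split_ifs <;> simp
  · simp only [hne, ne_eq, not_false_eq_true, if_true] at h2 ⊢
    rw [← h2]

theorem HasSurgery.card_circle_flips [Finite A] (hs : D.HasSurgery) {e : X} {σ τ : Finset X}
    (hf : Flips e σ τ) :
    (Nat.card (D.Circle τ) : ℤ) = Nat.card (D.Circle σ) +
      if D.circle σ (D.slot e 0) ≠ D.circle σ (D.slot e 2) then -1 else 1 := by
  split_ifs with h
  · rw [hs.card_circle hf h]; push_cast; ring
  · rw [hs.card_circle hf.symm ((hs.eq_iff_ne hf).1 (not_ne_iff.1 h))]; push_cast; ring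

/-- The edge maps of two crossings commute. The orders of merges and splits agree up to the cases
where both ways are a merge and then a split, or both a split and then a merge; there the two
crossings meet the same circles. -/
theorem HasSurgery.edgeDual_comm [Finite A] (hs : D.HasSurgery) {e f : X} {σ τ τ' : Finset X}
    {u : D.Enhanced} (h1 : Flips e σ τ) (h2 : Flips f τ u.1) (h3 : Flips f σ τ')
    (h4 : Flips e τ' u.1) (m : Multiset A) :
    D.edgeDual e σ (D.edgeDual f τ (D.coeffFun u)) m =
      D.edgeDual f σ (D.edgeDual e τ' (D.coeffFun u)) m := by
  have c1 := hs.card_circle_flips h1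
  have c2 := hs.card_circle_flips h2
  have c3 := hs.card_circle_flips h3
  have c4 := hs.card_circle_flips h4
  by_cases p1 : D.circle σ (D.slot e 0) = D.circle σ (D.slot e 2) <;>
  by_cases p2 : D.circle τ (D.slot f 0) = D.circle τ (D.slot f 2) <;>
  by_cases p3 : D.circle σ (D.slot f 0) = D.circle σ (D.slot f 2) <;>
  by_cases p4 : D.circle τ' (D.slot e 0) = D.circle τ' (D.slot e 2) <;>
  simp only [p1, p2, p3, p4, edgeDual, ne_eq, not_true_eq_false, not_false_eq_true, if_true,
    if_false] at c1 c2 c3 c4 ⊢ <;> try omega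
  · simp only [add_right_comm m]
    ring
  · -- split and merge on both sides: one circle of `u` carries all ends at both crossings
    have q1 := (hs.eq_iff_ne h1).1 p1
    have q2 : D.circle u.1 (D.slot f 0) = D.circle u.1 (D.slot f 2) := hs.merged h2 p2
    have q3 : D.circle u.1 (D.slot e 0) = D.circle u.1 (D.slot e 2) := hs.merged h4 p4
    have q4 := ((hs.merge h1.symm q1 _ _).1 p3).resolve_left p2
    have q5 : D.circle u.1 (D.slot f 0) = D.circle u.1 (D.slot e 0) := by
      rcases q4.1 with h | h
      · exact hs.circle_mono h2 p2 h
      · exact (hs.circle_mono h2 p2 h).trans q3.symm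
    rw [coeffFun_congr m q5, coeffFun_congr m (q2.symm.trans q5), coeffFun_congr m q3]
  · -- merge and split on both sides: the same two circles of `u` meet both crossings
    have q1 := (hs.eq_iff_ne h2).1 p2
    have q2 := (hs.eq_iff_ne h4).1 p4
    have q3 := ((hs.merge h1 p1 _ _).1 p2).resolve_left p3
    have q4 : D.circle τ (D.slot f 0) = D.circle τ (D.slot e 0) :=
      (hs.circle_eq_merged h1 p1 _).2 q3.1
    have q5 := hs.merged h1 p1
    have q6 := (hs.circle_eq_merged h2.symm q1 _).1 q4.symm
    have q7 := (hs.circle_eq_merged h2.symm q1 _).1 (q5.symm.trans q4.symm)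
    rcases q6 with h | h <;> rcases q7 with h' | h'
    · exact absurd (h.trans h'.symm) q2
    · rw [coeffFun_congr m h, coeffFun_congr m h']
    · rw [coeffFun_congr m h, coeffFun_congr m h', add_comm]
    · exact absurd (h.trans h'.symm) q2

end Square

section Square

variable [Fintype X] [LinearOrder X] [Finite A]

/-- The square of the Khovanov differential vanishes: its terms come in pairs, one for each order
of two crossings, that agree up to the sign. -/
theorem HasSurgery.finsum_khCoeff_mul (hs : D.HasSurgery) (s u : D.Enhanced) :
    ∑ᶠ t, D.khCoeff s t * D.khCoeff t u = 0 := by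
  classical
  have := Fintype.ofFinite D.Enhanced
  rw [finsum_eq_sum_of_fintype]
  let N (e f : X) : ℤ := ∑ t : D.Enhanced,
    if t.1 = insert e s.1 ∧ D.Compatible e s t ∧ D.Compatible f t u then (1 : ℤ) else 0
  let F (e f : X) : ℤ := if e ∉ s.1 ∧ f ∉ s.1 ∧ e ≠ f ∧ u.1 = insert f (insert e s.1) then
    (-1) ^ (s.1.filter (· < e)).card * (-1) ^ ((insert e s.1).filter (· < f)).card * N e f else 0
  have hsum : ∑ t, D.khCoeff s t * D.khCoeff t u = ∑ e, ∑ f, F e f := by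
    have : ∀ t, D.khCoeff s t * D.khCoeff t u = ∑ e, ∑ f,
        if (e ∉ s.1 ∧ f ∉ s.1 ∧ e ≠ f ∧ u.1 = insert f (insert e s.1)) then
          (-1) ^ (s.1.filter (· < e)).card * (-1) ^ ((insert e s.1).filter (· < f)).card *
            (if t.1 = insert e s.1 ∧ D.Compatible e s t ∧ D.Compatible f t u then (1 : ℤ) else 0)
        else 0 := by
      intro t
      rw [khCoeff, khCoeff, Finset.sum_mul_sum]
      refine Finset.sum_congr rfl fun e _ => Finset.sum_congr rfl fun f _ => ?_
      by_cases ht : t.1 = insert e s.1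
      · rw [ht]
        by_cases he : e ∈ s.1
        · simp [he]
        · by_cases hf : f ∈ insert e s.1
          · have : f ∈ s.1 ∨ e = f := by
              rcases Finset.mem_insert.1 hf with h | h
              · exact Or.inr h.symm
              · exact Or.inl h
            simp only [hf, not_true_eq_false, false_and, if_false, mul_zero]
            exact (if_neg (by tauto)).symm
          · have h1 : f ∉ s.1 := fun h => hf (Finset.mem_insert_of_mem h)
            have h2 : e ≠ f := by rintro rfl; exact hf (Finset.mem_insert_self _ _)
            by_cases h3 : D.Compatible e s t <;> by_cases h4 : D.Compatible f t u <;>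
              by_cases h5 : u.1 = insert f (insert e s.1) <;>
              simp [he, hf, h1, h2, h3, h4, h5]
      · simp [ht]
    simp only [this]
    rw [Finset.sum_comm]
    refine Finset.sum_congr rfl fun e _ => ?_
    rw [Finset.sum_comm]
    refine Finset.sum_congr rfl fun f _ => ?_
    simp only [F, N]
    split_ifs
    · rw [Finset.mul_sum]
    · simp
  have hanti : ∀ e f, F e f = - F f e := by
    intro e f
    simp only [F]
    by_cases hc : e ∉ s.1 ∧ f ∉ s.1 ∧ e ≠ f ∧ u.1 = insert f (insert e s.1)
    · obtain ⟨he, hf, hef, hu⟩ := hc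
      have hu' : u.1 = insert e (insert f s.1) := by rw [hu, Finset.insert_comm]
      rw [if_pos ⟨he, hf, hef, hu⟩, if_pos ⟨hf, he, hef.symm, hu'⟩]
      have hN : N e f = N f e := by
        obtain ⟨m, hm⟩ := D.exists_represents s
        have h1 := flips_insert he
        have h2 : Flips f (insert e s.1) u.1 := by
          rw [hu]; exact flips_insert (by simp [hf, hef.symm])
        have h3 := flips_insert hf
        have h4 : Flips e (insert f s.1) u.1 := by
          rw [hu']; exact flips_insert (by simp [he, hef])
        have e1 : N e f = D.edgeDual e s.1 (D.edgeDual f (insert e s.1) (D.coeffFun u)) m := by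
          rw [← hs.sum_compatible h1 h2 hm]
          exact Finset.sum_congr rfl fun t _ => by congr
        have e2 : N f e = D.edgeDual f s.1 (D.edgeDual e (insert f s.1) (D.coeffFun u)) m := by
          rw [← hs.sum_compatible h3 h4 hm]
          exact Finset.sum_congr rfl fun t _ => by congr
        rw [e1, e2, hs.edgeDual_comm h1 h2 h3 h4]
      rw [hN]
      have hsign : ∀ {e f : X}, e ∉ s.1 → f ∉ s.1 → e < f →
          (-1 : ℤ) ^ (s.1.filter (· < e)).card * (-1) ^ ((insert e s.1).filter (· < f)).card =
          -((-1) ^ (s.1.filter (· < f)).card * (-1) ^ ((insert f s.1).filter (· < e)).card) := by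
        intro e f he hf hlt
        rw [Finset.filter_insert, if_pos hlt, Finset.filter_insert, if_neg hlt.not_gt,
          Finset.card_insert_of_notMem (by simp [he]), pow_succ]
        ring
      rcases lt_or_gt_of_ne hef with hlt | hlt
      · rw [hsign he hf hlt]; ring
      · rw [hsign hf he hlt]; ring
    · rw [if_neg hc, if_neg, neg_zero]
      rintro ⟨h1, h2, h3, h4⟩
      exact hc ⟨h2, h1, h3.symm, by rw [h4, Finset.insert_comm]⟩
  have hneg : ∑ e, ∑ f, F e f = - ∑ e, ∑ f, F e f := by
    conv_lhs => rw [Finset.sum_comm]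
    simp only [← Finset.sum_neg_distrib]
    exact Finset.sum_congr rfl fun e _ => Finset.sum_congr rfl fun f _ => hanti f e
  rw [hsum]
  omega

end Square

end CrossingData

/-! ### Planarity: the circles of a state and the Tait graph -/

namespace CrossingData

variable {X A : Type*} {D : CrossingData X A} {black : D.Face → Prop}

/-- The spanning subgraph of the Tait graph that belongs to the state `σ`: the edges whose smoothing
connects the two black corners. -/
def blackSet (D : CrossingData X A) (black : D.Face → Prop) (σ : Finset X) : Set X :=
  {e | e ∉ σ ↔ D.PosEdge black e}

theorem mem_blackSet {σ : Finset X} {e : X} :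
    e ∈ D.blackSet black σ ↔ (e ∉ σ ↔ D.PosEdge black e) := Iff.rfl

theorem mem_iff_of_blackSet {σ τ : Finset X} {e : X} :
    (e ∈ σ ↔ e ∈ τ) ↔ (e ∈ D.blackSet black σ ↔ e ∈ D.blackSet black τ) := by
  rw [mem_blackSet, mem_blackSet]
  tauto

open Classical in
/-- The state that belongs to a spanning subgraph of the Tait graph. -/
noncomputable def ofBlack [Fintype X] (D : CrossingData X A) (black : D.Face → Prop)
    (S : Set X) : Finset X :=
  Finset.univ.filter fun e => e ∉ S ↔ D.PosEdge black e

theorem blackSet_ofBlack [Fintype X] (S : Set X) : D.blackSet black (D.ofBlack black S) = S := by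
  ext e
  simp only [mem_blackSet, ofBlack, Finset.mem_filter, Finset.mem_univ, true_and]
  tauto

theorem ofBlack_blackSet [Fintype X] (σ : Finset X) : D.ofBlack black (D.blackSet black σ) = σ := by
  ext e
  simp only [mem_blackSet, ofBlack, Finset.mem_filter, Finset.mem_univ, true_and]
  tauto

theorem flips_of_blackSet {σ τ : Finset X} {e : X}
    (h : ∀ f, (f ∈ D.blackSet black σ ↔ f ∈ D.blackSet black τ) ↔ f ≠ e) : Flips e σ τ :=
  fun f => mem_iff_of_blackSet.trans (h f)

open Classical in
/-- The black region next to the arc `a`. -/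
noncomputable def blackFace (D : CrossingData X A) (black : D.Face → Prop) (a : A) : D.Face :=
  if black (Quot.mk _ (a, true)) then Quot.mk _ (a, true) else Quot.mk _ (a, false)

theorem IsCheckerboard.black_blackFace (h : D.IsCheckerboard black) (a : A) :
    black (D.blackFace black a) := by
  unfold blackFace
  split_ifs with ha
  · exact ha
  · exact not_not.1 (mt (h a).2 ha)

theorem IsCheckerboard.blackFace_eq (h : D.IsCheckerboard black) {a : A} {t : Bool}
    (ht : black (Quot.mk _ (a, t))) : D.blackFace black a = Quot.mk _ (a, t) := by
  cases t
  · rw [blackFace, if_neg fun h' => (h a).1 h' ht]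
  · rw [blackFace, if_pos ht]

theorem IsCheckerboard.exists_blackFace_eq (h : D.IsCheckerboard black) {u : D.Face}
    (hu : black u) : ∃ a, D.blackFace black a = u := by
  obtain ⟨⟨a, t⟩, rfl⟩ := Quot.exists_rep u
  exact ⟨a, h.blackFace_eq hu⟩

theorem IsCheckerboard.blackFace_slot (h : D.IsCheckerboard black) {e : X} {k : Fin 4}
    (hk : black (D.corner e k)) : D.blackFace black (D.slot e k) = D.corner e k :=
  h.blackFace_eq hk

theorem IsCheckerboard.blackFace_slot_succ (h : D.IsCheckerboard black) {e : X} {k : Fin 4}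
    (hk : black (D.corner e k)) : D.blackFace black (D.slot e (k + 1)) = D.corner e k := by
  rw [corner_eq_mk_side] at hk ⊢
  exact h.blackFace_eq hk

theorem IsCheckerboard.blackFace_of_posEdge (h : D.IsCheckerboard black) {e : X}
    (he : D.PosEdge black e) :
    D.blackFace black (D.slot e 0) = D.corner e 3 ∧ D.blackFace black (D.slot e 1) = D.corner e 1 ∧
    D.blackFace black (D.slot e 2) = D.corner e 1 ∧ D.blackFace black (D.slot e 3) = D.corner e 3 :=
  have h1 : black (D.corner e 1) := he
  have h3 : black (D.corner e 3) := by
    have := h.black_corner e; tauto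
  ⟨h.blackFace_slot_succ h3, h.blackFace_slot h1, h.blackFace_slot_succ h1, h.blackFace_slot h3⟩

theorem IsCheckerboard.blackFace_of_not_posEdge (h : D.IsCheckerboard black) {e : X}
    (he : ¬ D.PosEdge black e) :
    D.blackFace black (D.slot e 0) = D.corner e 0 ∧ D.blackFace black (D.slot e 1) = D.corner e 0 ∧
    D.blackFace black (D.slot e 2) = D.corner e 2 ∧ D.blackFace black (D.slot e 3) = D.corner e 2 :=
  have h0 : black (D.corner e 0) := by
    have := h.black_corner e; simp only [PosEdge] at he; tauto
  have h2 : black (D.corner e 2) := by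
    have := h.black_corner e; tauto
  ⟨h.blackFace_slot h0, h.blackFace_slot_succ h0, h.blackFace_slot h2, h.blackFace_slot_succ h2⟩

theorem TaitConn.refl (S : Set X) (u : D.Face) : D.TaitConn black S u u := Relation.EqvGen.refl u

theorem TaitConn.symm {S : Set X} {u v : D.Face} (h : D.TaitConn black S u v) :
    D.TaitConn black S v u := Relation.EqvGen.symm _ _ h

theorem TaitConn.trans {S : Set X} {u v w : D.Face} (h : D.TaitConn black S u v)
    (h' : D.TaitConn black S v w) : D.TaitConn black S u w := Relation.EqvGen.trans _ _ _ h h'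

theorem taitLink_blackFace (h : D.IsCheckerboard black) {e : X} {u v : D.Face}
    (hl : D.TaitLink black e u v) :
    (u = D.blackFace black (D.slot e 0) ∧ v = D.blackFace black (D.slot e 2)) ∨
    (u = D.blackFace black (D.slot e 2) ∧ v = D.blackFace black (D.slot e 0)) := by
  rcases hl with ⟨he, rfl, rfl⟩ | ⟨he, rfl, rfl⟩
  · have := h.blackFace_of_posEdge he
    exact Or.inr ⟨this.2.2.1.symm, this.1.symm⟩
  · have := h.blackFace_of_not_posEdge he
    exact Or.inl ⟨this.1.symm, this.2.2.1.symm⟩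

/-- The edge `e` joins the black regions next to the arcs at its ends `0` and `2`. -/
theorem IsCheckerboard.endsConn_iff (h : D.IsCheckerboard black) {S : Set X} {e : X} :
    D.EndsConn black S e ↔ D.TaitConn black S (D.blackFace black (D.slot e 0))
      (D.blackFace black (D.slot e 2)) := by
  constructor
  · intro he
    by_cases hp : D.PosEdge black e
    · have := h.blackFace_of_posEdge hp
      rw [this.1, this.2.2.1]
      exact (he _ _ (Or.inl ⟨hp, rfl, rfl⟩)).symm
    · have := h.blackFace_of_not_posEdge hp
      rw [this.1, this.2.2.1]
      exact he _ _ (Or.inr ⟨hp, rfl, rfl⟩)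
  · intro he u v hl
    rcases taitLink_blackFace h hl with ⟨rfl, rfl⟩ | ⟨rfl, rfl⟩
    · exact he
    · exact he.symm

theorem TaitConn.of_subset_endsConn {S S' : Set X} (hS : ∀ e ∈ S, D.EndsConn black S' e)
    {u v : D.Face} (h : D.TaitConn black S u v) : D.TaitConn black S' u v := by
  induction h with
  | rel u v h => obtain ⟨e, he, hl⟩ := h; exact hS e he u v hl
  | refl u => exact TaitConn.refl _ _
  | symm u v _ ih => exact ih.symm
  | trans u v w _ _ ih ih' => exact ih.trans ih'

theorem endsConn_of_mem {S : Set X} {e : X} (he : e ∈ S) : D.EndsConn black S e :=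
  fun _ _ hl => .rel _ _ ⟨e, he, hl⟩

theorem TaitConn.mono {S S' : Set X} (hS : S ⊆ S') {u v : D.Face} (h : D.TaitConn black S u v) :
    D.TaitConn black S' u v :=
  h.of_subset_endsConn fun _ he => endsConn_of_mem (hS he)

theorem IsCheckerboard.taitConn_insert_iff (h : D.IsCheckerboard black) {S : Set X} {e : X}
    {u v : D.Face} :
    D.TaitConn black (insert e S) u v ↔ D.TaitConn black S u v ∨
      ((D.TaitConn black S u (D.blackFace black (D.slot e 0)) ∨
        D.TaitConn black S u (D.blackFace black (D.slot e 2))) ∧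
      (D.TaitConn black S v (D.blackFace black (D.slot e 0)) ∨
        D.TaitConn black S v (D.blackFace black (D.slot e 2)))) := by
  constructor
  · intro huv
    induction huv with
    | rel u v huv =>
      obtain ⟨f, hf, hl⟩ := huv
      rcases hf with rfl | hf
      · rcases taitLink_blackFace h hl with ⟨rfl, rfl⟩ | ⟨rfl, rfl⟩
        · exact Or.inr ⟨Or.inl (TaitConn.refl _ _), Or.inr (TaitConn.refl _ _)⟩
        · exact Or.inr ⟨Or.inr (TaitConn.refl _ _), Or.inl (TaitConn.refl _ _)⟩
      · exact Or.inl (.rel _ _ ⟨f, hf, hl⟩)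
    | refl u => exact Or.inl (TaitConn.refl _ _)
    | symm u v _ ih => exact ih.imp TaitConn.symm And.symm
    | trans u v w _ _ ih ih' =>
      rcases ih with h1 | h1 <;> rcases ih' with h2 | h2
      · exact Or.inl (h1.trans h2)
      · exact Or.inr ⟨h2.1.imp h1.trans h1.trans, h2.2⟩
      · exact Or.inr ⟨h1.1, h1.2.imp h2.symm.trans h2.symm.trans⟩
      · exact Or.inr ⟨h1.1, h2.2⟩
  · have he : D.TaitConn black (insert e S) (D.blackFace black (D.slot e 0))
        (D.blackFace black (D.slot e 2)) :=
      h.endsConn_iff.1 (endsConn_of_mem (Set.mem_insert e S))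
    have hm : ∀ {u v}, D.TaitConn black S u v → D.TaitConn black (insert e S) u v :=
      fun h' => h'.mono (Set.subset_insert e S)
    rintro (h' | ⟨h1, h2⟩)
    · exact hm h'
    · have h3 := h1.elim hm fun h' => (hm h').trans he.symm
      have h4 := h2.elim hm fun h' => (hm h').trans he.symm
      exact h3.trans h4.symm

/-- The edges whose ends are connected by edges in `S`: the closure operator of the graphic matroid
of the Tait graph. -/
def taitClosure (D : CrossingData X A) (black : D.Face → Prop) (S : Set X) : Set X :=
  {e | D.EndsConn black S e}

theorem IsCheckerboard.isMatroidClosure (h : D.IsCheckerboard black) :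
    IsMatroidClosure (D.taitClosure black) where
  subset _ _ he := endsConn_of_mem he
  mono hS _ he u v hl := (he u v hl).mono hS
  idem _ _ he u v hl := (he u v hl).of_subset_endsConn fun _ hf => hf
  exchange {S e f} he hn := by
    have h1 : D.EndsConn black (insert f S) e := he
    have h2 : ¬ D.EndsConn black S e := hn
    change D.EndsConn black (insert e S) f
    rw [h.endsConn_iff, h.taitConn_insert_iff] at h1 ⊢
    rw [h.endsConn_iff] at h2
    obtain ⟨h3, h4⟩ := h1.resolve_left h2
    right
    rcases h3 with h3 | h3 <;> rcases h4 with h4 | h4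
    · exact absurd (h3.trans h4.symm) h2
    · exact ⟨Or.inl h3.symm, Or.inr h4.symm⟩
    · exact ⟨Or.inr h4.symm, Or.inl h3.symm⟩
    · exact absurd (h3.trans h4.symm) h2

/-- The arcs of a circle run along one component of the spanning subgraph. -/
theorem IsCheckerboard.taitConn_of_circle_eq (h : D.IsCheckerboard black) {σ : Finset X} {a b : A}
    (hab : D.circle σ a = D.circle σ b) :
    D.TaitConn black (D.blackSet black σ) (D.blackFace black a) (D.blackFace black b) := by
  replace hab := Quot.eqvGen_exact hab
  induction hab with
  | rel a b hab =>
    have hlink : ∀ e, (e ∉ σ ↔ D.PosEdge black e) → D.TaitConn black (D.blackSet black σ)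
        (D.blackFace black (D.slot e 0)) (D.blackFace black (D.slot e 2)) :=
      fun e he => h.endsConn_iff.1 (endsConn_of_mem he)
    obtain ⟨e, he⟩ := hab
    by_cases hp : D.PosEdge black e
    · obtain ⟨h0, h1, h2, h3⟩ := h.blackFace_of_posEdge hp
      rcases he with ⟨he, ⟨rfl, rfl⟩ | ⟨rfl, rfl⟩⟩ | ⟨he, ⟨rfl, rfl⟩ | ⟨rfl, rfl⟩⟩
      · rw [h1, ← h2]; exact hlink e (by tauto)
      · rw [h3, ← h0]; exact (hlink e (by tauto)).symm
      · rw [h1, h2]; exact TaitConn.refl _ _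
      · rw [h3, h0]; exact TaitConn.refl _ _
    · obtain ⟨h0, h1, h2, h3⟩ := h.blackFace_of_not_posEdge hp
      rcases he with ⟨he, ⟨rfl, rfl⟩ | ⟨rfl, rfl⟩⟩ | ⟨he, ⟨rfl, rfl⟩ | ⟨rfl, rfl⟩⟩
      · rw [h0, h1]; exact TaitConn.refl _ _
      · rw [h2, h3]; exact TaitConn.refl _ _
      · rw [h1, ← h0]; exact hlink e (by tauto)
      · rw [h3, ← h2]; exact (hlink e (by tauto)).symm
  | refl a => exact TaitConn.refl _ _
  | symm a b _ ih => exact ih.symm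
  | trans a b c _ _ ih ih' => exact ih.trans ih'

theorem taitConn_empty {u v : D.Face} (h : D.TaitConn black ∅ u v) : u = v := by
  induction h with
  | rel u v h => obtain ⟨e, he, -⟩ := h; exact he.elim
  | refl u => rfl
  | symm u v _ ih => exact ih.symm
  | trans u v w _ _ ih ih' => exact ih.trans ih'

/-- If no black corners are connected, the circles of the state are the boundaries of the black
regions. -/
theorem IsCheckerboard.circle_eq_iff_of_blackSet_eq_empty (h : D.IsCheckerboard black)
    {σ : Finset X} (hσ : D.blackSet black σ = ∅) (a b : A) :
    D.circle σ a = D.circle σ b ↔ D.blackFace black a = D.blackFace black b := by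
  classical
  refine ⟨fun hab => taitConn_empty (hσ ▸ h.taitConn_of_circle_eq hab), fun hab => ?_⟩
  let G : D.Face → Option (D.Circle σ) := Quot.lift
    (fun s => if black (Quot.mk _ s) then some (D.circle σ s.1) else none) (by
      intro s t hst
      obtain ⟨e, k, hs, ht⟩ := id hst
      have h1 : (Quot.mk _ s : D.Face) = Quot.mk _ t := Quot.sound hst
      simp only [← h1]
      by_cases hb : black (Quot.mk _ s)
      · rw [if_pos hb, if_pos hb]
        congr 1
        subst hs ht
        change D.circle σ (D.slot e k) = D.circle σ (D.slot e (k + 1))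
        have hc := h.black_corner e
        have he : e ∉ D.blackSet black σ := by rw [hσ]; exact Set.notMem_empty e
        rw [mem_blackSet, PosEdge] at he
        change black (D.corner e k) at hb
        by_cases heσ : e ∈ σ
        · have h2 := D.circle_of_mem heσ
          fin_cases k
          · change black (D.corner e 0) at hb; tauto
          · exact h2.1
          · change black (D.corner e 2) at hb; tauto
          · exact h2.2
        · have h2 := D.circle_of_notMem heσ
          fin_cases k
          · exact h2.1
          · change black (D.corner e 1) at hb; tauto
          · exact h2.2
          · change black (D.corner e 3) at hb; tauto
      · rw [if_neg hb, if_neg hb])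
  have hG : ∀ a, G (D.blackFace black a) = some (D.circle σ a) := by
    intro a
    obtain ⟨t, ht⟩ : ∃ t, black (Quot.mk _ (a, t)) := by
      by_cases h1 : black (Quot.mk _ (a, true))
      · exact ⟨_, h1⟩
      · exact ⟨_, not_not.1 (mt (h a).2 h1)⟩
    rw [h.blackFace_eq ht]
    exact if_pos ht
  have := hG a
  rw [hab, hG b] at this
  exact (Option.some_injective _ this).symm

theorem IsCheckerboard.compl (h : D.IsCheckerboard black) :
    D.IsCheckerboard fun f => ¬ black f := by
  intro a
  have := h a
  tauto

theorem blackSet_compl (σ : Finset X) :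
    D.blackSet (fun f => ¬ black f) σ = (D.blackSet black σ)ᶜ := by
  ext e
  simp only [Set.mem_compl_iff, mem_blackSet, PosEdge]
  tauto

/-- The regions are the black regions, bounded by the circles of the state in which no black corners
are connected, and the white regions, bounded by those of the opposite state. -/
theorem IsCheckerboard.card_face [Finite A] (h : D.IsCheckerboard black) {σ τ : Finset X}
    (hσ : D.blackSet black σ = ∅) (hτ : D.blackSet black τ = Set.univ) :
    Nat.card D.Face = Nat.card (D.Circle σ) + Nat.card (D.Circle τ) := by
  have hτ' : D.blackSet (fun f => ¬ black f) τ = ∅ := by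
    rw [blackSet_compl, hτ, Set.compl_univ]
  have e1 := h.circle_eq_iff_of_blackSet_eq_empty hσ
  have e2 := h.compl.circle_eq_iff_of_blackSet_eq_empty hτ'
  let F : D.Circle σ ⊕ D.Circle τ → D.Face := Sum.elim
    (Quot.lift (D.blackFace black) fun a b hab => (e1 a b).1 (Quot.sound hab))
    (Quot.lift (D.blackFace fun f => ¬ black f) fun a b hab => (e2 a b).1 (Quot.sound hab))
  have hF : Function.Bijective F := by
    constructor
    · rintro (⟨⟨a⟩⟩ | ⟨⟨a⟩⟩) (⟨⟨b⟩⟩ | ⟨⟨b⟩⟩) hab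
      · exact congrArg Sum.inl ((e1 a b).2 hab)
      · have h1 := h.black_blackFace a
        have h2 := h.compl.black_blackFace b
        change D.blackFace black a = D.blackFace (fun f => ¬ black f) b at hab
        rw [hab] at h1
        exact absurd h1 h2
      · have h1 := h.compl.black_blackFace a
        have h2 := h.black_blackFace b
        change D.blackFace (fun f => ¬ black f) a = D.blackFace black b at hab
        rw [hab] at h1
        exact absurd h2 h1
      · exact congrArg Sum.inr ((e2 a b).2 hab)
    · intro u
      by_cases hu : black u
      · obtain ⟨a, rfl⟩ := h.exists_blackFace_eq hu
        exact ⟨Sum.inl (D.circle σ a), rfl⟩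
      · obtain ⟨a, rfl⟩ := h.compl.exists_blackFace_eq hu
        exact ⟨Sum.inr (D.circle τ a), rfl⟩
  rw [← Nat.card_congr (Equiv.ofBijective F hF), Nat.card_sum]

end CrossingData

namespace CrossingData

variable {X A : Type*} {D : CrossingData X A} {black : D.Face → Prop}

/-- The partition of the arcs according to the components of the spanning subgraph `S` of the Tait
graph that they run along. -/
def taitSetoid (D : CrossingData X A) (black : D.Face → Prop) (S : Set X) : Setoid A where
  r a b := D.TaitConn black S (D.blackFace black a) (D.blackFace black b)
  iseqv := ⟨fun _ => TaitConn.refl _ _, TaitConn.symm, TaitConn.trans⟩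

/-- The number of components of the spanning subgraph `S` of the Tait graph. -/
noncomputable def taitComponents (D : CrossingData X A) (black : D.Face → Prop) (S : Set X) : ℕ :=
  Nat.card (Quotient (D.taitSetoid black S))

theorem taitComponents_insert_of_endsConn {S : Set X} {e : X}
    (he : D.EndsConn black S e) :
    D.taitComponents black (insert e S) = D.taitComponents black S := by
  have : D.taitSetoid black (insert e S) = D.taitSetoid black S := by
    ext a b
    refine ⟨fun hab => TaitConn.of_subset_endsConn ?_ hab,
      fun hab => TaitConn.mono (Set.subset_insert _ _) hab⟩
    rintro f (rfl | hf)
    · exact he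
    · exact endsConn_of_mem hf
  rw [taitComponents, this, taitComponents]

theorem IsCheckerboard.taitComponents_insert_of_not_endsConn [Finite A] (h : D.IsCheckerboard black)
    {S : Set X} {e : X} (he : ¬ D.EndsConn black S e) :
    D.taitComponents black S = D.taitComponents black (insert e S) + 1 := by
  rw [h.endsConn_iff] at he
  have key : ∀ a b, (D.taitSetoid black (insert e S)).r a b ↔ _ := fun a b =>
    h.taitConn_insert_iff (S := S) (e := e)
  let π : Quotient (D.taitSetoid black S) → Quotient (D.taitSetoid black (insert e S)) :=
    Quotient.map id fun a b hab => TaitConn.mono (Set.subset_insert e S) hab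
  refine card_eq_card_add_one_of_merge π (a := Quotient.mk _ (D.slot e 0))
    (b := Quotient.mk _ (D.slot e 2)) ?_ ?_ ?_ ?_
  · rintro ⟨a⟩
    exact ⟨Quotient.mk _ a, rfl⟩
  · exact fun h' => he (Quotient.exact h')
  · exact Quotient.sound (h.endsConn_iff.1 (endsConn_of_mem (Set.mem_insert e S)))
  · rintro ⟨a⟩ ⟨b⟩ hab
    refine ((key a b).1 (Quotient.exact hab)).imp (fun h' => Quotient.sound h') fun h' => ?_
    exact ⟨h'.1.imp (fun h' => Quotient.sound h') fun h' => Quotient.sound h',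
      h'.2.imp (fun h' => Quotient.sound h') fun h' => Quotient.sound h'⟩

theorem IsCheckerboard.taitComponents_empty [Fintype X] (h : D.IsCheckerboard black) :
    D.taitComponents black ∅ = Nat.card (D.Circle (D.ofBlack black ∅)) := by
  have e := h.circle_eq_iff_of_blackSet_eq_empty (blackSet_ofBlack (D := D) (black := black) ∅)
  let F : D.Circle (D.ofBlack black ∅) → Quotient (D.taitSetoid black ∅) :=
    Quot.lift (Quotient.mk _) fun a b hab => Quotient.sound (by
      change D.TaitConn black ∅ _ _
      rw [(e a b).1 (Quot.sound hab)]
      exact TaitConn.refl _ _)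
  refine (Nat.card_congr (Equiv.ofBijective F ⟨?_, ?_⟩)).symm
  · rintro ⟨a⟩ ⟨b⟩ hab
    exact (e a b).2 (taitConn_empty (Quotient.exact hab))
  · rintro ⟨a⟩
    exact ⟨D.circle _ a, rfl⟩

section Defect

variable [Fintype X]

/-- Twice the genus of the spanning subgraph `S`, up to a constant: twice the number of components,
plus the number of edges, minus the number of boundary circles. -/
noncomputable def defect (D : CrossingData X A) (black : D.Face → Prop) (S : Finset X) : ℤ :=
  2 * D.taitComponents black S + S.card - Nat.card (D.Circle (D.ofBlack black S))

theorem flips_ofBlack_insert [DecidableEq X] {S : Finset X} {e : X} (he : e ∉ S) :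
    Flips e (D.ofBlack black S) (D.ofBlack black (insert e S : Finset X)) := by
  refine flips_of_blackSet (black := black) fun f => ?_
  rw [blackSet_ofBlack, blackSet_ofBlack]
  by_cases hf : f = e
  · subst hf; simp [he]
  · simp [hf]

variable [Finite A] [DecidableEq X]

/-- The defect does not decrease when an edge is added, and it increases if the edge joins two
boundary circles of one component. -/
theorem HasSurgery.defect_insert (hs : D.HasSurgery) (h : D.IsCheckerboard black) {S : Finset X}
    {e : X} (he : e ∉ S) :
    D.defect black S ≤ D.defect black (insert e S) ∧
    (D.EndsConn black S e → D.circle (D.ofBlack black S) (D.slot e 0) ≠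
      D.circle (D.ofBlack black S) (D.slot e 2) →
      D.defect black S < D.defect black (insert e S)) := by
  have hcard := hs.card_circle_flips (flips_ofBlack_insert (D := D) (black := black) he)
  have hS : ((insert e S).card : ℤ) = S.card + 1 := by
    rw [Finset.card_insert_of_notMem he]; push_cast; ring
  have hcoe : ((insert e S : Finset X) : Set X) = insert e (S : Set X) := Finset.coe_insert e S
  by_cases hc : D.EndsConn black S e
  · have hr : D.taitComponents black (insert e S : Finset X) = D.taitComponents black S := by
      rw [hcoe, taitComponents_insert_of_endsConn hc]
    simp only [defect, hr, hS, hcard]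
    constructor
    · split_ifs <;> omega
    · intro _ hne
      rw [if_pos hne]
      omega
  · have hr := h.taitComponents_insert_of_not_endsConn hc
    rw [← hcoe] at hr
    have hne : D.circle (D.ofBlack black S) (D.slot e 0) ≠
        D.circle (D.ofBlack black S) (D.slot e 2) := by
      intro hne
      have := h.taitConn_of_circle_eq hne
      rw [blackSet_ofBlack] at this
      exact hc (h.endsConn_iff.2 this)
    simp only [defect, hr, hS, hcard, if_pos hne]
    exact ⟨by push_cast; omega, fun hc' => absurd hc' hc⟩

theorem HasSurgery.defect_mono (hs : D.HasSurgery) (h : D.IsCheckerboard black) {S S' : Finset X}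
    (hS : S ⊆ S') : D.defect black S ≤ D.defect black S' := by
  have key : ∀ U : Finset X, D.defect black S ≤ D.defect black (S ∪ U) := by
    intro U
    induction U using Finset.induction_on with
    | empty => simp
    | insert e U _ ih =>
      rw [Finset.union_insert]
      by_cases he : e ∈ S ∪ U
      · rwa [Finset.insert_eq_of_mem he]
      · exact ih.trans (hs.defect_insert h he).1
  have := key S'
  rwa [Finset.union_eq_right.2 hS] at this

end Defect

/-- In a connected diagram the Tait graph is connected. -/
theorem IsCheckerboard.taitConn_univ (h : D.IsCheckerboard black) (hc : D.Connected) (a b : A) :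
    D.TaitConn black Set.univ (D.blackFace black a) (D.blackFace black b) := by
  have := (Nat.card_eq_one_iff_unique.1 hc).1
  have hab : (Quot.mk _ a : D.Component) = Quot.mk _ b := Subsingleton.elim _ _
  replace hab := Quot.eqvGen_exact hab
  induction hab with
  | rel a b hab =>
    obtain ⟨e, k, l, rfl, rfl⟩ := hab
    have h02 : D.TaitConn black Set.univ (D.blackFace black (D.slot e 0))
        (D.blackFace black (D.slot e 2)) := h.endsConn_iff.1 (endsConn_of_mem (Set.mem_univ e))
    have key : ∀ k, D.TaitConn black Set.univ (D.blackFace black (D.slot e 0))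
        (D.blackFace black (D.slot e k)) := by
      intro k
      by_cases hp : D.PosEdge black e
      · obtain ⟨h0, h1, h2, h3⟩ := h.blackFace_of_posEdge hp
        fin_cases k
        · exact TaitConn.refl _ _
        · change D.TaitConn black _ _ (D.blackFace black (D.slot e 1))
          rw [h1, ← h2]; exact h02
        · exact h02
        · change D.TaitConn black _ _ (D.blackFace black (D.slot e 3))
          rw [h3, ← h0]; exact TaitConn.refl _ _
      · obtain ⟨h0, h1, h2, h3⟩ := h.blackFace_of_not_posEdge hp
        fin_cases k
        · exact TaitConn.refl _ _
        · change D.TaitConn black _ _ (D.blackFace black (D.slot e 1))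
          rw [h1, ← h0]; exact TaitConn.refl _ _
        · exact h02
        · change D.TaitConn black _ _ (D.blackFace black (D.slot e 3))
          rw [h3, ← h2]; exact h02
    exact (key k).symm.trans (key l)
  | refl a => exact TaitConn.refl _ _
  | symm a b _ ih => exact ih.symm
  | trans a b c _ _ ih ih' => exact ih.trans ih'

end CrossingData

namespace LinkDiagram

open CrossingData

variable {X A : Type*} [Fintype X] [Finite A] {L : LinkDiagram X A} {black : L.Face → Prop}

/-- By Euler's formula, the defect of the whole Tait graph is that of its empty subgraph. -/
theorem defect_univ (hL : L.Connected) (h : L.IsCheckerboard black) :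
    L.defect black Finset.univ = L.defect black ∅ := by
  have hF := h.card_face (blackSet_ofBlack (D := L.toCrossingData) (black := black) ∅)
    (blackSet_ofBlack (D := L.toCrossingData) (black := black) Set.univ)
  have hne : Nonempty A := by
    obtain ⟨⟨a⟩⟩ := (Nat.card_eq_one_iff_unique.1 hL).2
    exact ⟨a⟩
  have h1 : L.taitComponents black Set.univ = 1 := by
    refine Nat.card_eq_one_iff_unique.2 ⟨⟨?_⟩, hne.map (Quotient.mk _)⟩
    rintro ⟨a⟩ ⟨b⟩
    exact Quotient.sound (h.taitConn_univ hL a b)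
  have h2 := L.planar
  rw [show Nat.card L.Component = 1 from hL, hF] at h2
  have h3 := h.taitComponents_empty
  simp only [defect, Finset.coe_univ, Finset.coe_empty, h1, h3, Finset.card_univ,
    Finset.card_empty]
  rw [Nat.card_eq_fintype_card (α := X)] at h2
  omega

/-- In a planar diagram, adding an edge to a spanning subgraph splits a circle iff the ends of the
edge are already connected. -/
theorem circle_eq_iff_endsConn (hL : L.Connected) (h : L.IsCheckerboard black) {σ : Finset X}
    {e : X} (he : e ∉ L.blackSet black σ) :
    L.circle σ (L.slot e 0) = L.circle σ (L.slot e 2) ↔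
      L.EndsConn black (L.blackSet black σ) e := by
  classical
  have hs := hasSurgery h
  refine ⟨fun hab => h.endsConn_iff.2 (h.taitConn_of_circle_eq hab), fun hc => ?_⟩
  by_contra hne
  obtain ⟨S, hS⟩ : ∃ S : Finset X, (S : Set X) = L.blackSet black σ :=
    ⟨(Set.toFinite (L.blackSet black σ)).toFinset, Set.Finite.coe_toFinset _⟩
  have hσ : L.ofBlack black S = σ := by rw [hS, ofBlack_blackSet]
  rw [← hS] at hc he
  have h1 := (hs.defect_insert h (fun h' => he (Finset.mem_coe.2 h'))).2 hc (by rwa [hσ])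
  have h2 := hs.defect_mono h (Finset.empty_subset S)
  have h3 := hs.defect_mono h (Finset.subset_univ (insert e S))
  rw [defect_univ hL h] at h3
  omega

end LinkDiagram

/-! ### Spanning trees and their twisted unknots -/

/-- An element outside a basis is in the fundamental circuit of the elements that it can be
exchanged for. -/
theorem IsMatroidClosure.mem_cl_iff_exchangeable {X : Type*} {cl : Set X → Set X}
    (h : IsMatroidClosure cl) {T : Set X} (hT : IsClosureBasis cl T) {f g : X} (hf : f ∈ T)
    (hg : g ∉ T) : f ∈ cl ((T ∪ {g}) \ {f}) ↔ Exchangeable cl T f g := by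
  have h1 : (T ∪ {g}) \ {f} = insert g (T \ {f}) := by
    ext x
    simp only [Set.mem_sdiff, Set.mem_union, Set.mem_singleton_iff, Set.mem_insert_iff]
    constructor
    · tauto
    · rintro (rfl | hx)
      · exact ⟨Or.inr rfl, fun h' => hg (h' ▸ hf)⟩
      · tauto
  have h2 : insert f (T \ {f}) = T := by
    ext x
    by_cases hx : x = f <;> simp [hx, hf]
  rw [h1]
  constructor
  · intro h3 h4
    exact hT.indep f hf (h.mem_cl_of_subset_cl h3 (Set.insert_subset h4 (h.subset _)))
  · intro h3
    exact h.exchange (by rw [h2]; exact hT.spans g) h3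

namespace CrossingData

variable {X A : Type*} {D : CrossingData X A} {black : D.Face → Prop}

theorem IsCheckerboard.isSpanningTree_iff (h : D.IsCheckerboard black) (hc : D.Connected)
    {T : Finset X} :
    D.IsSpanningTree black T ↔ IsClosureBasis (D.taitClosure black) (T : Set X) := by
  constructor
  · rintro ⟨h1, h2⟩
    exact ⟨fun e => h.endsConn_iff.2 (h1 _ _ (h.black_blackFace _) (h.black_blackFace _)), h2⟩
  · rintro ⟨h1, h2⟩
    refine ⟨fun u v hu hv => ?_, h2⟩
    obtain ⟨a, rfl⟩ := h.exists_blackFace_eq hu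
    obtain ⟨b, rfl⟩ := h.exists_blackFace_eq hv
    exact (h.taitConn_univ hc a b).of_subset_endsConn fun e _ => h1 e

section

variable [LinearOrder X]

theorem IsCheckerboard.live_iff (h : D.IsCheckerboard black) {T : Finset X}
    (hT : IsClosureBasis (D.taitClosure black) (T : Set X)) (e : X) :
    D.Live black T e ↔ ActiveFor (D.taitClosure black) T e := by
  refine or_congr (and_congr_right fun he => ?_) (and_congr_right fun he => ?_)
  · constructor
    · intro h1 g _ hg
      exact h1 g hg
    · intro h1 g hg
      by_cases hgT : g ∈ T
      · by_cases hge : g = e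
        · exact hge.ge
        · exact absurd (h.isMatroidClosure.subset ((T : Set X) \ {e}) ⟨hgT, hge⟩) hg
      · exact h1 g hgT hg
  · constructor
    · intro h1 f hf hfe
      exact h1 f ⟨Or.inl hf, (h.isMatroidClosure.mem_cl_iff_exchangeable hT hf he).2 hfe⟩
    · rintro h1 f ⟨hf | rfl, hfe⟩
      · exact h1 f hf ((h.isMatroidClosure.mem_cl_iff_exchangeable hT hf he).1 hfe)
      · exact le_rfl

variable [Fintype X]

theorem mem_blackSet_treeState {T : Finset X} {e : X} :
    e ∈ D.blackSet black (D.treeState black T) ↔ ¬ (e ∈ T ↔ D.Live black T e) := by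
  simp only [mem_blackSet, treeState, Finset.mem_filter, Finset.mem_univ, true_and]
  split_ifs <;> tauto

theorem IsCheckerboard.inUnknot_iff (h : D.IsCheckerboard black) {T : Finset X}
    (hT : IsClosureBasis (D.taitClosure black) (T : Set X)) {s : D.Enhanced} :
    D.InUnknot black T s ↔ InInterval (D.taitClosure black) T (D.blackSet black s.1) := by
  refine forall_congr' fun e => ?_
  rw [h.live_iff hT]
  refine imp_congr_right fun he => ?_
  rw [← h.live_iff hT] at he
  rw [mem_iff_of_blackSet (black := black), mem_blackSet_treeState, Finset.mem_coe]
  tauto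

/-- The states that agree with `c` outside the finite set `R` of crossings form the cube of a
twisted unknot whose graph is a tree: every crossing of `R` that is smoothed as in `c` merges two
circles, and the state that differs from `c` at all of `R` consists of a single circle. -/
structure IsTwistTree (D : CrossingData X A) (c R : Finset X) : Prop where
  surgery : D.HasSurgery
  merge : ∀ σ : Finset X, (∀ f ∉ R, f ∈ σ ↔ f ∈ c) → ∀ e ∈ R, (e ∈ σ ↔ e ∈ c) →
    D.circle σ (D.slot e 0) ≠ D.circle σ (D.slot e 2)
  connected : ∀ σ : Finset X, (∀ f, (f ∈ σ ↔ f ∈ c) ↔ f ∉ R) → ∀ a b, D.circle σ a = D.circle σ b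

theorem mem_liveEdges {T : Finset X} {e : X} :
    e ∈ D.liveEdges black T ↔ D.Live black T e := by
  simp [liveEdges]

end

end CrossingData

namespace LinkDiagram

open CrossingData

variable {X A : Type*} [Fintype X] [LinearOrder X] {L : LinkDiagram X A}
  {black : L.Face → Prop}

/-- An edge of a spanning subgraph separates two circles iff its ends are connected by the other
edges. -/
theorem circle_ne_iff_endsConn_sdiff [Finite A] (hL : L.Connected) (h : L.IsCheckerboard black)
    {σ : Finset X} {e : X} (he : e ∈ L.blackSet black σ) :
    L.circle σ (L.slot e 0) ≠ L.circle σ (L.slot e 2) ↔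
      L.EndsConn black (L.blackSet black σ \ {e}) e := by
  have hb := blackSet_ofBlack (D := L.toCrossingData) (black := black) (L.blackSet black σ \ {e})
  have hf : Flips e (L.ofBlack black (L.blackSet black σ \ {e})) σ := by
    refine flips_of_blackSet (black := black) fun f => ?_
    rw [hb]
    by_cases hfe : f = e
    · subst hfe; simp [he]
    · simp [hfe]
  rw [← hb, ← circle_eq_iff_endsConn hL h (by rw [hb]; simp), (hasSurgery h).eq_iff_ne hf]

theorem isTwistTree [Finite A] (hL : L.Connected) (h : L.IsCheckerboard black) {T : Finset X}
    (hT : L.IsSpanningTree black T) :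
    L.IsTwistTree (L.treeState black T) (L.liveEdges black T) := by
  rw [h.isSpanningTree_iff hL] at hT
  have hcl := h.isMatroidClosure
  refine ⟨hasSurgery h, ?_, ?_⟩
  · intro σ hσ e he heσ
    have hint : InInterval (L.taitClosure black) T (L.blackSet black σ) := by
      have := (h.inUnknot_iff hT (s := ⟨σ, fun _ => Label.one⟩)).1 fun f hf =>
        hσ f (by rwa [mem_liveEdges])
      exact this
    rw [mem_liveEdges] at he
    rw [mem_iff_of_blackSet (black := black), mem_blackSet_treeState] at heσ
    have hact := (h.live_iff hT e).1 he
    by_cases heT : e ∈ T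
    · have heH : e ∉ L.blackSet black σ := by tauto
      rw [ne_eq, circle_eq_iff_endsConn hL h heH]
      intro hc
      obtain ⟨g, hg, rfl | ⟨hgT, hge⟩⟩ := hcl.exists_exchangeable hT heT hc
      · exact heH hg
      · have h1 := IsMatroidClosure.inInterval_le_left hint heT heH hgT hge
        have h2 := IsMatroidClosure.inInterval_le_right hint heT hg hgT hge
        exact hgT (le_antisymm h1 h2 ▸ heT)
    · have heH : e ∈ L.blackSet black σ := by tauto
      rw [circle_ne_iff_endsConn_sdiff hL h heH]
      refine hcl.mono ?_ (hcl.mem_cl_setOf_exchangeable hT e)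
      rintro f ⟨hf, hfe⟩
      have h2 : f ≠ e := fun h' => heT (h' ▸ hf)
      refine ⟨?_, h2⟩
      by_contra hfH
      have h3 := IsMatroidClosure.inInterval_le_right hint hf heH heT hfe
      exact h2 (le_antisymm (IsMatroidClosure.inInterval_le_left hint hf hfH heT hfe) h3)
  · intro σ hσ a b
    have hblack : L.blackSet black σ = T := by
      ext e
      have := hσ e
      rw [mem_iff_of_blackSet (black := black), mem_blackSet_treeState, mem_liveEdges] at this
      rw [Finset.mem_coe]
      tauto
    have h02 : ∀ e, L.circle σ (L.slot e 0) = L.circle σ (L.slot e 2) := by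
      intro e
      by_cases he : e ∈ T
      · by_contra hne
        have h1 := (circle_ne_iff_endsConn_sdiff hL h (by rw [hblack]; exact he)).1 hne
        rw [hblack] at h1
        exact hT.indep e he h1
      · rw [circle_eq_iff_endsConn hL h (by rw [hblack]; exact he), hblack]
        exact hT.spans e
    have hall : ∀ e k, L.circle σ (L.slot e k) = L.circle σ (L.slot e 0) := by
      intro e k
      by_cases he : e ∈ σ
      · have h1 := L.circle_of_mem he
        fin_cases k
        exacts [rfl, h1.1.trans (h02 e).symm, (h02 e).symm, h1.2]
      · have h1 := L.circle_of_notMem he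
        fin_cases k
        exacts [rfl, h1.1.symm, (h02 e).symm, h1.2.symm.trans (h02 e).symm]
    have := (Nat.card_eq_one_iff_unique.1 hL).1
    have hab : (Quot.mk _ a : L.Component) = Quot.mk _ b := Subsingleton.elim _ _
    replace hab := Quot.eqvGen_exact hab
    induction hab with
    | rel a b hab =>
      obtain ⟨e, k, l, rfl, rfl⟩ := hab
      rw [hall e k, hall e l]
    | refl a => rfl
    | symm a b _ ih => exact ih.symm
    | trans a b c _ _ ih ih' => exact ih.trans ih'

/-- Every enhanced state belongs to the twisted unknot of a spanning tree. -/
theorem exists_inUnknot (hL : L.Connected) (h : L.IsCheckerboard black) (s : L.Enhanced) :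
    ∃ T, L.IsSpanningTree black T ∧ L.InUnknot black T s := by
  obtain ⟨T, hT, hint⟩ := h.isMatroidClosure.exists_basis_inInterval (L.blackSet black s.1)
  have hcoe : (((Set.toFinite T).toFinset : Finset X) : Set X) = T := Set.Finite.coe_toFinset _
  refine ⟨(Set.toFinite T).toFinset, (h.isSpanningTree_iff hL).2 (by rwa [hcoe]), ?_⟩
  rw [h.inUnknot_iff (by rwa [hcoe]), hcoe]
  exact hint

theorem eq_of_inUnknot (hL : L.Connected) (h : L.IsCheckerboard black) {s : L.Enhanced}
    {T T' : Finset X} (hT : L.IsSpanningTree black T) (hT' : L.IsSpanningTree black T')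
    (hs : L.InUnknot black T s) (hs' : L.InUnknot black T' s) : T = T' := by
  rw [h.isSpanningTree_iff hL] at hT hT'
  rw [h.inUnknot_iff hT] at hs
  rw [h.inUnknot_iff hT'] at hs'
  exact Finset.coe_injective (h.isMatroidClosure.eq_of_inInterval hT hT' hs hs')

/-- The dead `B`-smoothed edges of a spanning tree. -/
noncomputable def deadB (L : LinkDiagram X A) (black : L.Face → Prop) (T : Finset X) : Finset X :=
  L.treeState black T \ L.liveEdges black T

/-- The differential either stays in the twisted unknot of a spanning tree or enters that of a tree
whose set of dead `B`-smoothed edges is larger in the colexicographic order: the larger edges have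
the same activities and smoothings, and the changed edge is dead for both trees. -/
theorem eq_or_deadB_lt (hL : L.Connected) (h : L.IsCheckerboard black) {s t : L.Enhanced}
    {T T' : Finset X} (hT : L.IsSpanningTree black T) (hT' : L.IsSpanningTree black T')
    (hs : L.InUnknot black T s) (ht : L.InUnknot black T' t) {e : X} (he : e ∉ s.1)
    (hst : t.1 = insert e s.1) :
    T = T' ∨ toColex (deadB L black T) < toColex (deadB L black T') := by
  have hB := (h.isSpanningTree_iff hL).1 hT
  have hB' := (h.isSpanningTree_iff hL).1 hT'
  have hI := (h.inUnknot_iff hB).1 hs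
  have hI' := (h.inUnknot_iff hB').1 ht
  have hcl := h.isMatroidClosure
  have hlive : ∀ f, e ≤ f → (L.Live black T f ↔ L.Live black T' f) := by
    intro f hf
    rw [h.live_iff hB, h.live_iff hB', hcl.activeFor_iff_of_inInterval hB hI,
      hcl.activeFor_iff_of_inInterval hB' hI']
    have : L.blackSet black s.1 ∩ Set.Ioi f = L.blackSet black t.1 ∩ Set.Ioi f := by
      ext g
      refine and_congr_left fun hg => mem_iff_of_blackSet.1 ?_
      rw [hst, Finset.mem_insert]
      have : g ≠ e := (hf.trans_lt hg).ne'
      tauto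
    rw [this]
  by_cases hlv : L.Live black T e
  · left
    refine eq_of_inUnknot hL h hT hT' (s := t) (fun f hf => ?_) ht
    rw [← hs f hf, hst, Finset.mem_insert]
    have : f ≠ e := fun h' => hf (h' ▸ hlv)
    tauto
  · right
    have hlv' : ¬ L.Live black T' e := mt (hlive e le_rfl).2 hlv
    rw [Finset.Colex.toColex_lt_toColex_iff_exists_forall_lt]
    have hmem : ∀ f, f ∈ deadB L black T ↔ (f ∈ s.1 ∧ ¬ L.Live black T f) := by
      intro f
      rw [deadB, Finset.mem_sdiff, mem_liveEdges]
      exact and_congr_left fun hf => (hs f hf).symm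
    have hmem' : ∀ f, f ∈ deadB L black T' ↔ (f ∈ t.1 ∧ ¬ L.Live black T' f) := by
      intro f
      rw [deadB, Finset.mem_sdiff, mem_liveEdges]
      exact and_congr_left fun hf => (ht f hf).symm
    refine ⟨e, (hmem' e).2 ⟨by rw [hst]; exact Finset.mem_insert_self _ _, hlv'⟩,
      fun h' => he ((hmem e).1 h').1, fun f hf hfn => ?_⟩
    by_contra! hle
    rw [hmem] at hf
    refine hfn ((hmem' f).2 ⟨?_, mt (hlive f hle).2 hf.2⟩)
    rw [hst]
    exact Finset.mem_insert_of_mem hf.1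

end LinkDiagram

/-! ### The tree of a twisted unknot -/

/-- A cycle along which `f` is constant or increases (measured by `g`) lies in one fiber of `f`. -/
theorem Relation.TransGen.of_monotone {α β γ : Type*} [Preorder γ] {r : α → α → Prop}
    (f : α → β) (g : β → γ) (h : ∀ x y, r x y → f x = f y ∨ g (f x) < g (f y)) {a : α}
    (ha : Relation.TransGen r a a) :
    Relation.TransGen (fun x y => r x y ∧ f x = f a ∧ f y = f a) a a := by
  have key : ∀ b, Relation.TransGen r a b →
      (f b = f a ∧ Relation.TransGen (fun x y => r x y ∧ f x = f a ∧ f y = f a) a b) ∨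
        g (f a) < g (f b) := by
    intro b hb
    induction hb with
    | single hab =>
      rcases h _ _ hab with h1 | h1
      · exact Or.inl ⟨h1.symm, .single ⟨hab, rfl, h1.symm⟩⟩
      · exact Or.inr h1
    | tail _ hbc ih =>
      rcases h _ _ hbc with h1 | h1 <;> rcases ih with ⟨h2, h3⟩ | h2
      · exact Or.inl ⟨h1 ▸ h2, h3.tail ⟨hbc, h2, h1 ▸ h2⟩⟩
      · exact Or.inr (h1 ▸ h2)
      · exact Or.inr (h2 ▸ h1)
      · exact Or.inr (h2.trans h1)
  rcases key a ha with h1 | h1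
  · exact h1.2
  · exact absurd h1 (lt_irrefl _)

theorem Finset.induction_on_superset {α : Type*} [DecidableEq α] {p : Finset α → Prop}
    {s t : Finset α} (hst : s ⊆ t) (base : p s)
    (step : ∀ e u, s ⊆ u → u ⊆ t → e ∈ t → e ∉ u → p u → p (insert e u)) : p t := by
  have key : ∀ l, l ⊆ t → p (s ∪ l) := by
    intro l
    induction l using Finset.induction_on with
    | empty => intro _; rwa [Finset.union_empty]
    | insert e l _ ih =>
      intro hl
      obtain ⟨he, hl⟩ := Finset.insert_subset_iff.1 hl
      rw [Finset.union_insert]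
      by_cases hes : e ∈ s ∪ l
      · rw [Finset.insert_eq_of_mem hes]
        exact ih hl
      · exact step e _ Finset.subset_union_left (Finset.union_subset hst hl) he hes (ih hl)
  have := key t subset_rfl
  rwa [Finset.union_eq_right.2 hst] at this

namespace CrossingData

variable {X A : Type*} {D : CrossingData X A} [LinearOrder X] {c R₀ : Finset X}

theorem mem_symmDiff_iff {J : Finset X} {e : X} : (e ∈ symmDiff c J ↔ e ∈ c) ↔ e ∉ J := by
  rw [Finset.mem_symmDiff]; tauto

theorem flips_symmDiff_insert {J : Finset X} {e : X} (he : e ∉ J) :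
    Flips e (symmDiff c J) (symmDiff c (insert e J)) := by
  intro f
  rw [Finset.mem_symmDiff, Finset.mem_symmDiff, Finset.mem_insert]
  by_cases hf : f = e
  · subst hf; tauto
  · tauto

/-- The state `σ` agrees with `c` outside `R`. -/
def AgreesOff (c R σ : Finset X) : Prop := ∀ f ∉ R, f ∈ σ ↔ f ∈ c

theorem AgreesOff.symmDiff_subset {R σ : Finset X} (h : AgreesOff c R σ) : symmDiff c σ ⊆ R := by
  intro f hf
  by_contra hR
  have := h f hR
  rw [Finset.mem_symmDiff] at hf
  tauto

theorem agreesOff_symmDiff {J R : Finset X} (h : J ⊆ R) : AgreesOff c R (symmDiff c J) :=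
  fun _ hf => mem_symmDiff_iff.2 fun h' => hf (h h')

theorem mem_symmDiff_left {σ : Finset X} {f : X} : f ∈ symmDiff c σ ↔ ¬ (f ∈ σ ↔ f ∈ c) := by
  rw [Finset.mem_symmDiff]; tauto

namespace IsTwistTree

theorem merge_symmDiff (ht : D.IsTwistTree c R₀) {J : Finset X} (hJ : J ⊆ R₀) {e : X}
    (he : e ∈ R₀) (heJ : e ∉ J) :
    D.circle (symmDiff c J) (D.slot e 0) ≠ D.circle (symmDiff c J) (D.slot e 2) :=
  ht.merge _ (agreesOff_symmDiff hJ) e he (mem_symmDiff_iff.2 heJ)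

theorem joined_symmDiff (ht : D.IsTwistTree c R₀) {J : Finset X} (hJ : J ⊆ R₀) {e : X}
    (he : e ∈ J) :
    D.circle (symmDiff c J) (D.slot e 0) = D.circle (symmDiff c J) (D.slot e 2) := by
  have h := ht.surgery.merged (flips_symmDiff_insert (c := c) (Finset.notMem_erase e J))
    (ht.merge_symmDiff ((Finset.erase_subset e J).trans hJ) (hJ he) (Finset.notMem_erase e J))
  rwa [Finset.insert_erase he] at h

/-- Adding edges to a spanning subgraph of the tree only merges components. -/
theorem mono_symmDiff (ht : D.IsTwistTree c R₀) {J K : Finset X} (hJK : J ⊆ K) (hK : K ⊆ R₀)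
    {a b : A} (h : D.circle (symmDiff c J) a = D.circle (symmDiff c J) b) :
    D.circle (symmDiff c K) a = D.circle (symmDiff c K) b := by
  refine Finset.induction_on_superset
    (p := fun K => D.circle (symmDiff c K) a = D.circle (symmDiff c K) b) hJK h
    fun e u _ hu he heu ih => ?_
  exact ht.surgery.circle_mono (flips_symmDiff_insert heu)
    (ht.merge_symmDiff (hu.trans hK) (hK he) heu) ih

/-- A component that meets none of the added edges does not change. -/
theorem isolated_symmDiff (ht : D.IsTwistTree c R₀) {J K : Finset X} (hJK : J ⊆ K) (hK : K ⊆ R₀)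
    {a : A} (h : ∀ f ∈ K, f ∉ J →
      D.circle (symmDiff c J) (D.slot f 0) ≠ D.circle (symmDiff c J) a ∧
      D.circle (symmDiff c J) (D.slot f 2) ≠ D.circle (symmDiff c J) a) (b : A) :
    D.circle (symmDiff c K) b = D.circle (symmDiff c K) a ↔
      D.circle (symmDiff c J) b = D.circle (symmDiff c J) a := by
  refine Finset.induction_on_superset (p := fun K => ∀ b, D.circle (symmDiff c K) b =
    D.circle (symmDiff c K) a ↔ D.circle (symmDiff c J) b = D.circle (symmDiff c J) a) hJK
    (fun _ => Iff.rfl) (fun e u hJu hu he heu ih b => ?_) b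
  have h1 := h e he fun h' => heu (hJu h')
  rw [ht.surgery.circle_eq_of_ne (flips_symmDiff_insert heu)
    (ht.merge_symmDiff (hu.trans hK) (hK he) heu) (fun h' => h1.1 ((ih _).1 h'.symm))
    (fun h' => h1.2 ((ih _).1 h'.symm)), ih]

theorem mono (ht : D.IsTwistTree c R₀) {σ τ : Finset X}
    (hτ : AgreesOff c R₀ τ) (hστ : ∀ f, ¬ (f ∈ σ ↔ f ∈ c) → ¬ (f ∈ τ ↔ f ∈ c)) {a b : A}
    (h : D.circle σ a = D.circle σ b) : D.circle τ a = D.circle τ b := by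
  have := ht.mono_symmDiff (J := symmDiff c σ) (K := symmDiff c τ) (a := a) (b := b)
    (fun f hf => mem_symmDiff_left.2 (hστ f (mem_symmDiff_left.1 hf))) hτ.symmDiff_subset
  rw [symmDiff_symmDiff_cancel_left, symmDiff_symmDiff_cancel_left] at this
  exact this h

/-- The circles of `c` are contained in those of the other states of the twisted unknot. -/
theorem circle_eq_of_base (ht : D.IsTwistTree c R₀) {σ : Finset X}
    (hσ : AgreesOff c R₀ σ) {a b : A}
    (h : D.circle c a = D.circle c b) : D.circle σ a = D.circle σ b :=
  ht.mono hσ (fun _ hf => absurd Iff.rfl hf) h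

/-- An isolated vertex of a spanning subgraph is a circle of the corresponding state. -/
theorem isolated (ht : D.IsTwistTree c R₀) {σ : Finset X} (hσ : AgreesOff c R₀ σ)
    {v : D.Circle c} (hv : ∀ f, ¬ (f ∈ σ ↔ f ∈ c) → ¬ D.Incident c f v) {a : A}
    (ha : D.circle c a = v) (b : A) :
    D.circle σ b = D.circle σ a ↔ D.circle c b = v := by
  have := ht.isolated_symmDiff (J := ∅) (K := symmDiff c σ) (a := a) (Finset.empty_subset _)
    hσ.symmDiff_subset
  rw [symmDiff_symmDiff_cancel_left, ← Finset.bot_eq_empty, symmDiff_bot, ha] at this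
  refine this (fun f hf _ => ?_) b
  have := hv f (mem_symmDiff_left.1 hf)
  rw [Incident] at this
  tauto

end IsTwistTree

/-- The edges of `R` form a subtree that contains the root, if `R` is not empty. -/
def RootConn (D : CrossingData X A) (c : Finset X) (dot : A) (R : Finset X) : Prop :=
  ∀ e ∈ R, D.circle (symmDiff c R) (D.slot e 0) = D.circle (symmDiff c R) dot

/-- The two ends of a leaf: `q` is an arc on its vertex, and `p` one on its other vertex. -/
def LeafEnds (D : CrossingData X A) (c : Finset X) (e : X) (v : D.Circle c) (q p : A) : Prop :=
  (q = D.slot e 0 ∧ p = D.slot e 2 ∨ q = D.slot e 2 ∧ p = D.slot e 0) ∧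
    D.circle c q = v ∧ D.circle c p ≠ v

namespace IsTwistTree

variable {dot : A}

theorem rootConn (ht : D.IsTwistTree c R₀) : D.RootConn c dot R₀ := fun _ _ =>
  ht.connected _ (fun _ => mem_symmDiff_iff) _ _

theorem exists_leafEnds (ht : D.IsTwistTree c R₀) {e : X} (he : e ∈ R₀) {v : D.Circle c}
    (hv : D.Incident c e v) : ∃ q p, D.LeafEnds c e v q p := by
  have h := ht.merge_symmDiff (Finset.empty_subset _) he (Finset.notMem_empty e)
  rw [← Finset.bot_eq_empty, symmDiff_bot] at h
  rcases hv with rfl | rfl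
  · exact ⟨_, _, Or.inl ⟨rfl, rfl⟩, rfl, h.symm⟩
  · exact ⟨_, _, Or.inr ⟨rfl, rfl⟩, rfl, h⟩

/-- The removal of a leaf does not separate vertices other than that of the leaf. -/
theorem circle_erase (ht : D.IsTwistTree c R₀) {R : Finset X} (hR : R ⊆ R₀) {e : X}
    {v : D.Circle c} (hl : D.IsLeaf c (D.circle c dot) R e v) {a b : A} (ha : D.circle c a ≠ v)
    (hb : D.circle c b ≠ v)
    (h : D.circle (symmDiff c R) a = D.circle (symmDiff c R) b) :
    D.circle (symmDiff c (R.erase e)) a = D.circle (symmDiff c (R.erase e)) b := by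
  have hR' := (Finset.erase_subset e R).trans hR
  have hins := Finset.insert_erase hl.1
  have hfl := flips_symmDiff_insert (c := c) (Finset.notMem_erase e R)
  rw [hins] at hfl
  rw [ht.surgery.merge hfl (ht.merge_symmDiff hR' (hR hl.1) (Finset.notMem_erase e R))] at h
  obtain ⟨q, p, hqp, hq, hp⟩ := ht.exists_leafEnds (hR hl.1) hl.2.2.1
  have hiso : ∀ b, D.circle (symmDiff c (R.erase e)) b = D.circle (symmDiff c (R.erase e)) q ↔
      D.circle c b = v := by
    refine ht.isolated (agreesOff_symmDiff hR') (fun f hf hfv => ?_) hq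
    rw [mem_symmDiff_iff, not_not, Finset.mem_erase] at hf
    exact hf.1 (hl.2.2.2 f hf.2 hfv)
  have ha' := mt (hiso a).1 ha
  have hb' := mt (hiso b).1 hb
  rcases hqp with ⟨rfl, rfl⟩ | ⟨rfl, rfl⟩
  · rcases h with h | ⟨h1, h2⟩
    · exact h
    · exact (h1.resolve_left ha').trans (h2.resolve_left hb').symm
  · rcases h with h | ⟨h1, h2⟩
    · exact h
    · exact (h1.resolve_right ha').trans (h2.resolve_right hb').symm

theorem rootConn_erase (ht : D.IsTwistTree c R₀) {R : Finset X} (hR : R ⊆ R₀)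
    (hc : D.RootConn c dot R) {e : X} {v : D.Circle c}
    (hl : D.IsLeaf c (D.circle c dot) R e v) : D.RootConn c dot (R.erase e) := by
  intro f hf
  rw [Finset.mem_erase] at hf
  exact ht.circle_erase hR hl (fun h' => hf.1 (hl.2.2.2 f hf.2 (Or.inl h'.symm)))
    (Ne.symm hl.2.1) (hc f hf.2)

theorem leaf_unique (ht : D.IsTwistTree c R₀) {R : Finset X} (hR : R ⊆ R₀)
    (hc : D.RootConn c dot R) {e : X} {v w : D.Circle c}
    (hv : D.IsLeaf c (D.circle c dot) R e v) (hw : D.IsLeaf c (D.circle c dot) R e w) :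
    v = w := by
  by_contra hne
  obtain ⟨q, p, hqp, hq, hp⟩ := ht.exists_leafEnds (hR hv.1) hv.2.2.1
  have hpw : D.circle c p = w := by
    have := hw.2.2.1
    rcases hqp with ⟨rfl, rfl⟩ | ⟨rfl, rfl⟩
    · exact (this.resolve_left fun h => hne (hq.symm.trans h.symm)).symm
    · exact (this.resolve_right fun h => hne (hq.symm.trans h.symm)).symm
  -- If both ends of `e` are leaves, then `e` is not connected with the root.
  have h1 : D.circle (symmDiff c R) p = D.circle (symmDiff c R) dot := by
    rcases hqp with ⟨rfl, rfl⟩ | ⟨rfl, rfl⟩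
    · rw [← ht.joined_symmDiff hR hv.1]
      exact hc e hv.1
    · exact hc e hv.1
  have h2 := ht.circle_erase hR hv hp (Ne.symm hv.2.1) h1
  have hR' := (Finset.erase_subset e R).trans hR
  rw [eq_comm, ht.isolated (agreesOff_symmDiff hR') (v := w) (fun f hf hfv => ?_) hpw] at h2
  · exact hw.2.1 h2.symm
  · rw [mem_symmDiff_iff, not_not, Finset.mem_erase] at hf
    exact hf.1 (hw.2.2.2 f hf.2 hfv)

/-- A proper subtree that contains the root can be enlarged by one edge. -/
theorem exists_rootConn_insert (ht : D.IsTwistTree c R₀) {K R : Finset X} (hR : R ⊆ R₀)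
    (hc : D.RootConn c dot R) (hK : D.RootConn c dot K) (hKR : K ⊂ R) :
    ∃ e ∈ R, e ∉ K ∧ D.RootConn c dot (insert e K) ∧
      (D.circle (symmDiff c K) (D.slot e 0) = D.circle (symmDiff c K) dot ∨
        D.circle (symmDiff c K) (D.slot e 2) = D.circle (symmDiff c K) dot) := by
  obtain ⟨e, he, heK, hend⟩ : ∃ e ∈ R, e ∉ K ∧
      (D.circle (symmDiff c K) (D.slot e 0) = D.circle (symmDiff c K) dot ∨
        D.circle (symmDiff c K) (D.slot e 2) = D.circle (symmDiff c K) dot) := by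
    by_contra! hcon
    obtain ⟨e, he, heK⟩ := Finset.exists_of_ssubset hKR
    exact (hcon e he heK).1
      ((ht.isolated_symmDiff hKR.subset hR (fun f hf hfK => hcon f hf hfK) _).1 (hc e he))
  refine ⟨e, he, heK, ?_, hend⟩
  have hsub : insert e K ⊆ R₀ := Finset.insert_subset (hR he) (hKR.subset.trans hR)
  intro f hf
  rcases Finset.mem_insert.1 hf with rfl | hf
  · rcases hend with h | h
    · exact ht.mono_symmDiff (Finset.subset_insert _ _) hsub h
    · rw [ht.joined_symmDiff hsub (Finset.mem_insert_self _ _)]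
      exact ht.mono_symmDiff (Finset.subset_insert _ _) hsub h
  · exact ht.mono_symmDiff (Finset.subset_insert _ _) hsub (hK f hf)

theorem exists_leaf (ht : D.IsTwistTree c R₀) {R : Finset X} (hR : R ⊆ R₀)
    (hc : D.RootConn c dot R) (hne : R.Nonempty) :
    ∃ e v, D.IsLeaf c (D.circle c dot) R e v := by
  classical
  -- The last edge in the growth of the tree from its root is a leaf.
  obtain ⟨K, hKmem, hmax⟩ := (R.powerset.filter fun K => K ≠ R ∧ D.RootConn c dot K).exists_maximal
    ⟨∅, Finset.mem_filter.2 ⟨Finset.empty_mem_powerset R, hne.ne_empty.symm,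
      fun e he => absurd he (Finset.notMem_empty e)⟩⟩
  simp only [Finset.mem_filter, Finset.mem_powerset] at hKmem hmax
  obtain ⟨hKR, hKne, hKc⟩ := hKmem
  have hss : K ⊂ R := Finset.ssubset_iff_subset_ne.2 ⟨hKR, hKne⟩
  obtain ⟨e, he, heK, hins, hend⟩ := ht.exists_rootConn_insert hR hc hKc hss
  have hRe : insert e K = R := by
    by_contra h
    exact heK (hmax ⟨Finset.insert_subset he hKR, h, hins⟩ (Finset.subset_insert e K)
      (Finset.mem_insert_self _ _))
  obtain ⟨q, hqe, hq⟩ : ∃ q, (q = D.slot e 0 ∨ q = D.slot e 2) ∧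
      D.circle (symmDiff c K) q ≠ D.circle (symmDiff c K) dot := by
    have hm := ht.merge_symmDiff (hKR.trans hR) (hR he) heK
    by_cases h0 : D.circle (symmDiff c K) (D.slot e 0) = D.circle (symmDiff c K) dot
    · exact ⟨_, Or.inr rfl, fun h2 => hm (h0.trans h2.symm)⟩
    · exact ⟨_, Or.inl rfl, h0⟩
  have hbase := agreesOff_symmDiff (c := c) (hKR.trans hR)
  refine ⟨e, D.circle c q, he, fun h => hq (ht.circle_eq_of_base hbase h), ?_, ?_⟩
  · rcases hqe with rfl | rfl
    · exact Or.inl rfl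
    · exact Or.inr rfl
  · intro f hf hfq
    rw [← hRe, Finset.mem_insert] at hf
    refine hf.resolve_right fun hfK => hq ?_
    rcases hfq with h | h
    · exact (ht.circle_eq_of_base hbase h).trans (hKc f hfK)
    · refine (ht.circle_eq_of_base hbase h).trans ?_
      rw [← ht.joined_symmDiff (hKR.trans hR) hfK]
      exact hKc f hfK

theorem exists_leastLeaf (ht : D.IsTwistTree c R₀) {R : Finset X} (hR : R ⊆ R₀)
    (hc : D.RootConn c dot R) (hne : R.Nonempty) :
    ∃ e v, D.IsLeastLeaf c (D.circle c dot) R e v := by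
  classical
  obtain ⟨e₀, v₀, h₀⟩ := ht.exists_leaf hR hc hne
  obtain ⟨e, he, hmin⟩ := (R.filter fun e => ∃ v, D.IsLeaf c (D.circle c dot) R e v).exists_minimal
    ⟨e₀, Finset.mem_filter.2 ⟨h₀.1, v₀, h₀⟩⟩
  obtain ⟨-, v, hv⟩ := Finset.mem_filter.1 he
  refine ⟨e, v, hv, fun f w hf => ?_⟩
  by_contra! hlt
  exact hlt.not_ge (hmin (Finset.mem_filter.2 ⟨hf.1, w, hf⟩) hlt.le)

theorem leastLeaf_unique (ht : D.IsTwistTree c R₀) {R : Finset X} (hR : R ⊆ R₀)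
    (hc : D.RootConn c dot R) {e f : X} {v w : D.Circle c}
    (hv : D.IsLeastLeaf c (D.circle c dot) R e v) (hw : D.IsLeastLeaf c (D.circle c dot) R f w) :
    e = f ∧ v = w := by
  obtain rfl : e = f := le_antisymm (hv.2 f w hw.1) (hw.2 e v hv.1)
  exact ⟨rfl, ht.leaf_unique hR hc hv.1 hw.1⟩

/-- Induction along the successive removal of the least leaf. -/
theorem removal_induction (ht : D.IsTwistTree c R₀) {p : Finset X → Prop} (empty : p ∅)
    (step : ∀ R e v, R ⊆ R₀ → D.RootConn c dot R → D.IsLeastLeaf c (D.circle c dot) R e v →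
      p (R.erase e) → p R) : p R₀ := by
  have key : ∀ n, ∀ R : Finset X, R.card = n → R ⊆ R₀ → D.RootConn c dot R → p R := by
    intro n
    induction n with
    | zero =>
      intro R hn _ _
      rwa [Finset.card_eq_zero.1 hn]
    | succ n ih =>
      intro R hn hR hc
      obtain ⟨e, v, hl⟩ := ht.exists_leastLeaf hR hc (Finset.card_pos.1 (by omega))
      refine step R e v hR hc hl (ih _ ?_ ((Finset.erase_subset e R).trans hR)
        (ht.rootConn_erase hR hc hl.1))
      rw [Finset.card_erase_of_mem hl.1.1, hn, Nat.add_sub_cancel]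
  exact key _ R₀ rfl subset_rfl ht.rootConn

end IsTwistTree

end CrossingData

/-! ### The matching of a twisted unknot -/

theorem Flips.eq_insert {X : Type*} [DecidableEq X] {e : X} {σ τ : Finset X} (h : Flips e σ τ)
    (he : e ∉ σ) : τ = insert e σ := by
  ext f
  have := h f
  rw [Finset.mem_insert]
  by_cases hf : f = e
  · subst hf; tauto
  · tauto

theorem Flips.mem_iff {X : Type*} {e : X} {σ τ : Finset X} (h : Flips e σ τ) : e ∈ τ ↔ e ∉ σ := by
  have := h e
  tauto

theorem Label.isMul_one_left (p : Label) : Label.IsMul Label.one p p := by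
  cases p <;> constructor

theorem Label.isMul_one_right (p : Label) : Label.IsMul p Label.one p := by
  cases p <;> constructor

theorem Label.isComul_x_left (p : Label) : Label.IsComul p Label.x p := by
  cases p <;> constructor

theorem Label.isComul_x_right (p : Label) : Label.IsComul p p Label.x := by
  cases p <;> constructor

namespace CrossingData

variable {X A : Type*} {D : CrossingData X A}

theorem khCoeff_ne_zero_iff_flips [Fintype X] [LinearOrder X] {s t : D.Enhanced} :
    D.khCoeff s t ≠ 0 ↔ ∃ e, e ∉ s.1 ∧ Flips e s.1 t.1 ∧ D.Compatible e s t := by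
  rw [khCoeff_ne_zero_iff]
  refine exists_congr fun e => and_congr_right fun he => and_congr_left fun _ => ?_
  exact ⟨fun h => h ▸ flips_insert he, fun h => h.eq_insert he⟩

variable {c R R₀ : Finset X}

theorem AgreesOff.of_flips {e : X} {σ τ : Finset X}
    (hσ : AgreesOff c R σ) (he : e ∈ R) (h : Flips e σ τ) :
    AgreesOff c R τ := fun f hf => by
  rw [← hσ f hf]
  exact ((h f).2 fun h' => hf (h' ▸ he)).symm

/-- A leaf that is not joined merges two circles. -/
theorem IsTwistTree.merge_leaf {e : X} {v : D.Circle c} (ht : D.IsTwistTree c R₀) (hR : R ⊆ R₀)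
    {root : D.Circle c}
    (hl : D.IsLeaf c root R e v) {s : D.Enhanced} (hs : AgreesOff c R s.1)
    (hj : ¬ D.Joined c e s) :
    D.circle s.1 (D.slot e 0) ≠ D.circle s.1 (D.slot e 2) :=
  ht.merge _ (fun f hf => hs f fun h => hf (hR h)) e (hR hl.1) (not_not.1 hj)

theorem IsTwistTree.joined_leaf {e : X} {v : D.Circle c} (ht : D.IsTwistTree c R₀) (hR : R ⊆ R₀)
    {root : D.Circle c}
    (hl : D.IsLeaf c root R e v) {s : D.Enhanced} {τ : Finset X} (hs : AgreesOff c R s.1)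
    (hj : ¬ D.Joined c e s) (hf : Flips e s.1 τ) {q p : A} (hqp : D.LeafEnds c e v q p) :
    D.circle τ q = D.circle τ p := by
  have := ht.surgery.merged hf (ht.merge_leaf hR hl hs hj)
  rcases hqp.1 with ⟨rfl, rfl⟩ | ⟨rfl, rfl⟩
  · exact this
  · exact this.symm

variable [LinearOrder X]

theorem matchLabel_ne_critLabel (c : Finset X) (e : X) : matchLabel c e ≠ critLabel c e := by
  unfold matchLabel critLabel
  split_ifs <;> simp

theorem eq_matchLabel_or_eq_critLabel (c : Finset X) (e : X) (l : Label) :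
    l = matchLabel c e ∨ l = critLabel c e := by
  unfold matchLabel critLabel
  split_ifs <;> cases l <;> simp

theorem Removes.mem {root : D.Circle c} {e : X} {v : D.Circle c} (h : D.Removes c root R e v) :
    e ∈ R ∧ D.Incident c e v ∧ v ≠ root := by
  induction h with
  | here R e v h => exact ⟨h.1.1, h.1.2.2.1, h.1.2.1⟩
  | later R e f v w _ _ ih => exact ⟨Finset.mem_of_mem_erase ih.1, ih.2⟩

/-- The state `t` is obtained from `s` by the removal of the edge `e`, which cuts off the isolated
vertex `v` with label `matchLabel`. -/
structure CutPair (D : CrossingData X A) (c : Finset X) (e : X) (v : D.Circle c)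
    (s t : D.Enhanced) : Prop where
  joined : D.Joined c e s
  not_joined : ¬ D.Joined c e t
  mem_iff : ∀ f, f ≠ e → (f ∈ s.1 ↔ f ∈ t.1)
  label_eq : ∀ a, D.circle c a = v → D.label t a = matchLabel c e
  label_eq_of_ne : ∀ a, D.circle c a ≠ v → D.label t a = D.label s a

/-- The state `s` is left unmatched at the leaf `e` with vertex `v`. -/
structure LeftOver (D : CrossingData X A) (c : Finset X) (e : X) (v : D.Circle c)
    (s : D.Enhanced) : Prop where
  not_joined : ¬ D.Joined c e s
  label_eq : ∀ a, D.circle c a = v → D.label s a = critLabel c e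

/-- The states `s` and `t` are matched with each other, in either direction. -/
def Partners (D : CrossingData X A) (c : Finset X) (root : D.Circle c) (R : Finset X)
    (s t : D.Enhanced) : Prop :=
  D.Paired c root R s t ∨ D.Paired c root R t s

theorem CutPair.flips {e : X} {v : D.Circle c} {s t : D.Enhanced} (h : D.CutPair c e v s t) :
    Flips e s.1 t.1 := by
  intro f
  have h1 := h.joined
  have h2 := h.not_joined
  unfold Joined at h1 h2
  by_cases hf : f = e
  · subst hf; tauto
  · have := h.mem_iff f hf
    tauto

theorem Paired.exists_edge {root : D.Circle c} {s t : D.Enhanced} (h : D.Paired c root R s t) :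
    ∃ e ∈ R, ∀ f, f ≠ e → (f ∈ s.1 ↔ f ∈ t.1) := by
  induction h with
  | here R e v s t hl _ _ h => exact ⟨e, hl.1.1, h⟩
  | later R e v s t _ _ _ _ _ ih =>
    obtain ⟨f, hf, h⟩ := ih
    exact ⟨f, Finset.mem_of_mem_erase hf, h⟩

theorem Partners.agreesOff {root : D.Circle c} {s t : D.Enhanced} (h : D.Partners c root R s t)
    (hs : AgreesOff c R s.1) : AgreesOff c R t.1 := by
  intro f hf
  rw [← hs f hf]
  rcases h with h | h <;> obtain ⟨e, he, h⟩ := h.exists_edge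
  · exact (h f fun h' => hf (h' ▸ he)).symm
  · exact h f fun h' => hf (h' ▸ he)

theorem Paired.label_root {dot : A} {s t : D.Enhanced} (h : D.Paired c (D.circle c dot) R s t) :
    D.label s dot = D.label t dot := by
  induction h with
  | here R e v s t hl _ _ _ _ h => exact (h dot (Ne.symm hl.1.2.1)).symm
  | later R e v s t _ _ _ _ _ ih => exact ih

namespace IsTwistTree

variable {dot : A} {e : X} {v : D.Circle c}

theorem removes_iff (ht : D.IsTwistTree c R₀) (hR : R ⊆ R₀) (hc : D.RootConn c dot R)
    (hl : D.IsLeastLeaf c (D.circle c dot) R e v) {f : X} {w : D.Circle c} :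
    D.Removes c (D.circle c dot) R f w ↔
      (f = e ∧ w = v) ∨ D.Removes c (D.circle c dot) (R.erase e) f w := by
  constructor
  · rintro (⟨_, _, _, h⟩ | ⟨_, e', _, v', _, h, h'⟩)
    · obtain ⟨rfl, rfl⟩ := ht.leastLeaf_unique hR hc hl h
      exact Or.inl ⟨rfl, rfl⟩
    · obtain ⟨rfl, rfl⟩ := ht.leastLeaf_unique hR hc hl h
      exact Or.inr h'
  · rintro (⟨rfl, rfl⟩ | h)
    · exact .here _ _ _ hl
    · exact .later _ _ _ _ _ hl h

theorem paired_iff (ht : D.IsTwistTree c R₀) (hR : R ⊆ R₀) (hc : D.RootConn c dot R)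
    (hl : D.IsLeastLeaf c (D.circle c dot) R e v) {s t : D.Enhanced} :
    D.Paired c (D.circle c dot) R s t ↔ D.CutPair c e v s t ∨
      D.LeftOver c e v s ∧ D.LeftOver c e v t ∧
        D.Paired c (D.circle c dot) (R.erase e) s t := by
  constructor
  · rintro (⟨_, e', v', _, _, h, h1, h2, h3, h4, h5⟩ | ⟨_, e', v', _, _, h, h1, h2, h3, h4⟩)
    · obtain ⟨rfl, rfl⟩ := ht.leastLeaf_unique hR hc hl h
      exact Or.inl ⟨h1, h2, h3, h4, h5⟩
    · obtain ⟨rfl, rfl⟩ := ht.leastLeaf_unique hR hc hl h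
      exact Or.inr ⟨⟨h1, fun a ha => (h3 a ha).1⟩, ⟨h2, fun a ha => (h3 a ha).2⟩, h4⟩
  · rintro (h | ⟨h1, h2, h3⟩)
    · exact .here _ _ _ _ _ hl h.joined h.not_joined h.mem_iff h.label_eq h.label_eq_of_ne
    · exact .later _ _ _ _ _ hl h1.not_joined h2.not_joined
        (fun a ha => ⟨h1.label_eq a ha, h2.label_eq a ha⟩) h3

theorem partners_iff (ht : D.IsTwistTree c R₀) (hR : R ⊆ R₀) (hc : D.RootConn c dot R)
    (hl : D.IsLeastLeaf c (D.circle c dot) R e v) {s t : D.Enhanced} :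
    D.Partners c (D.circle c dot) R s t ↔ D.CutPair c e v s t ∨ D.CutPair c e v t s ∨
      D.LeftOver c e v s ∧ D.LeftOver c e v t ∧
        D.Partners c (D.circle c dot) (R.erase e) s t := by
  unfold Partners
  rw [ht.paired_iff hR hc hl, ht.paired_iff hR hc hl]
  tauto

/-- The vertex of a leaf that is not joined is isolated. -/
theorem isolated_leaf (ht : D.IsTwistTree c R₀) (hR : R ⊆ R₀) {root : D.Circle c}
    (hl : D.IsLeaf c root R e v) {s : D.Enhanced} (hs : AgreesOff c R s.1)
    (hj : ¬ D.Joined c e s) {a : A} (ha : D.circle c a = v) (b : A) :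
    D.circle s.1 b = D.circle s.1 a ↔ D.circle c b = v := by
  refine ht.isolated (fun f hf => hs f fun h => hf (hR h)) (fun f hf hfv => ?_) ha b
  have hfR : f ∈ R := by
    by_contra h
    exact hf (hs f h)
  obtain rfl := hl.2.2.2 f hfR hfv
  exact hj hf

theorem label_eq_of_base (ht : D.IsTwistTree c R₀) (hR : R ⊆ R₀) {s : D.Enhanced}
    (hs : AgreesOff c R s.1) {a b : A} (h : D.circle c a = D.circle c b) :
    D.label s a = D.label s b :=
  label_congr (ht.circle_eq_of_base (fun f hf => hs f fun h => hf (hR h)) h)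

theorem cutPair_right_unique {s t t' : D.Enhanced} (h : D.CutPair c e v s t)
    (h' : D.CutPair c e v s t') : t = t' := by
  refine enhanced_ext ?_ fun a => ?_
  · ext f
    rcases eq_or_ne f e with rfl | hf
    · rw [h.flips.mem_iff, h'.flips.mem_iff]
    · rw [← h.mem_iff f hf, h'.mem_iff f hf]
  · by_cases ha : D.circle c a = v
    · rw [h.label_eq a ha, h'.label_eq a ha]
    · rw [h.label_eq_of_ne a ha, h'.label_eq_of_ne a ha]

theorem cutPair_left_unique (ht : D.IsTwistTree c R₀) (hR : R ⊆ R₀) {root : D.Circle c}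
    (hl : D.IsLeaf c root R e v) {s s' t : D.Enhanced} (hs : AgreesOff c R t.1)
    (h : D.CutPair c e v s t) (h' : D.CutPair c e v s' t) : s = s' := by
  obtain ⟨q, p, hqp⟩ := ht.exists_leafEnds (hR hl.1) hl.2.2.1
  have key : ∀ s, D.CutPair c e v s t → ∀ a, D.circle c a = v → D.label s a = D.label t p := by
    intro s h a ha
    have h1 := hs.of_flips hl.1 h.flips.symm
    rw [ht.label_eq_of_base hR h1 (ha.trans hqp.2.1.symm),
      label_congr (ht.joined_leaf hR hl hs h.not_joined h.flips.symm hqp),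
      h.label_eq_of_ne p hqp.2.2]
  refine enhanced_ext ?_ fun a => ?_
  · ext f
    rcases eq_or_ne f e with rfl | hf
    · rw [h.flips.symm.mem_iff, h'.flips.symm.mem_iff]
    · rw [h.mem_iff f hf, h'.mem_iff f hf]
  · by_cases ha : D.circle c a = v
    · rw [key s h a ha, key s' h' a ha]
    · rw [← h.label_eq_of_ne a ha, h'.label_eq_of_ne a ha]

theorem CutPair.not_leftOver {q p : A} (hqp : D.LeafEnds c e v q p) {s t : D.Enhanced}
    (h : D.CutPair c e v s t) : ¬ D.LeftOver c e v t := fun h' =>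
  matchLabel_ne_critLabel c e ((h.label_eq q hqp.2.1).symm.trans (h'.label_eq q hqp.2.1))

/-- The partner of a state is unique. -/
theorem partners_unique (ht : D.IsTwistTree c R₀) {s : D.Enhanced} (hs : AgreesOff c R₀ s.1)
    {t t' : D.Enhanced} (h : D.Partners c (D.circle c dot) R₀ s t)
    (h' : D.Partners c (D.circle c dot) R₀ s t') : t = t' := by
  revert hs h h'
  refine ht.removal_induction (dot := dot) (p := fun R => AgreesOff c R s.1 →
    D.Partners c (D.circle c dot) R s t → D.Partners c (D.circle c dot) R s t' → t = t') ?_ ?_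
  · rintro - h -
    rcases h with h | h <;> obtain ⟨e, he, -⟩ := h.exists_edge <;>
      exact absurd he (Finset.notMem_empty e)
  · intro R e v hR hc hl ih hs h h'
    obtain ⟨q, p, hqp⟩ := ht.exists_leafEnds (hR hl.1.1) hl.1.2.2.1
    rw [ht.partners_iff hR hc hl] at h h'
    rcases h with h | h | ⟨h1, -, h⟩ <;> rcases h' with h' | h' | ⟨h1', -, h'⟩
    · exact cutPair_right_unique h h'
    · exact absurd h.joined h'.not_joined
    · exact absurd h.joined h1'.not_joined
    · exact absurd h'.joined h.not_joined
    · exact ht.cutPair_left_unique hR hl.1 hs h h'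
    · exact absurd h1' (CutPair.not_leftOver hqp h)
    · exact absurd h'.joined h1.not_joined
    · exact absurd h1 (CutPair.not_leftOver hqp h')
    · refine ih (fun f hf => ?_) h h'
      rw [Finset.mem_erase, not_and] at hf
      rcases eq_or_ne f e with rfl | hfe
      · exact not_not.1 h1.not_joined
      · exact hs f (hf hfe)

end IsTwistTree

end CrossingData

/-! ### The unmatched states of a twisted unknot -/

namespace CrossingData

variable {X A : Type*} {D : CrossingData X A} [LinearOrder X] {c R R₀ : Finset X}

theorem exists_flips (e : X) (σ : Finset X) : ∃ τ, Flips e σ τ := by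
  refine ⟨symmDiff σ {e}, fun f => ?_⟩
  rw [Finset.mem_symmDiff, Finset.mem_singleton]
  tauto

theorem joined_iff_of_flips {e : X} {s t : D.Enhanced} (h : Flips e s.1 t.1) :
    D.Joined c e t ↔ ¬ D.Joined c e s := by
  have := h e
  unfold Joined
  tauto

theorem LeftOver.agreesOff_erase {e : X} {v : D.Circle c} {s : D.Enhanced}
    (h : D.LeftOver c e v s) (hs : AgreesOff c R s.1) : AgreesOff c (R.erase e) s.1 := by
  intro f hf
  rw [Finset.mem_erase, not_and] at hf
  rcases eq_or_ne f e with rfl | hfe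
  · exact not_not.1 h.not_joined
  · exact hs f (hf hfe)

theorem Paired.label_eq_of_not_incident {root : D.Circle c} {s t : D.Enhanced}
    (h : D.Paired c root R s t) {a : A} (ha : ∀ e ∈ R, ¬ D.Incident c e (D.circle c a)) :
    D.label s a = D.label t a := by
  induction h with
  | here R e v s t hl _ _ _ _ h =>
    exact (h a fun h' => ha e hl.1.1 (h' ▸ hl.1.2.2.1)).symm
  | later R e v s t _ _ _ _ _ ih => exact ih fun f hf => ha f (Finset.mem_of_mem_erase hf)

theorem Partners.symm {root : D.Circle c} {s t : D.Enhanced} (h : D.Partners c root R s t) :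
    D.Partners c root R t s := Or.symm h

/-- Partners with respect to the tree without a leaf agree at the vertex of the leaf. -/
theorem Partners.leftOver {e : X} {v root : D.Circle c} {s t : D.Enhanced}
    (hl : D.IsLeaf c root R e v)
    (h : D.Partners c root (R.erase e) s t) (hs : D.LeftOver c e v s) : D.LeftOver c e v t := by
  have hlab : ∀ a, D.circle c a = v → D.label s a = D.label t a := by
    intro a ha
    have hinc : ∀ f ∈ R.erase e, ¬ D.Incident c f (D.circle c a) := by
      intro f hf hfa
      rw [Finset.mem_erase] at hf
      exact hf.1 (hl.2.2.2 f hf.2 (ha ▸ hfa))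
    rcases h with h | h
    · exact h.label_eq_of_not_incident hinc
    · exact (h.label_eq_of_not_incident hinc).symm
  refine ⟨fun hj => hs.not_joined ?_, fun a ha => (hlab a ha).symm.trans (hs.label_eq a ha)⟩
  have hmem : ∀ f ∈ R.erase e, e ≠ f := fun f hf h' => Finset.notMem_erase e R (h' ▸ hf)
  unfold Joined at hj ⊢
  rcases h with h | h <;> obtain ⟨f, hf, h⟩ := h.exists_edge <;> have := h e (hmem f hf) <;> tauto

namespace IsTwistTree

variable {dot : A} {e : X} {v : D.Circle c}

theorem eq_matchLabel_or_leftOver (ht : D.IsTwistTree c R₀) (hR : R ⊆ R₀) {root : D.Circle c}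
    (hl : D.IsLeaf c root R e v) {s : D.Enhanced} (hs : AgreesOff c R s.1)
    (hj : ¬ D.Joined c e s) :
    (∀ a, D.circle c a = v → D.label s a = matchLabel c e) ∨ D.LeftOver c e v s := by
  obtain ⟨q, p, hqp⟩ := ht.exists_leafEnds (hR hl.1) hl.2.2.1
  have h : ∀ a, D.circle c a = v → D.label s a = D.label s q := fun a ha =>
    ht.label_eq_of_base hR hs (ha.trans hqp.2.1.symm)
  rcases eq_matchLabel_or_eq_critLabel c e (D.label s q) with h1 | h1
  · exact Or.inl fun a ha => (h a ha).trans h1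
  · exact Or.inr ⟨hj, fun a ha => (h a ha).trans h1⟩

theorem exists_cutPair_left (ht : D.IsTwistTree c R₀) (hR : R ⊆ R₀) {root : D.Circle c}
    (hl : D.IsLeaf c root R e v) {s : D.Enhanced} (hs : AgreesOff c R s.1)
    (hj : D.Joined c e s) : ∃ t, D.CutPair c e v s t := by
  classical
  obtain ⟨τ, hτ⟩ := exists_flips e s.1
  have hsτ : AgreesOff c R τ := hs.of_flips hl.1 hτ
  have hjτ : ¬ D.Joined c e ⟨τ, fun _ => Label.one⟩ := fun h =>
    (joined_iff_of_flips (t := ⟨τ, fun _ => Label.one⟩) hτ).1 h hj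
  refine ⟨D.enhance τ (fun a => if D.circle c a = v then matchLabel c e else D.label s a)
    fun a b hab => ?_, hj, hjτ, fun f hf => (hτ f).2 hf, fun a ha => ?_, fun a ha => ?_⟩
  · by_cases ha : D.circle c a = v
    · have hb := (ht.isolated_leaf hR hl (s := ⟨τ, fun _ => Label.one⟩) hsτ hjτ ha b).1 hab.symm
      rw [if_pos ha, if_pos hb]
    · have hb : D.circle c b ≠ v := fun hb => ha
        ((ht.isolated_leaf hR hl (s := ⟨τ, fun _ => Label.one⟩) hsτ hjτ hb a).1 hab)
      rw [if_neg ha, if_neg hb]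
      exact label_congr (ht.surgery.circle_mono hτ.symm
        (ht.merge_leaf hR hl (s := ⟨τ, fun _ => Label.one⟩) hsτ hjτ) hab)
  · rw [label_enhance, if_pos ha]
  · rw [label_enhance, if_neg ha]

theorem exists_cutPair_right (ht : D.IsTwistTree c R₀) (hR : R ⊆ R₀) {root : D.Circle c}
    (hl : D.IsLeaf c root R e v) {t : D.Enhanced} (hs : AgreesOff c R t.1)
    (hj : ¬ D.Joined c e t) (hlab : ∀ a, D.circle c a = v → D.label t a = matchLabel c e) :
    ∃ s, D.CutPair c e v s t := by
  classical
  obtain ⟨τ, hτ⟩ := exists_flips e t.1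
  obtain ⟨q, p, hqp, hq, hp⟩ := ht.exists_leafEnds (hR hl.1) hl.2.2.1
  have hjτ : D.Joined c e ⟨τ, fun _ => Label.one⟩ :=
    (joined_iff_of_flips (t := ⟨τ, fun _ => Label.one⟩) hτ).2 hj
  have hend : ∀ a, D.circle t.1 a = D.circle t.1 (D.slot e 0) ∨
      D.circle t.1 a = D.circle t.1 (D.slot e 2) →
      (if D.circle c a = v then D.label t p else D.label t a) = D.label t p := by
    intro a ha
    have h1 : D.circle t.1 a = D.circle t.1 q ∨ D.circle t.1 a = D.circle t.1 p := by
      rcases hqp with ⟨rfl, rfl⟩ | ⟨rfl, rfl⟩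
      · exact ha
      · exact ha.symm
    rcases h1 with h1 | h1
    · exact if_pos ((ht.isolated_leaf hR hl hs hj hq a).1 h1)
    · split_ifs
      · rfl
      · exact label_congr h1
  refine ⟨D.enhance τ (fun a => if D.circle c a = v then D.label t p else D.label t a)
    fun a b hab => ?_, hjτ, hj, fun f hf => ((hτ f).2 hf).symm, hlab, fun a ha => ?_⟩
  · rcases (ht.surgery.merge hτ (ht.merge_leaf hR hl hs hj) a b).1 hab with h | ⟨h1, h2⟩
    · by_cases ha : D.circle c a = v
      · rw [if_pos ha, if_pos ((ht.isolated_leaf hR hl hs hj ha b).1 h.symm)]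
      · rw [if_neg ha, if_neg fun hb => ha ((ht.isolated_leaf hR hl hs hj hb a).1 h)]
        exact label_congr h
    · exact (hend a h1).trans (hend b h2).symm
  · rw [label_enhance, if_neg ha]

/-- Having no partner, one leaf at a time. -/
theorem forall_not_partners_step (ht : D.IsTwistTree c R₀) (hR : R ⊆ R₀)
    (hc : D.RootConn c dot R) (hl : D.IsLeastLeaf c (D.circle c dot) R e v) {s : D.Enhanced}
    (hs : AgreesOff c R s.1) :
    (∀ t, ¬ D.Partners c (D.circle c dot) R s t) ↔
      D.LeftOver c e v s ∧ ∀ t, ¬ D.Partners c (D.circle c dot) (R.erase e) s t := by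
  constructor
  · intro h
    have hj : ¬ D.Joined c e s := fun hj => by
      obtain ⟨t, htp⟩ := ht.exists_cutPair_left hR hl.1 hs hj
      exact h t ((ht.partners_iff hR hc hl).2 (Or.inl htp))
    have hlo : D.LeftOver c e v s := by
      refine (ht.eq_matchLabel_or_leftOver hR hl.1 hs hj).resolve_left fun h1 => ?_
      obtain ⟨t, htp⟩ := ht.exists_cutPair_right hR hl.1 hs hj h1
      exact h t ((ht.partners_iff hR hc hl).2 (Or.inr (Or.inl htp)))
    exact ⟨hlo, fun t hp => h t ((ht.partners_iff hR hc hl).2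
      (Or.inr (Or.inr ⟨hlo, hp.leftOver hl.1 hlo, hp⟩)))⟩
  · rintro ⟨hlo, h⟩ t hp
    obtain ⟨q, p, hqp⟩ := ht.exists_leafEnds (hR hl.1.1) hl.1.2.2.1
    rcases (ht.partners_iff hR hc hl).1 hp with h1 | h1 | ⟨-, -, h1⟩
    · exact hlo.not_joined h1.joined
    · exact CutPair.not_leftOver hqp h1 hlo
    · exact h t h1

theorem not_partners_empty {root : D.Circle c} {s t : D.Enhanced} : ¬ D.Partners c root ∅ s t := by
  rintro (h | h) <;> obtain ⟨e, he, -⟩ := h.exists_edge <;> exact Finset.notMem_empty e he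

/-- The states without partner are the enhancements of `c` in which every vertex other than the
root has the label of the states left over by the edge with which it is removed. -/
theorem forall_not_partners_iff (ht : D.IsTwistTree c R₀) {s : D.Enhanced}
    (hs : AgreesOff c R₀ s.1) :
    (∀ t, ¬ D.Partners c (D.circle c dot) R₀ s t) ↔
      s.1 = c ∧ ∀ e v, D.Removes c (D.circle c dot) R₀ e v →
        ∀ a, D.circle c a = v → D.label s a = critLabel c e := by
  revert hs
  refine ht.removal_induction (dot := dot) (p := fun R => AgreesOff c R s.1 →
    ((∀ t, ¬ D.Partners c (D.circle c dot) R s t) ↔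
      s.1 = c ∧ ∀ e v, D.Removes c (D.circle c dot) R e v →
        ∀ a, D.circle c a = v → D.label s a = critLabel c e)) ?_ ?_
  · intro hs
    refine iff_of_true (fun _ => not_partners_empty) ⟨?_, fun e v h => ?_⟩
    · ext f
      exact hs f (Finset.notMem_empty f)
    · exact absurd h.mem.1 (Finset.notMem_empty e)
  · intro R e v hR hc hl ih hs
    rw [ht.forall_not_partners_step hR hc hl hs]
    constructor
    · rintro ⟨hlo, h⟩
      obtain ⟨h1, h2⟩ := (ih (hlo.agreesOff_erase hs)).1 h
      refine ⟨h1, fun f w hf => ?_⟩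
      rcases (ht.removes_iff hR hc hl).1 hf with ⟨rfl, rfl⟩ | hf
      · exact hlo.label_eq
      · exact h2 f w hf
    · rintro ⟨h1, h2⟩
      have hlo : D.LeftOver c e v s :=
        ⟨fun h => h (h1 ▸ Iff.rfl), h2 e v ((ht.removes_iff hR hc hl).2 (Or.inl ⟨rfl, rfl⟩))⟩
      exact ⟨hlo, (ih (hlo.agreesOff_erase hs)).2
        ⟨h1, fun f w hf => h2 f w ((ht.removes_iff hR hc hl).2 (Or.inr hf))⟩⟩

/-- Every vertex other than the root is removed. -/
theorem exists_removes (ht : D.IsTwistTree c R₀) {a : A} (ha : D.circle c a ≠ D.circle c dot) :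
    ∃ e, D.Removes c (D.circle c dot) R₀ e (D.circle c a) := by
  have h : D.circle (symmDiff c R₀) a = D.circle (symmDiff c R₀) dot :=
    ht.connected _ (fun _ => mem_symmDiff_iff) _ _
  revert h
  refine ht.removal_induction (dot := dot) (p := fun R =>
    D.circle (symmDiff c R) a = D.circle (symmDiff c R) dot →
      ∃ e, D.Removes c (D.circle c dot) R e (D.circle c a)) ?_ ?_
  · intro h
    rw [← Finset.bot_eq_empty, symmDiff_bot] at h
    exact absurd h ha
  · intro R e v hR hc hl ih h
    by_cases hav : D.circle c a = v
    · exact ⟨e, hav ▸ .here _ _ _ hl⟩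
    · obtain ⟨f, hf⟩ := ih (ht.circle_erase hR hl.1 hav (Ne.symm hl.1.2.1) h)
      exact ⟨f, .later _ _ _ _ _ hl hf⟩

theorem removes_unique (ht : D.IsTwistTree c R₀) {e f : X} {v : D.Circle c}
    (he : D.Removes c (D.circle c dot) R₀ e v) (hf : D.Removes c (D.circle c dot) R₀ f v) :
    e = f := by
  revert he hf
  refine ht.removal_induction (dot := dot) (p := fun R => D.Removes c (D.circle c dot) R e v →
    D.Removes c (D.circle c dot) R f v → e = f) ?_ ?_
  · intro he
    exact absurd he.mem.1 (Finset.notMem_empty e)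
  · intro R g w hR hc hl ih he hf
    have key : ∀ f, D.Removes c (D.circle c dot) (R.erase g) f v → w ≠ v := by
      rintro f hf rfl
      have := hf.mem
      exact (Finset.mem_erase.1 this.1).1 (hl.1.2.2.2 f (Finset.mem_of_mem_erase this.1) this.2.1)
    rcases (ht.removes_iff hR hc hl).1 he with ⟨rfl, rfl⟩ | he <;>
      rcases (ht.removes_iff hR hc hl).1 hf with ⟨rfl, hw⟩ | hf
    · rfl
    · exact absurd rfl (key f hf)
    · exact absurd hw.symm (key e he)
    · exact ih he hf

end IsTwistTree

end CrossingData

/-! ### Acyclicity in a twisted unknot -/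

namespace CrossingData

variable {X A : Type*} {D : CrossingData X A} {c R R₀ : Finset X}

open Classical in
/-- A function that increases along paths, for a leaf `e` with an arc `q` on its vertex: the states
with `e` come between those where the isolated vertex is labelled `x` and those where its label
is `1`. -/
noncomputable def leafRank (D : CrossingData X A) (c : Finset X) (e : X) (q : A)
    (s : D.Enhanced) : ℕ :=
  if D.Joined c e s then 1 else if D.label s q = Label.x then 0 else 2

theorem leafRank_of_joined {e : X} {q : A} {s : D.Enhanced} (h : D.Joined c e s) :
    D.leafRank c e q s = 1 := if_pos h

theorem leafRank_of_x {e : X} {q : A} {s : D.Enhanced} (h : ¬ D.Joined c e s)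
    (hq : D.label s q = Label.x) : D.leafRank c e q s = 0 := by
  rw [leafRank, if_neg h, if_pos hq]

theorem leafRank_of_one {e : X} {q : A} {s : D.Enhanced} (h : ¬ D.Joined c e s)
    (hq : D.label s q = Label.one) : D.leafRank c e q s = 2 := by
  rw [leafRank, if_neg h, if_neg (by rw [hq]; simp)]

theorem leafRank_congr {e : X} {q : A} {s t : D.Enhanced} (h : ¬ D.Joined c e s)
    (h' : ¬ D.Joined c e t) (hq : D.label s q = D.label t q) :
    D.leafRank c e q s = D.leafRank c e q t := by
  rw [leafRank, leafRank, if_neg h, if_neg h', hq]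

variable [LinearOrder X]

theorem matchLabel_of_mem {e : X} (h : e ∈ c) : matchLabel c e = Label.x := if_pos h

theorem matchLabel_of_notMem {e : X} (h : e ∉ c) : matchLabel c e = Label.one := if_neg h

namespace IsTwistTree

variable {dot : A} {e : X} {v : D.Circle c}

/-- The cut at a negative twist is a split with a term of the coproduct. -/
theorem compatible_of_mem (ht : D.IsTwistTree c R₀) (hR : R ⊆ R₀) {root : D.Circle c}
    (hl : D.IsLeaf c root R e v) {s t : D.Enhanced} (htR : AgreesOff c R t.1)
    (h : D.CutPair c e v s t) (he : e ∈ c) : D.Compatible e s t := by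
  obtain ⟨q, p, hqp⟩ := ht.exists_leafEnds (hR hl.1) hl.2.2.1
  have hsR := htR.of_flips hl.1 h.flips.symm
  have hm := ht.merge_leaf hR hl htR h.not_joined
  have hjn := ht.surgery.merged h.flips.symm hm
  have hq : D.label t q = Label.x := by rw [h.label_eq q hqp.2.1, matchLabel_of_mem he]
  have hp : D.label t p = D.label s (D.slot e 0) := by
    rw [h.label_eq_of_ne p hqp.2.2]
    rcases hqp.1 with ⟨-, rfl⟩ | ⟨-, rfl⟩
    · exact (label_congr hjn).symm
    · rfl
  refine ⟨Or.inr ⟨hjn, hm, ?_⟩, fun a h0 h2 => h.label_eq_of_ne a fun ha => ?_⟩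
  · rcases hqp.1 with ⟨rfl, rfl⟩ | ⟨rfl, rfl⟩
    · rw [hq, hp]; exact Label.isComul_x_left _
    · rw [hq, hp]; exact Label.isComul_x_right _
  · have := ht.circle_eq_of_base (fun f hf => hsR f fun h => hf (hR h)) (ha.trans hqp.2.1.symm)
    rcases hqp.1 with ⟨rfl, -⟩ | ⟨rfl, -⟩
    · exact h0 this
    · exact h2 this

/-- The converse of the cut at a positive twist is a merge with a unit. -/
theorem compatible_of_notMem (ht : D.IsTwistTree c R₀) (hR : R ⊆ R₀) {root : D.Circle c}
    (hl : D.IsLeaf c root R e v) {s t : D.Enhanced} (htR : AgreesOff c R t.1)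
    (h : D.CutPair c e v s t) (he : e ∉ c) : D.Compatible e t s := by
  obtain ⟨q, p, hqp⟩ := ht.exists_leafEnds (hR hl.1) hl.2.2.1
  have hm := ht.merge_leaf hR hl htR h.not_joined
  have hjn := ht.surgery.merged h.flips.symm hm
  have hq : D.label t q = Label.one := by rw [h.label_eq q hqp.2.1, matchLabel_of_notMem he]
  have hp : D.label t p = D.label s (D.slot e 0) := by
    rw [h.label_eq_of_ne p hqp.2.2]
    rcases hqp.1 with ⟨-, rfl⟩ | ⟨-, rfl⟩
    · exact (label_congr hjn).symm
    · rfl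
  refine ⟨Or.inl ⟨hm, hjn, ?_⟩, fun a h0 h2 => (h.label_eq_of_ne a fun ha => ?_).symm⟩
  · rcases hqp.1 with ⟨rfl, rfl⟩ | ⟨rfl, rfl⟩
    · rw [hq, hp]; exact Label.isMul_one_left _
    · rw [hq, hp]; exact Label.isMul_one_right _
  · have := (ht.isolated_leaf hR hl htR h.not_joined hqp.2.1 a).2 ha
    rcases hqp.1 with ⟨rfl, -⟩ | ⟨rfl, -⟩
    · exact h0 this
    · exact h2 this

theorem cutPair_of_split (ht : D.IsTwistTree c R₀) (hR : R ⊆ R₀) {root : D.Circle c}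
    (hl : D.IsLeaf c root R e v) {s t : D.Enhanced} (htR : AgreesOff c R t.1)
    (hf : Flips e s.1 t.1) (hj : ¬ D.Joined c e t) (he : e ∈ c) (hc : D.Compatible e s t)
    {q p : A} (hqp : D.LeafEnds c e v q p) (hq : D.label t q = Label.x) : D.CutPair c e v s t := by
  have hm := ht.merge_leaf hR hl htR hj
  have hjn := ht.surgery.merged hf.symm hm
  refine ⟨not_not.1 (mt (joined_iff_of_flips hf).2 hj), hj, fun f => (hf f).2, fun a ha => ?_,
    fun a ha => ?_⟩
  · rw [ht.label_eq_of_base hR htR (ha.trans hqp.2.1.symm), hq, matchLabel_of_mem he]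
  · obtain ⟨⟨-, h1, -⟩ | ⟨-, -, hco⟩, ho⟩ := hc
    · exact absurd h1 hm
    have hp : D.label t p = D.label s (D.slot e 0) := by
      rcases hqp.1 with ⟨rfl, rfl⟩ | ⟨rfl, rfl⟩ <;>
      · rw [hq] at hco
        generalize D.label s (D.slot e 0) = l at hco ⊢
        generalize D.label t _ = l' at hco ⊢
        cases hco <;> rfl
    by_cases ha0 : D.circle s.1 a = D.circle s.1 (D.slot e 0)
    · have hap : D.circle t.1 a = D.circle t.1 p := by
        have h1 := (ht.surgery.circle_eq_merged hf.symm hm a).1 ha0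
        have h2 := mt (ht.isolated_leaf hR hl htR hj hqp.2.1 a).1 ha
        rcases hqp.1 with ⟨rfl, rfl⟩ | ⟨rfl, rfl⟩
        · exact h1.resolve_left h2
        · exact h1.resolve_right h2
      rw [label_congr hap, hp, label_congr ha0]
    · exact ho a ha0 (hjn ▸ ha0)

theorem cutPair_of_merge (ht : D.IsTwistTree c R₀) (hR : R ⊆ R₀) {root : D.Circle c}
    (hl : D.IsLeaf c root R e v) {s t : D.Enhanced} (htR : AgreesOff c R t.1)
    (hf : Flips e s.1 t.1) (hj : ¬ D.Joined c e t) (he : e ∉ c) (hc : D.Compatible e t s)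
    {q p : A} (hqp : D.LeafEnds c e v q p) (hq : D.label t q = Label.one) :
    D.CutPair c e v s t := by
  have hm := ht.merge_leaf hR hl htR hj
  have hjn := ht.surgery.merged hf.symm hm
  refine ⟨not_not.1 (mt (joined_iff_of_flips hf).2 hj), hj, fun f => (hf f).2, fun a ha => ?_,
    fun a ha => ?_⟩
  · rw [ht.label_eq_of_base hR htR (ha.trans hqp.2.1.symm), hq, matchLabel_of_notMem he]
  · obtain ⟨⟨-, -, hmul⟩ | ⟨h1, -⟩, ho⟩ := hc
    swap
    · exact absurd h1 hm
    have hp : D.label t p = D.label s (D.slot e 0) := by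
      rcases hqp.1 with ⟨rfl, rfl⟩ | ⟨rfl, rfl⟩ <;>
      · rw [hq] at hmul
        generalize D.label s (D.slot e 0) = l at hmul ⊢
        generalize D.label t _ = l' at hmul ⊢
        cases hmul <;> rfl
    have h2 := mt (ht.isolated_leaf hR hl htR hj hqp.2.1 a).1 ha
    by_cases hap : D.circle t.1 a = D.circle t.1 p
    · rw [label_congr hap, hp]
      refine label_congr ((ht.surgery.circle_eq_merged hf.symm hm a).2 ?_).symm
      rcases hqp.1 with ⟨rfl, rfl⟩ | ⟨rfl, rfl⟩
      · exact Or.inr hap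
      · exact Or.inl hap
    · refine (ho a ?_ ?_).symm <;> rcases hqp.1 with ⟨rfl, rfl⟩ | ⟨rfl, rfl⟩ <;> assumption

end IsTwistTree

theorem LeftOver.leafRank_eq {e : X} {v : D.Circle c} {q : A} {s : D.Enhanced}
    (h : D.LeftOver c e v s) (hq : D.circle c q = v) :
    D.leafRank c e q s = if e ∈ c then 2 else 0 := by
  have := h.label_eq q hq
  unfold critLabel at this
  split_ifs with he
  · rw [if_pos he] at this
    exact leafRank_of_one h.not_joined this
  · rw [if_neg he] at this
    exact leafRank_of_x h.not_joined this

theorem IsTwistTree.leftOver_of_leafRank {e : X} {v : D.Circle c} (ht : D.IsTwistTree c R₀)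
    (hR : R ⊆ R₀) {s : D.Enhanced}
    (hs : AgreesOff c R s.1) {q : A} (hq : D.circle c q = v)
    (h : D.leafRank c e q s = if e ∈ c then 2 else 0) : D.LeftOver c e v s := by
  have hj : ¬ D.Joined c e s := fun hj => by
    rw [leafRank_of_joined hj] at h
    split_ifs at h; omega
  refine ⟨hj, fun a ha => ?_⟩
  rw [ht.label_eq_of_base hR hs (ha.trans hq.symm)]
  unfold leafRank at h
  unfold critLabel
  rw [if_neg hj] at h
  rcases Label.eq_one_or_eq_x (D.label s q) with h1 | h1 <;> rw [h1] at h ⊢ <;> split_ifs at h ⊢ <;>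
    simp_all

section Fintype

variable [Fintype X]

/-- The steps, within the states that agree with `c` outside `R`, of directed paths in the Hasse
diagram with the edges between partners reversed. -/
def TwistStep (D : CrossingData X A) (c : Finset X) (root : D.Circle c) (R : Finset X)
    (s t : D.Enhanced) : Prop :=
  AgreesOff c R s.1 ∧ AgreesOff c R t.1 ∧
    ((D.khCoeff s t ≠ 0 ∧ ¬ D.Partners c root R s t) ∨
      (D.khCoeff t s ≠ 0 ∧ D.Partners c root R s t))

theorem card_lt_of_khCoeff_ne_zero {s t : D.Enhanced} (h : D.khCoeff s t ≠ 0) :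
    s.1.card < t.1.card := by
  obtain ⟨e, he, ht, -⟩ := khCoeff_ne_zero_iff.1 h
  rw [ht, Finset.card_insert_of_notMem he]
  exact Nat.lt_succ_self _

namespace IsTwistTree

variable {dot : A} {e : X} {v : D.Circle c}

/-- The rank of a leaf is monotone along paths. It is constant only in the states left over by the
leaf and along edges of the Hasse diagram that are not reversed. -/
theorem leafRank_step (ht : D.IsTwistTree c R₀) (hR : R ⊆ R₀) (hc : D.RootConn c dot R)
    (hl : D.IsLeastLeaf c (D.circle c dot) R e v) {q p : A} (hqp : D.LeafEnds c e v q p)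
    {s t : D.Enhanced} (h : D.TwistStep c (D.circle c dot) R s t) :
    D.leafRank c e q s < D.leafRank c e q t ∨ D.leafRank c e q s = D.leafRank c e q t ∧
      (D.LeftOver c e v s ∧ D.LeftOver c e v t ∨ D.khCoeff s t ≠ 0) := by
  obtain ⟨hs, htR, ⟨hco, hnp⟩ | ⟨hco, hp⟩⟩ := h
  · obtain ⟨g, hg, hf, hcomp⟩ := khCoeff_ne_zero_iff_flips.1 hco
    rw [ht.partners_iff hR hc hl] at hnp
    rcases eq_or_ne g e with rfl | hge
    · by_cases hgc : g ∈ c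
      · have hjs : D.Joined c g s := by unfold Joined; tauto
        have hjt : ¬ D.Joined c g t := fun h => (joined_iff_of_flips hf).1 h hjs
        -- a split of a negative twist that labels the leaf `x` is matched
        left
        rw [leafRank_of_joined hjs, leafRank_of_one hjt]
        · norm_num
        refine (Label.eq_one_or_eq_x _).resolve_right fun hq => hnp (Or.inl ?_)
        exact ht.cutPair_of_split hR hl.1 htR hf hjt hgc hcomp hqp hq
      · have hjs : ¬ D.Joined c g s := by unfold Joined; tauto
        have hjt : D.Joined c g t := (joined_iff_of_flips hf).2 hjs
        -- a merge at a positive twist whose leaf has the label `1` is matched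
        left
        rw [leafRank_of_joined hjt, leafRank_of_x hjs]
        · norm_num
        refine (Label.eq_one_or_eq_x _).resolve_left fun hq => hnp (Or.inr (Or.inl ?_))
        exact ht.cutPair_of_merge hR hl.1 hs hf.symm hjs hgc hcomp hqp hq
    · -- other crossings do not meet the circle of the isolated leaf
      right
      refine ⟨?_, Or.inr hco⟩
      have hiff : D.Joined c e s ↔ D.Joined c e t := by
        have := (hf e).2 hge.symm
        unfold Joined
        tauto
      by_cases hj : D.Joined c e s
      · rw [leafRank_of_joined hj, leafRank_of_joined (hiff.1 hj)]
      · refine leafRank_congr hj (mt hiff.2 hj) (hcomp.2 q ?_ ?_).symm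
        all_goals
          intro h
          have hg0 := (ht.isolated_leaf hR hl.1 hs hj hqp.2.1 _).1 h.symm
          have hgR : g ∈ R := by
            by_contra hgR
            have h1 := hs g hgR
            have h2 := htR g hgR
            have h3 := hf.mem_iff
            tauto
          refine hge (hl.1.2.2.2 g hgR ?_)
        exacts [Or.inl hg0.symm, Or.inr hg0.symm]
  · obtain ⟨g, hg, hf, hcomp⟩ := khCoeff_ne_zero_iff_flips.1 hco
    rcases (ht.partners_iff hR hc hl).1 hp with h | h | ⟨h1, h2, -⟩
    · left
      obtain rfl : e = g := by
        have := (h.flips e)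
        have := hf e
        tauto
      have hgc : e ∉ c := by
        have := h.not_joined
        unfold Joined at this
        tauto
      rw [leafRank_of_joined h.joined, leafRank_of_one h.not_joined]
      · norm_num
      · rw [h.label_eq q hqp.2.1, matchLabel_of_notMem hgc]
    · left
      obtain rfl : e = g := by
        have := (h.flips e)
        have := hf e
        tauto
      have hgc : e ∈ c := by
        have := h.joined
        unfold Joined at this
        tauto
      rw [leafRank_of_joined h.joined, leafRank_of_x h.not_joined]
      · norm_num
      · rw [h.label_eq q hqp.2.1, matchLabel_of_mem hgc]
    · right
      exact ⟨leafRank_congr h1.not_joined h2.not_joined ((h1.label_eq q hqp.2.1).trans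
        (h2.label_eq q hqp.2.1).symm), Or.inl ⟨h1, h2⟩⟩

theorem not_transGen_twistStep (ht : D.IsTwistTree c R₀) (s : D.Enhanced) :
    ¬ Relation.TransGen (D.TwistStep c (D.circle c dot) R₀) s s := by
  have hcard : ∀ a b : D.Enhanced, Relation.TransGen (fun s t => D.khCoeff s t ≠ 0) a b →
      a.1.card < b.1.card := by
    intro a b h
    induction h with
    | single h => exact card_lt_of_khCoeff_ne_zero h
    | tail _ h ih => exact ih.trans (card_lt_of_khCoeff_ne_zero h)
  refine ht.removal_induction (dot := dot) (p := fun R => ∀ s,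
    ¬ Relation.TransGen (D.TwistStep c (D.circle c dot) R) s s) ?_ ?_ s
  · intro s hs
    refine (hcard s s (Relation.TransGen.mono (fun a b h => ?_) _ _ hs)).false
    obtain ⟨-, -, h | h⟩ := h
    · exact h.1
    · exact absurd h.2 not_partners_empty
  · intro R e v hR hc hl ih s hs
    obtain ⟨q, p, hqp⟩ := ht.exists_leafEnds (hR hl.1.1) hl.1.2.2.1
    have hcyc := Relation.TransGen.of_monotone (D.leafRank c e q) id (fun a b h =>
      (ht.leafRank_step hR hc hl hqp h).symm.imp_left And.left) hs
    -- The level of the states left over by `e`; in the other two, reversed edges change the level.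
    by_cases hk : D.leafRank c e q s = if e ∈ c then 2 else 0
    · refine ih s (Relation.TransGen.mono (fun a b h => ?_) _ _ hcyc)
      obtain ⟨⟨ha, hb, h⟩, hra, hrb⟩ := h
      have hla := ht.leftOver_of_leafRank hR ha hqp.2.1 (hra.trans hk)
      have hlb := ht.leftOver_of_leafRank hR hb hqp.2.1 (hrb.trans hk)
      have hiff : D.Partners c (D.circle c dot) R a b ↔
          D.Partners c (D.circle c dot) (R.erase e) a b := by
        rw [ht.partners_iff hR hc hl]
        constructor
        · rintro (h | h | h)
          · exact absurd h.joined hla.not_joined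
          · exact absurd h.joined hlb.not_joined
          · exact h.2.2
        · exact fun h => Or.inr (Or.inr ⟨hla, hlb, h⟩)
      rw [hiff] at h
      exact ⟨hla.agreesOff_erase ha, hlb.agreesOff_erase hb, h⟩
    · refine (hcard s s (Relation.TransGen.mono (fun a b h => ?_) _ _ hcyc)).false
      obtain ⟨h, hra, hrb⟩ := h
      rcases ht.leafRank_step hR hc hl hqp h with h1 | ⟨-, ⟨h1, -⟩ | h1⟩
      · exact absurd (hra.trans hrb.symm) h1.ne
      · exact absurd (hra.symm.trans (h1.leafRank_eq hqp.2.1)) hk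
      · exact h1

/-- Partners are the ends of an edge of the Hasse diagram. -/
theorem khCoeff_of_partners (ht : D.IsTwistTree c R₀) {s t : D.Enhanced}
    (hs : AgreesOff c R₀ s.1) (h : D.Partners c (D.circle c dot) R₀ s t) :
    D.khCoeff s t ≠ 0 ∨ D.khCoeff t s ≠ 0 := by
  revert hs h
  refine ht.removal_induction (dot := dot) (p := fun R => AgreesOff c R s.1 →
    D.Partners c (D.circle c dot) R s t → D.khCoeff s t ≠ 0 ∨ D.khCoeff t s ≠ 0) ?_ ?_
  · intro _ h
    exact absurd h not_partners_empty
  · intro R e v hR hc hl ih hs h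
    have key : ∀ s t, AgreesOff c R t.1 → D.CutPair c e v s t →
        D.khCoeff s t ≠ 0 ∨ D.khCoeff t s ≠ 0 := by
      intro s t htR h
      have h1 := h.joined
      have h2 := h.not_joined
      unfold Joined at h1 h2
      by_cases he : e ∈ c
      · exact Or.inl (khCoeff_ne_zero_iff_flips.2 ⟨e, by tauto, h.flips,
          ht.compatible_of_mem hR hl.1 htR h he⟩)
      · exact Or.inr (khCoeff_ne_zero_iff_flips.2 ⟨e, by tauto, h.flips.symm,
          ht.compatible_of_notMem hR hl.1 htR h he⟩)
    have htR := h.agreesOff hs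
    rcases (ht.partners_iff hR hc hl).1 h with h | h | ⟨h1, -, h⟩
    · exact key s t htR h
    · exact (key t s hs h).symm
    · exact ih (h1.agreesOff_erase hs) h

end IsTwistTree

/-- The label of an arc changes along the differential at most from `1` to `x`. -/
theorem HasSurgery.label_eq_x (hs : D.HasSurgery) {s t : D.Enhanced} (h : D.khCoeff s t ≠ 0)
    {a : A} (ha : D.label s a = Label.x) : D.label t a = Label.x := by
  obtain ⟨e, he, hf, hc, ho⟩ := khCoeff_ne_zero_iff_flips.1 h
  by_cases h0 : D.circle s.1 a = D.circle s.1 (D.slot e 0) ∨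
      D.circle s.1 a = D.circle s.1 (D.slot e 2)
  · rcases hc with ⟨hne, -, hm⟩ | ⟨heq, hne, hm⟩
    · rw [label_congr ((hs.circle_eq_merged hf hne a).2 h0)]
      rcases h0 with h0 | h0 <;> rw [label_congr h0] at ha <;> rw [ha] at hm
      all_goals
        generalize D.label t (D.slot e 0) = l at hm ⊢
        generalize D.label s _ = l' at hm
        cases hm; rfl
    · have hs0 : D.circle s.1 a = D.circle s.1 (D.slot e 0) := h0.elim id fun h => h.trans heq.symm
      rw [label_congr hs0] at ha
      have h1 := (hs.circle_eq_merged hf.symm hne a).1 hs0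
      rw [ha] at hm
      have hm' : D.label t (D.slot e 0) = Label.x ∧ D.label t (D.slot e 2) = Label.x := by
        generalize D.label t (D.slot e 0) = l at hm ⊢
        generalize D.label t (D.slot e 2) = l' at hm ⊢
        cases hm
        exact ⟨rfl, rfl⟩
      rcases h1 with h1 | h1
      · rw [label_congr h1, hm'.1]
      · rw [label_congr h1, hm'.2]
  · rw [not_or] at h0
    rw [ho a h0.1 h0.2, ha]

end Fintype

end CrossingData

/-! ### Paths on which a property persists -/

namespace BasedComplex

variable {B : Type*} {K : BasedComplex B} {M : B → B → Prop}

theorem IsPath.forall_of_head {V : Set B} {b b' : B} {l : List B} (h : K.IsPath M V b b' l)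
    {p : B → Prop} (hp : ∀ x y, K.Arrow M x y → p x → p y) (hb : p b) : ∀ x ∈ l, p x := by
  refine h.chain.induction p l hp fun hne => ?_
  have := h.head
  rw [List.head?_eq_some_head hne, Option.some.injEq] at this
  rwa [this]

theorem IsPath.forall_of_last {V : Set B} {b b' : B} {l : List B} (h : K.IsPath M V b b' l)
    {p : B → Prop} (hp : ∀ x y, K.Arrow M x y → p y → p x) (hb : p b') : ∀ x ∈ l, p x := by
  refine h.chain.backwards_induction p l hp fun hne => ?_
  have := h.last
  rw [List.getLast?_eq_some_getLast hne, Option.some.injEq] at this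
  rwa [this]

theorem IsPath.last_mem {V : Set B} {b b' : B} {l : List B} (h : K.IsPath M V b b' l) : b' ∈ l :=
  List.mem_of_mem_getLast? h.last

theorem IsPath.of_forall_mem {V W : Set B} {b b' : B} {l : List B} (h : K.IsPath M V b b' l)
    (hW : ∀ c ∈ l, c ∈ W) : K.IsPath M W b b' l :=
  ⟨h.chain, h.nodup, h.head, h.last, hW⟩

/-- The set `V` does not restrict the paths if all paths stay in `V`. -/
theorem gamma_eq_gamma_univ {V : Set B} {b b' : B}
    (h : ∀ l, K.IsPath M Set.univ b b' l → ∀ c ∈ l, c ∈ V) :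
    K.Gamma M V b b' = K.Gamma M Set.univ b b' := by
  unfold Gamma
  congr 1
  funext l
  have : l ∈ {l | K.IsPath M V b b' l} ↔ l ∈ {l | K.IsPath M Set.univ b b' l} :=
    ⟨fun hl => hl.of_forall_mem fun _ _ => trivial, fun hl => hl.of_forall_mem (h l hl)⟩
  rw [this]

theorem gamma_eq_zero {V : Set B} {b b' : B} (h : ∀ l, ¬ K.IsPath M V b b' l) :
    K.Gamma M V b b' = 0 := by
  unfold Gamma
  have : {l : List B | K.IsPath M V b b' l} = ∅ := Set.eq_empty_iff_forall_notMem.2 h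
  rw [this]
  exact finsum_mem_empty

end BasedComplex

/-! ### The matching of the Khovanov complex -/

namespace CrossingData

variable {X A : Type*} [Fintype X] [LinearOrder X] {D : CrossingData X A} {black : D.Face → Prop}
  {dot : A}

theorem InUnknot.agreesOff {T : Finset X} {s : D.Enhanced} (h : D.InUnknot black T s) :
    AgreesOff (D.treeState black T) (D.liveEdges black T) s.1 := fun e he =>
  h e (mt mem_liveEdges.2 he)

theorem AgreesOff.inUnknot {T : Finset X} {s : D.Enhanced}
    (h : AgreesOff (D.treeState black T) (D.liveEdges black T) s.1) : D.InUnknot black T s :=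
  fun e he => h e (mt mem_liveEdges.1 he)

theorem label_criticalState_dot (T : D.SignedTree black) :
    D.label (D.criticalState black dot T) dot = T.2 := if_pos rfl

end CrossingData

namespace LinkDiagram

open CrossingData

variable {X A : Type*} [Fintype X] [LinearOrder X] {L : LinkDiagram X A}
  {black : L.Face → Prop} {dot : A}

theorem matched_iff (hL : L.Connected) (h : L.IsCheckerboard black) {s t : L.Enhanced}
    {T : Finset X} (hT : L.IsSpanningTree black T) (hs : L.InUnknot black T s) :
    L.Matched black dot s t ↔ L.khCoeff s t ≠ 0 ∧
      L.Partners (L.treeState black T) (L.circle _ dot) (L.liveEdges black T) s t := by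
  refine and_congr_right fun _ => ⟨?_, fun hp => ?_⟩
  · rintro ⟨T', hT', hs', -, hp⟩
    obtain rfl := eq_of_inUnknot hL h hT hT' hs hs'
    exact hp
  · exact ⟨T, hT, hs, (hp.agreesOff hs.agreesOff).inUnknot, hp⟩

theorem inUnknot_criticalState (T : L.SignedTree black) :
    L.InUnknot black T.1.1 (L.criticalState black dot T) := fun _ _ => Iff.rfl

variable [Finite A]

theorem matched_unique (hL : L.Connected) (h : L.IsCheckerboard black) {s t t' : L.Enhanced}
    (ht : L.Matched black dot s t ∨ L.Matched black dot t s)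
    (ht' : L.Matched black dot s t' ∨ L.Matched black dot t' s) : t = t' := by
  obtain ⟨T, hT, hs⟩ := exists_inUnknot hL h s
  have key : ∀ t, L.Matched black dot s t ∨ L.Matched black dot t s →
      L.Partners (L.treeState black T) (L.circle _ dot) (L.liveEdges black T) s t := by
    rintro t (⟨-, T', hT', hs', ht', hp⟩ | ⟨-, T', hT', ht', hs', hp⟩) <;>
      obtain rfl := eq_of_inUnknot hL h hT hT' hs hs'
    · exact hp
    · exact Or.symm hp
  exact (isTwistTree hL h hT).partners_unique hs.agreesOff (key t ht) (key t' ht')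

theorem isCritical_iff (hL : L.Connected) (h : L.IsCheckerboard black) {s : L.Enhanced}
    {T : Finset X} (hT : L.IsSpanningTree black T) (hs : L.InUnknot black T s) :
    BasedComplex.IsCritical (L.Matched black dot) s ↔ s.1 = L.treeState black T ∧
      ∀ e v, L.Removes _ (L.circle _ dot) (L.liveEdges black T) e v →
        ∀ a, L.circle (L.treeState black T) a = v →
          L.label s a = critLabel (L.treeState black T) e := by
  have ht := isTwistTree hL h hT
  rw [← ht.forall_not_partners_iff hs.agreesOff]
  constructor
  · intro hc t hp
    have htT := (hp.agreesOff hs.agreesOff).inUnknot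
    rcases ht.khCoeff_of_partners hs.agreesOff hp with h1 | h1
    · exact (hc t).1 ((matched_iff hL h hT hs).2 ⟨h1, hp⟩)
    · exact (hc t).2 ((matched_iff hL h hT htT).2 ⟨h1, hp.symm⟩)
  · intro hc t
    refine ⟨fun hM => hc t ((matched_iff hL h hT hs).1 hM).2, fun hM => ?_⟩
    obtain ⟨-, T', hT', ht', hs', hp⟩ := hM
    obtain rfl := eq_of_inUnknot hL h hT hT' hs hs'
    exact hc t (Or.symm hp)

/-- The matching is acyclic: a cycle would stay in the twisted unknot of one spanning tree, by the
monotonicity of the dead `B`-smoothed edges, and there it is excluded by the leaves of the tree. -/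
theorem isAcyclicMatching (hL : L.Connected) (h : L.IsCheckerboard black) :
    L.CKh.IsAcyclicMatching (L.Matched black dot) where
  edge _ _ hM := hM.1
  matching := by
    intro a a' b b' h1 h2 hor
    have hasymm : ∀ {s t}, L.Matched black dot s t → ¬ L.Matched black dot t s := fun h3 h4 =>
      (card_lt_of_khCoeff_ne_zero h3.1).asymm (card_lt_of_khCoeff_ne_zero h4.1)
    rcases hor with rfl | rfl | rfl | rfl
    · exact ⟨rfl, matched_unique hL h (Or.inl h1) (Or.inl h2)⟩
    · obtain rfl := matched_unique hL h (Or.inl h1) (Or.inr h2)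
      exact absurd h2 (hasymm h1)
    · obtain rfl := matched_unique hL h (Or.inr h1) (Or.inl h2)
      exact absurd h2 (hasymm h1)
    · exact ⟨matched_unique hL h (Or.inr h1) (Or.inr h2), rfl⟩
  unit _ _ hM := isUnit_khCoeff hM.1
  acyclic := by
    intro s hs
    choose T hT hsT using exists_inUnknot hL h
    have hcyc := Relation.TransGen.of_monotone T (fun T => toColex (deadB L black T))
      (fun a b hab => ?_) hs
    · refine (isTwistTree hL h (hT s)).not_transGen_twistStep (dot := dot) s
        (Relation.TransGen.mono (fun a b hab => ?_) _ _ hcyc)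
      obtain ⟨hab, ha, hb⟩ := hab
      have hsa := hsT a
      have hsb := hsT b
      rw [ha] at hsa
      rw [hb] at hsb
      refine ⟨hsa.agreesOff, hsb.agreesOff, ?_⟩
      rcases hab with ⟨h1, h2⟩ | h1
      · exact Or.inl ⟨h1, fun hp => h2 ((matched_iff hL h (hT s) hsa).2 ⟨h1, hp⟩)⟩
      · have := (matched_iff hL h (hT s) hsb).1 h1
        exact Or.inr ⟨this.1, this.2.symm⟩
    · rcases hab with ⟨h1, -⟩ | ⟨-, T', hT', hb, ha, -⟩
      · obtain ⟨e, he, hst, -⟩ := khCoeff_ne_zero_iff.1 h1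
        exact eq_or_deadB_lt hL h (hT a) (hT b) (hsT a) (hsT b) he hst
      · exact Or.inl ((eq_of_inUnknot hL h (hT a) hT' (hsT a) ha).trans
          (eq_of_inUnknot hL h (hT b) hT' (hsT b) hb).symm)

theorem label_criticalState (hL : L.Connected) (h : L.IsCheckerboard black)
    (T : L.SignedTree black) {e : X} {a : A}
    (hr : L.Removes _ (L.circle _ dot) (L.liveEdges black T.1.1) e
      (L.circle (L.treeState black T.1.1) a)) :
    L.label (L.criticalState black dot T) a = critLabel (L.treeState black T.1.1) e := by
  classical
  refine (if_neg hr.mem.2.2).trans ?_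
  unfold critLabel
  refine if_congr ⟨?_, fun he => ⟨e, he, hr⟩⟩ rfl rfl
  rintro ⟨f, hf, hfr⟩
  rwa [(isTwistTree hL h T.1.2).removes_unique hr hfr]

theorem bijOn_criticalState (hL : L.Connected) (h : L.IsCheckerboard black) :
    Set.BijOn (L.criticalState black dot) Set.univ
      {s | BasedComplex.IsCritical (L.Matched black dot) s} := by
  refine ⟨fun T _ => ?_, fun T _ T' _ heq => ?_, fun s hs => ?_⟩
  · refine (isCritical_iff hL h T.1.2 (inUnknot_criticalState T)).2 ⟨rfl, ?_⟩
    rintro e _ hr a rfl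
    exact label_criticalState hL h T hr
  · have h1 := inUnknot_criticalState (dot := dot) T
    rw [heq] at h1
    have h2 : T.1 = T'.1 :=
      Subtype.ext (eq_of_inUnknot hL h T.1.2 T'.1.2 h1 (inUnknot_criticalState T'))
    have h3 := label_criticalState_dot (dot := dot) T
    rw [heq, label_criticalState_dot] at h3
    exact Prod.ext h2 h3.symm
  · obtain ⟨T, hT, hsT⟩ := exists_inUnknot hL h s
    obtain ⟨h1, h2⟩ := (isCritical_iff hL h hT hsT).1 hs
    refine ⟨⟨⟨T, hT⟩, L.label s dot⟩, trivial, enhanced_ext h1.symm fun a => ?_⟩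
    by_cases ha : L.circle (L.treeState black T) a = L.circle (L.treeState black T) dot
    · have h3 : L.label (L.criticalState black dot ⟨⟨T, hT⟩, L.label s dot⟩) a =
          L.label s dot := if_pos ha
      rw [h3]
      rw [← h1] at ha
      exact (label_congr ha).symm
    · obtain ⟨e, he⟩ := (isTwistTree hL h hT).exists_removes ha
      rw [label_criticalState hL h ⟨⟨T, hT⟩, L.label s dot⟩ he, h2 e _ he a rfl]

/-! ### The spanning tree complex -/

theorem label_dot_eq_x (h : L.IsCheckerboard black) {s t : L.Enhanced}
    (hst : L.CKh.Arrow (L.Matched black dot) s t) (hs : L.label s dot = Label.x) :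
    L.label t dot = Label.x := by
  rcases hst with ⟨h1, -⟩ | ⟨-, T, -, -, -, hp⟩
  · exact (hasSurgery h).label_eq_x h1 hs
  · rcases hp with hp | hp
    · rw [hp.label_root, hs]
    · rw [← hp.label_root, hs]

theorem label_dot_eq_one (h : L.IsCheckerboard black) {s t : L.Enhanced}
    (hst : L.CKh.Arrow (L.Matched black dot) s t) (hs : L.label t dot = Label.one) :
    L.label s dot = Label.one := by
  refine (Label.eq_one_or_eq_x _).resolve_right fun h1 => ?_
  rw [label_dot_eq_x h hst h1] at hs
  cases hs

/-- The label of the dotted arc is constant on every path between critical states where it agrees,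
and it never changes from `x` to `1`. -/
theorem stCoeff_eq (h : L.IsCheckerboard black) (T T' : L.SignedTree black) :
    L.stCoeff black dot T T' = L.CKh.Gamma (L.Matched black dot) Set.univ
      (L.criticalState black dot T) (L.criticalState black dot T') := by
  have hd := label_criticalState_dot (dot := dot) T
  have hd' := label_criticalState_dot (dot := dot) T'
  unfold stCoeff
  split
  case h_1 h1 h2 =>
    rw [h2] at hd'
    exact BasedComplex.gamma_eq_gamma_univ fun l hl =>
      hl.forall_of_last (p := fun s => L.label s dot = .one)
        (fun _ _ => label_dot_eq_one h) hd'
  case h_2 h1 h2 =>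
    rw [h1] at hd
    exact BasedComplex.gamma_eq_gamma_univ fun l hl =>
      hl.forall_of_head (p := fun s => L.label s dot = .x) (fun _ _ => label_dot_eq_x h) hd
  case h_3 => rfl
  case h_4 h1 h2 =>
    rw [h1] at hd
    rw [h2] at hd'
    refine (BasedComplex.gamma_eq_zero fun l hl => ?_).symm
    have := hl.forall_of_head (p := fun s => L.label s dot = .x)
      (fun _ _ => label_dot_eq_x h) hd _ hl.last_mem
    rw [hd'] at this
    cases this

theorem isComplex_CKh (h : L.IsCheckerboard black) : L.CKh.IsComplex := by
  have := Fintype.ofFinite L.Enhanced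
  refine BasedComplex.isComplex_of_mul_self (A := L.CKh.coeff) (hasSurgery h).homogeneous
    (fun _ _ _ _ => rfl) ?_
  ext s u
  have := (hasSurgery h).finsum_khCoeff_mul s u
  rw [finsum_eq_sum_of_fintype] at this
  exact this

end LinkDiagram

theorem theorem1p2 {X A : Type*} [Fintype X] [LinearOrder X] [Finite A]
    (L : LinkDiagram X A) (hL : L.Connected)
    (black : L.Face → Prop) (hblack : L.IsCheckerboard black) (dot : A) :
    L.CKh.IsComplex ∧
    L.CKh.IsAcyclicMatching (L.Matched black dot) ∧
    Set.BijOn (L.criticalState black dot) Set.univ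
      {s | BasedComplex.IsCritical (L.Matched black dot) s} ∧
    (L.CST black dot).IsComplex ∧
    ∀ i j : ℤ, Nonempty ((L.CST black dot).Cohomology i j ≃ₗ[ℤ] L.CKh.Cohomology i j) := by
  have hM := LinkDiagram.isAcyclicMatching (dot := dot) hL hblack
  have hφ := LinkDiagram.bijOn_criticalState (dot := dot) hL hblack
  have hs := LinkDiagram.hasSurgery hblack
  exact ⟨LinkDiagram.isComplex_CKh hblack, hM, hφ,
    hM.morse hs.homogeneous hs.finsum_khCoeff_mul (K' := L.CST black dot) hφ
      (fun _ => rfl) (fun _ => rfl) fun T T' _ => LinkDiagram.stCoeff_eq hblack T T'⟩
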